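/- Let $k$ be a field, $Q$ a quiver (not necessarily finite), $\rho$ a set of paths of length $\ge 2$ in $Q$, and $\Lambda = kQ/(\rho)$ a string algebra: every vertex is the head of at most two arrows and the tail of at most two arrows, and for every arrow $y$ there is at most one path $xy$ of length $2$ with $xy\notin\rho$ and at most one path $yz$ of length $2$ with $yz\notin\rho$. (In a path $x_1x_2\cdots x_m$ the tail of $x_i$ is the head of $x_{i+1}$.) Modules are left $\Lambda$-modules $M$ with $\Lambda M = M$; thus $M=\bigoplus_v e_vM$, where $e_v$ is the trivial path at the vertex $v$. A module $M$ is *finitely controlled* if for every $a\in\Lambda$ the set $aM$ is contained in a finitely generated submodule of $M$. *Words.* A letter is an arrow $x$ (direct) or its formal inverse $x^{-1}$ (inverse), whose head is the tail of $x$ and whose tail is the head of $x$. Let $I$ be $\{0,\dots,n\}$ ($n\ge 0$), $\mathbb N$, $-\mathbb N$ or $\mathbb Z$. An $I$-word $C$ consists of letters $C_i$ for all $i$ with $i,i-1\in I$, such that for consecutive letters the tail of $C_i$ is the head of $C_{i+1}$ and $C_i^{-1}\ne C_{i+1}$, and such that no $x_1\cdots x_m\in\rho$ and no inverse $x_m^{-1}\cdots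 x_1^{-1}$ of it occurs as a sequence of consecutive letters of $C$; for $I=\{0\}$ it consists of a vertex. It has vertices $v_i(C)$ $(i\in I)$, where $v_i(C)$ is the tail of $C_i$ or the head of $C_{i+1}$. For $i\in I$ put $C_{>i}=C_{i+1}C_{i+2}\cdots$ and $(C_{\le i})^{-1}=C_i^{-1}C_{i-1}^{-1}\cdots$. *String and band modules.* The string module $M(C)$ has $k$-basis $b_i$ $(i\in I)$, with $e_vb_i=b_i$ if $v_i(C)=v$ and $e_vb_i=0$ otherwise, and, for an arrow $x$, $xb_i=b_{i-1}$ if $C_i=x$, $xb_i=b_{i+1}$ if $C_{i+1}=x^{-1}$, and $xb_i=0$ otherwise. If $C$ is a periodic $\mathbb Z$-word of (minimal) period $n$, then $M(C)$ is a $\Lambda$-$k[T,T^{-1}]$-bimodule with $T$ acting by $b_i\mapsto b_{i-n}$, and for a $k[T,T^{-1}]$-module $V$ one puts $M(C,V)=M(C)\otimes_{k[T,T^{-1}]}V$. The band modules are the $M(C,V)$ with $V$ finite-dimensional and indecomposable. *Primitive cycles and primitive torsion.* A primitive cycle $P$ is a non-trivial path from a vertex to itself such that ${}^\infty P^\infty=\cdots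 P\,|\,PP\cdots$ is a periodic $\mathbb Z$-word of period equal to the length of $P$. Let $z_v\in\Lambda$ be the sum of the (at most two) primitive cycles with head $v$; the polynomial ring $k[z]$ acts on a module $M$, with $z$ acting as $z_v$ on $e_vM$. Put $\tau^1(M)=\{m\in M: f(z)m=0 \text{ for some } f\in k[z] \text{ with } f(0)=1\}$. A primitive simple is a simple module $S$ with $\tau^1(S)=S$. *$P$-peaks.* Let $P$ be a primitive cycle and $C$ an $I$-word. An index $i\in I$ is a $P$-peak for $C$ if one of the two words $C_{>i}$ and $(C_{\le i})^{-1}$ is equal to $(P^{-1})^\infty=P^{-1}P^{-1}\cdots$, and the other one is not of the form $PD$ with a word $D$. **Theorem.** Let $S$ be a primitive simple, $M$ a finitely controlled $\Lambda$-module, and $N$ a submodule of $M$ with $\tau^1(M)\subseteq N$ and $M/N\cong S$. Suppose that $N=\bigoplus_{\lambda\in\Phi}N_\lambda$, where every $N_\lambda$ is a submodule isomorphic to a string module or a band module. Then $S\cong M({}^\infty P^\infty,V)$ for some primitive cycle $P$ and some simple $k[T,T^{-1}]$-module $V$. Moreover, for every primitive cycle $P$ for which such a $V$ exists, there are $\mu\in\Phi$,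 a word $C$ which has a $P$-peak and satisfies $N_\mu\cong M(C)$, and a submodule $N'_\mu$ of $M$ with $N'_\mu\cong N_\mu$, such that $$M = N'_\mu\oplus N',\qquad N'=\bigoplus_{\lambda\in\Phi\smallsetminus\{\mu\}}N_\lambda .$$ -/

import Mathlib

noncomputable section

open scoped Classical

namespace StringAlg

universe u v w

/-! ### Quivers and paths

An arrow `x : a ⟶ b` has tail `a` and head `b`. Paths are written as in `x₁ x₂ ⋯ xₘ`, where the
tail of `xᵢ` is the head of `xᵢ₊₁`; so the leftmost arrow is the last one that is traversed. -/

/-- The arrows of the quiver `Q`. -/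
abbrev Arrow (Q : Type v) [Quiver.{w} Q] := Quiver.Total Q

/-- The paths of the quiver `Q` (including the trivial ones). -/
structure QPath (Q : Type v) [Quiver.{w} Q] where
  tail : Q
  head : Q
  path : Quiver.Path tail head

section Paths

variable {Q : Type v} [Quiver.{w} Q]

/-- The list `[x₁, …, xₘ]` of the arrows of a path `x₁ ⋯ xₘ`. -/
def arrows {a b : Q} : Quiver.Path a b → List (Arrow Q)
  | .nil => []
  | .cons p x => ⟨_, _, x⟩ :: arrows p

theorem length_arrows {a b : Q} (p : Quiver.Path a b) : (arrows p).length = p.length := by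
  induction p with
  | nil => rfl
  | cons p x ih => simp [arrows, ih]

/-- The product `p q` (first `q`, then `p`) of two paths, if the tail of `p` is the head of `q`. -/
def QPath.mul? (p q : QPath Q) : Option (QPath Q) :=
  if h : p.tail = q.head then some ⟨q.tail, p.head, q.path.comp (p.path.cast h rfl)⟩ else none

/-- The trivial path at a vertex. -/
def QPath.triv (a : Q) : QPath Q := ⟨a, a, .nil⟩

/-- An arrow as a path of length one. -/
def QPath.ofArrow (x : Arrow Q) : QPath Q := ⟨x.left, x.right, x.hom.toPath⟩

/-- `kQ/(ρ)` is a string algebra: `ρ` is a set of paths of length `≥ 2`, and conditions (a) and (b)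
in the definition of a string algebra hold. -/
structure IsString (ρ : Set (QPath Q)) : Prop where
  two_le : ∀ p ∈ ρ, 2 ≤ p.path.length
  heads : ∀ a : Q, {x : Arrow Q | x.right = a}.encard ≤ 2
  tails : ∀ a : Q, {x : Arrow Q | x.left = a}.encard ≤ 2
  left_unique : ∀ {a b : Q} (y : a ⟶ b),
    {p : QPath Q | p ∉ ρ ∧ ∃ (c : Q) (x : b ⟶ c), p = ⟨a, c, y.toPath.cons x⟩}.Subsingleton
  right_unique : ∀ {a b : Q} (y : a ⟶ b),
    {p : QPath Q | p ∉ ρ ∧ ∃ (c : Q) (z : c ⟶ a), p = ⟨c, b, z.toPath.cons y⟩}.Subsingleton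

end Paths

/-! ### The path algebra `kQ` (without a unit in general) -/

/-- The path algebra: the vector space with basis the paths of `Q`. -/
def PathAlgebra (k : Type u) (Q : Type v) [Field k] [Quiver.{w} Q] := QPath Q →₀ k

section PathAlgebra

variable {k : Type u} {Q : Type v} [Field k] [Quiver.{w} Q]

instance : AddCommGroup (PathAlgebra k Q) := inferInstanceAs (AddCommGroup (QPath Q →₀ k))

instance : Module k (PathAlgebra k Q) := inferInstanceAs (Module k (QPath Q →₀ k))

/-- A path, as an element of the path algebra. -/
def PathAlgebra.of (k : Type u) [Field k] (p : QPath Q) : PathAlgebra k Q := Finsupp.single p 1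

/-- The product of two paths in the path algebra. -/
def PathAlgebra.pathMul (k : Type u) [Field k] (p q : QPath Q) : PathAlgebra k Q :=
  (p.mul? q).elim 0 (PathAlgebra.of k)

/-- The linear map on the path algebra with given values on paths. -/
def PathAlgebra.lin {A : Type*} [AddCommGroup A] [Module k A] (f : QPath Q → A) :
    PathAlgebra k Q →ₗ[k] A :=
  Finsupp.linearCombination k f

@[simp] theorem PathAlgebra.lin_of {A : Type*} [AddCommGroup A] [Module k A] (f : QPath Q → A)
    (p : QPath Q) : PathAlgebra.lin f (PathAlgebra.of k p) = f p :=
  (Finsupp.linearCombination_single k 1 p).trans (one_smul k (f p))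

theorem PathAlgebra.hom_ext {A : Type*} [AddCommGroup A] [Module k A]
    {f g : PathAlgebra k Q →ₗ[k] A}
    (h : ∀ p, f (PathAlgebra.of k p) = g (PathAlgebra.of k p)) : f = g :=
  Finsupp.lhom_ext' fun p => LinearMap.ext_ring (h p)

theorem PathAlgebra.induction {P : PathAlgebra k Q → Prop} (h0 : P 0)
    (hadd : ∀ a b, P a → P b → P (a + b)) (hof : ∀ (t : k) p, P (t • PathAlgebra.of k p))
    (a : PathAlgebra k Q) : P a :=
  Finsupp.induction_linear a h0 hadd fun p t => by
    have h3 : t • PathAlgebra.of k p = Finsupp.single p t := Finsupp.smul_single_one p t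
    exact h3 ▸ hof t p

/-- The multiplication of the path algebra, as a bilinear map. -/
def PathAlgebra.mulₗ : PathAlgebra k Q →ₗ[k] PathAlgebra k Q →ₗ[k] PathAlgebra k Q :=
  PathAlgebra.lin fun p => PathAlgebra.lin fun q => PathAlgebra.pathMul k p q

instance : Mul (PathAlgebra k Q) := ⟨fun a b => PathAlgebra.mulₗ a b⟩

theorem PathAlgebra.mul_def (a b : PathAlgebra k Q) : a * b = PathAlgebra.mulₗ a b := rfl

theorem PathAlgebra.of_mul_of (p q : QPath Q) :
    PathAlgebra.of k p * PathAlgebra.of k q = PathAlgebra.pathMul k p q := by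
  simp [PathAlgebra.mul_def, PathAlgebra.mulₗ]

theorem PathAlgebra.of_mul_of_assoc (p q r : QPath Q) :
    PathAlgebra.of k p * PathAlgebra.of k q * PathAlgebra.of k r =
      PathAlgebra.of k p * (PathAlgebra.of k q * PathAlgebra.of k r) := by
  obtain ⟨a, b, p⟩ := p
  obtain ⟨c, d, q⟩ := q
  obtain ⟨e, f, r⟩ := r
  have h0 : ∀ a : PathAlgebra k Q, 0 * a = 0 := fun a => by simp [PathAlgebra.mul_def]
  have h1 : ∀ a : PathAlgebra k Q, a * 0 = 0 := fun a => by simp [PathAlgebra.mul_def]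
  by_cases h : a = d <;> by_cases h' : c = f
  · subst h h'
    simp [PathAlgebra.of_mul_of, PathAlgebra.pathMul, QPath.mul?]
  · subst h
    simp [PathAlgebra.of_mul_of, PathAlgebra.pathMul, QPath.mul?, h', h1]
  · subst h'
    simp [PathAlgebra.of_mul_of, PathAlgebra.pathMul, QPath.mul?, h, h0]
  · simp [PathAlgebra.of_mul_of, PathAlgebra.pathMul, QPath.mul?, h, h', h0, h1]

instance : NonUnitalRing (PathAlgebra k Q) where
  left_distrib a b c := by simp [PathAlgebra.mul_def]
  right_distrib a b c := by simp [PathAlgebra.mul_def]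
  zero_mul a := by simp [PathAlgebra.mul_def]
  mul_zero a := by simp [PathAlgebra.mul_def]
  mul_assoc a b c := by
    let m := PathAlgebra.mulₗ (k := k) (Q := Q)
    have h : (LinearMap.compr₂ m m) =
        ((LinearMap.llcomp k _ _ _).compl₁₂ m LinearMap.id |>.flip.comp m).flip := by
      refine PathAlgebra.hom_ext fun p => PathAlgebra.hom_ext fun q => PathAlgebra.hom_ext fun r => ?_
      exact PathAlgebra.of_mul_of_assoc (k := k) p q r
    exact congrArg (fun f => f a b c) h

instance : IsScalarTower k (PathAlgebra k Q) (PathAlgebra k Q) :=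
  ⟨fun t a b => by simp [PathAlgebra.mul_def]⟩

instance : SMulCommClass k (PathAlgebra k Q) (PathAlgebra k Q) :=
  ⟨fun t a b => by simp [PathAlgebra.mul_def]⟩

end PathAlgebra
/-! ### The algebra `Λ = kQ/(ρ)` and its modules

`Λ` has no unit if `Q` has infinitely many vertices. Modules over `Λ` (as a `k`-algebra that may
lack a unit) are the same as modules over the unital algebra `k ⊕ Λ = (k ⊕ kQ)/(ρ)`. -/

section Alg

variable {Q : Type v} [Quiver.{w} Q]

/-- The generators of the ideal `(ρ)`. -/
inductive ZeroRel (k : Type u) [Field k] (ρ : Set (QPath Q)) :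
    Unitization k (PathAlgebra k Q) → Unitization k (PathAlgebra k Q) → Prop
  | mk (p : QPath Q) (hp : p ∈ ρ) :
      ZeroRel k ρ (Unitization.inr (PathAlgebra.of k p)) 0

/-- The algebra `k ⊕ Λ`, where `Λ = kQ/(ρ)`. -/
def UAlg (k : Type u) [Field k] (ρ : Set (QPath Q)) := RingQuot (ZeroRel k ρ)

variable (k : Type u) [Field k] (ρ : Set (QPath Q))

instance : Ring (UAlg k ρ) := inferInstanceAs (Ring (RingQuot (ZeroRel k ρ)))

instance : Algebra k (UAlg k ρ) := inferInstanceAs (Algebra k (RingQuot (ZeroRel k ρ)))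

/-- The quotient map `k ⊕ kQ → k ⊕ Λ`. -/
def UAlg.mk : Unitization k (PathAlgebra k Q) →ₐ[k] UAlg k ρ := RingQuot.mkAlgHom k (ZeroRel k ρ)

/-- The subset `Λ` of `k ⊕ Λ`: the image of `kQ`. -/
def Lam : Set (UAlg k ρ) := Set.range fun a : PathAlgebra k Q => UAlg.mk k ρ (Unitization.inr a)

/-- A path, as an element of `Λ`. -/
def pathElt (p : QPath Q) : UAlg k ρ := UAlg.mk k ρ (Unitization.inr (PathAlgebra.of k p))

/-- The idempotent `e_a` of `Λ` at the vertex `a`. -/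
def idem (a : Q) : UAlg k ρ := pathElt k ρ (QPath.triv a)

/-- An arrow, as an element of `Λ`. -/
def arrowElt (x : Arrow Q) : UAlg k ρ := pathElt k ρ (QPath.ofArrow x)

section Modules

variable (M : Type*) [AddCommGroup M] [Module (UAlg k ρ) M]

/-- `M` is a unital `Λ`-module: `Λ M = M`. -/
def IsUnital : Prop :=
  Submodule.span (UAlg k ρ) {y : M | ∃ a ∈ Lam k ρ, ∃ m : M, y = a • m} = ⊤

/-- `M` is finitely controlled: for every `a ∈ Λ`, the set `a M` is contained in a finitely
generated submodule of `M`. -/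
def IsFinitelyControlled : Prop :=
  ∀ a ∈ Lam k ρ, ∃ F : Submodule (UAlg k ρ) M, F.FG ∧ ∀ m : M, a • m ∈ F

end Modules

/-! #### Modules given by the action of the vertices and arrows -/

variable {k}
variable {A : Type*} [Ring A] [Algebra k A] (e : Q → A) (f : Arrow Q → A)

/-- The product `f x₁ ⋯ f xₘ` for a path `x₁ ⋯ xₘ`, and `e a` for the trivial path at `a`. -/
def evalPath {a : Q} : {b : Q} → Quiver.Path a b → A
  | _, .nil => e a
  | _, .cons p x => f ⟨_, _, x⟩ * evalPath p

variable {e f}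

theorem evalPath_comp (he : ∀ a, e a * e a = e a) (hl : ∀ x, e x.right * f x = f x) {a b c : Q}
    (q : Quiver.Path a b) (p : Quiver.Path b c) :
    evalPath e f (q.comp p) = evalPath e f p * evalPath e f q := by
  induction p with
  | nil =>
    cases q with
    | nil => simp [evalPath, he]
    | cons q x => simp [evalPath, ← mul_assoc, hl ⟨_, _, x⟩]
  | cons p x ih => simp [evalPath, ih, mul_assoc]

theorem evalPath_mul_zero (he' : ∀ a b, a ≠ b → e a * e b = 0) (he : ∀ a, e a * e a = e a)
    (hl : ∀ x, e x.right * f x = f x) {a b c d : Q}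
    (q : Quiver.Path a b) (p : Quiver.Path c d) (h : c ≠ b) :
    evalPath e f p * evalPath e f q = 0 := by
  have h1 : evalPath e f p = evalPath e f p * e c := by
    simpa [evalPath] using evalPath_comp he hl (.nil : Quiver.Path c c) p
  have h2 : evalPath e f q = e b * evalPath e f q := by
    simpa [evalPath] using evalPath_comp he hl q (.nil : Quiver.Path b b)
  rw [h1, h2, mul_assoc, ← mul_assoc (e c), he' _ _ h]
  simp

/-- The homomorphism `kQ → A` given by suitable images of the vertices and the arrows. -/
def pathLift (he' : ∀ a b, a ≠ b → e a * e b = 0) (he : ∀ a, e a * e a = e a)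
    (hl : ∀ x, e x.right * f x = f x) :
    PathAlgebra k Q →ₙₐ[k] A where
  __ := PathAlgebra.lin (k := k) fun p => evalPath e f p.path
  map_zero' := by simp
  map_mul' a b := by
    let φ : PathAlgebra k Q →ₗ[k] A := PathAlgebra.lin fun p => evalPath e f p.path
    have h : (PathAlgebra.mulₗ (k := k) (Q := Q)).compr₂ φ =
        (LinearMap.mul k A).compl₁₂ φ φ := by
      refine PathAlgebra.hom_ext fun p => PathAlgebra.hom_ext fun q => ?_
      obtain ⟨a, b, p⟩ := p
      obtain ⟨c, d, q⟩ := q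
      have := PathAlgebra.of_mul_of (k := k) ⟨a, b, p⟩ ⟨c, d, q⟩
      rw [PathAlgebra.mul_def] at this
      simp only [LinearMap.compr₂_apply, this, LinearMap.compl₁₂_apply, LinearMap.mul_apply', φ,
        PathAlgebra.lin_of]
      by_cases h : a = d
      · subst h
        simp [PathAlgebra.pathMul, QPath.mul?, evalPath_comp he hl]
      · simp [PathAlgebra.pathMul, QPath.mul?, h, evalPath_mul_zero he' he hl q p h]
    exact congrArg (fun f => f a b) h
  map_smul' := by simp

/-- The homomorphism `k ⊕ Λ → A` given by suitable images of the vertices and the arrows. -/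
def UAlg.lift (he' : ∀ a b, a ≠ b → e a * e b = 0) (he : ∀ a, e a * e a = e a)
    (hl : ∀ x, e x.right * f x = f x)
    (hρ : ∀ p ∈ ρ, evalPath e f p.path = 0) : UAlg k ρ →ₐ[k] A :=
  RingQuot.liftAlgHom k ⟨Unitization.lift (pathLift he' he hl), by
    rintro _ _ ⟨p, hp⟩
    simpa [pathLift] using hρ p hp⟩

theorem UAlg.lift_pathElt (he' : ∀ a b, a ≠ b → e a * e b = 0) (he : ∀ a, e a * e a = e a)
    (hl : ∀ x, e x.right * f x = f x)
    (hρ : ∀ p ∈ ρ, evalPath e f p.path = 0) (p : QPath Q) :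
    UAlg.lift (k := k) ρ he' he hl hρ (pathElt k ρ p) = evalPath e f p.path := by
  refine (RingQuot.liftAlgHom_mkAlgHom_apply k _ _ _).trans ?_
  simp [pathLift]

/-- `k ⊕ Λ` is spanned over `k` by the unit and the paths. -/
theorem UAlg.induction {P : UAlg k ρ → Prop} (h1 : P 1) (hp : ∀ p, P (pathElt k ρ p))
    (hadd : ∀ a b, P a → P b → P (a + b)) (hsmul : ∀ (t : k) a, P a → P (t • a)) (a : UAlg k ρ) :
    P a := by
  obtain ⟨a, rfl⟩ := RingQuot.mkAlgHom_surjective k (ZeroRel k ρ) a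
  change P (UAlg.mk k ρ a)
  induction a using Unitization.ind with
  | inl_add_inr r a =>
    rw [map_add]
    refine hadd _ _ ?_ ?_
    · have : (Unitization.inl r : Unitization k (PathAlgebra k Q)) = r • 1 := by
        ext <;> simp
      rw [this, map_smul, map_one]
      exact hsmul _ _ h1
    · induction a using PathAlgebra.induction with
      | h0 =>
        have := hsmul 0 _ h1
        rw [zero_smul] at this
        rw [Unitization.inr_zero, map_zero]
        exact this
      | hadd a b ha hb =>
        rw [Unitization.inr_add, map_add]
        exact hadd _ _ ha hb
      | hof t p =>
        rw [Unitization.inr_smul, map_smul]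
        exact hsmul t _ (hp p)

end Alg

/-! ### Letters and words -/

/-- A letter: an arrow `x` (a direct letter) or its formal inverse `x⁻¹` (an inverse letter). -/
inductive Letter (Q : Type v) [Quiver.{w} Q]
  | dir (x : Arrow Q)
  | inv (x : Arrow Q)

section Words

variable {Q : Type v} [Quiver.{w} Q]

/-- The inverse of a letter. -/
def Letter.inverse : Letter Q → Letter Q
  | .dir x => .inv x
  | .inv x => .dir x

/-- The head of a letter. -/
def Letter.head : Letter Q → Q
  | .dir x => x.right
  | .inv x => x.left

/-- The tail of a letter. -/
def Letter.tail : Letter Q → Q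
  | .dir x => x.left
  | .inv x => x.right

/-- The letters `x₁, …, xₘ` of a path `x₁ ⋯ xₘ`. -/
def dirLetters {a b : Q} (p : Quiver.Path a b) : List (Letter Q) := (arrows p).map .dir

/-- The letters `xₘ⁻¹, …, x₁⁻¹` of the inverse of a path `x₁ ⋯ xₘ`. -/
def invLetters {a b : Q} (p : Quiver.Path a b) : List (Letter Q) := (arrows p).reverse.map .inv

/-- The types of index sets of words. -/
inductive Shape
  | fin (n : ℕ)
  | nat
  | negNat
  | int

/-- The index sets `{0, …, n}`, `ℕ`, `-ℕ` and `ℤ`. -/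
def Shape.idx : Shape → Set ℤ
  | .fin n => Set.Icc 0 (n : ℤ)
  | .nat => Set.Ici 0
  | .negNat => Set.Iic 0
  | .int => Set.univ

/-- The list `L` occurs in the sequence `c`, as a sequence of consecutive letters starting at
position `i`. -/
def OccursAt (c : ℤ → Option (Letter Q)) (i : ℤ) (L : List (Letter Q)) : Prop :=
  ∀ j : ℕ, j < L.length → c (i + j) = L[j]?

/-- An `I`-word `C` for the string algebra `kQ/(ρ)`. Here `letter i` is the letter `Cᵢ`, which is
present if and only if `i` and `i - 1` are in `I`, and `vertex i` is the vertex `vᵢ(C)`, which is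
present if and only if `i` is in `I`. For `I = {0}` one gets the trivial word at a vertex. -/
structure Word (ρ : Set (QPath Q)) where
  shape : Shape
  vertex : ℤ → Option Q
  letter : ℤ → Option (Letter Q)
  vertex_isSome : ∀ i, (vertex i).isSome ↔ i ∈ shape.idx
  letter_isSome : ∀ i, (letter i).isSome ↔ i ∈ shape.idx ∧ i - 1 ∈ shape.idx
  vertex_tail : ∀ i l, letter i = some l → vertex i = some l.tail
  vertex_head : ∀ i l, letter i = some l → vertex (i - 1) = some l.head
  not_inverse : ∀ i l, letter i = some l → letter (i + 1) ≠ some l.inverse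
  not_rel : ∀ p ∈ ρ, ∀ i, ¬ OccursAt letter i (dirLetters p.path)
  not_rel_inv : ∀ p ∈ ρ, ∀ i, ¬ OccursAt letter i (invLetters p.path)

namespace Word

variable {ρ : Set (QPath Q)} (C : Word ρ)

/-- `C` is a `ℤ`-word with `C = C[n]`, where `n > 0`, and `n` is minimal with this property. -/
structure HasPeriod (n : ℕ) : Prop where
  shape_eq : C.shape = .int
  pos : 0 < n
  periodic : ∀ i, C.letter (i + n) = C.letter i
  minimal : ∀ m : ℕ, 0 < m → (∀ i, C.letter (i + m) = C.letter i) → n ≤ m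

/-- `C` is the `ℤ`-word `∞P∞ = ⋯ P | P P ⋯`. -/
def IsBiInfinitePower {a : Q} (P : Quiver.Path a a) : Prop :=
  C.shape = .int ∧ ∀ i : ℤ, C.letter i = (dirLetters P)[((i - 1) % (P.length : ℤ)).toNat]?

/-- The two words which start at position `i` of `C`, namely `C_{>i}` (for `d = true`) and
`(C_{≤i})⁻¹` (for `d = false`): `C.side i d n` is the letter number `n + 1` of that word. -/
def side (i : ℤ) (d : Bool) (n : ℕ) : Option (Letter Q) :=
  if d then C.letter (i + 1 + n) else (C.letter (i - n)).map Letter.inverse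

/-- The word at position `i` in direction `d` is `(P⁻¹)^∞`. -/
def IsDeepSide {a : Q} (P : Quiver.Path a a) (i : ℤ) (d : Bool) : Prop :=
  ∀ n : ℕ, C.side i d n = (invLetters P)[n % P.length]?

/-- The word at position `i` in direction `d` is of the form `P D` for some word `D`. -/
def StartsWith {a : Q} (P : Quiver.Path a a) (i : ℤ) (d : Bool) : Prop :=
  ∀ n : ℕ, n < P.length → C.side i d n = (dirLetters P)[n]?

/-- `i` is a `P`-peak for `C`: one of the two words at position `i` is `(P⁻¹)^∞` (that is, `i` is
`P`-deep), and the other one is not of the form `P D`. If `P` has sign `ε`, then `(P⁻¹)^∞` has sign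
`-ε`, so the first one of the two words is `C(i, -ε)` and the other one is `C(i, ε)`. -/
def IsPeak {a : Q} (P : Quiver.Path a a) (i : ℤ) : Prop :=
  i ∈ C.shape.idx ∧ ∃ d : Bool, C.IsDeepSide P i d ∧ ¬ C.StartsWith P i (!d)

end Word

/-- `P` is a primitive cycle: a non-trivial direct word, such that `∞P∞` is a periodic
`ℤ`-word of period equal to the length of `P`. -/
def IsPrimitiveCycle (ρ : Set (QPath Q)) {a : Q} (P : Quiver.Path a a) : Prop :=
  ∃ C : Word ρ, C.IsBiInfinitePower P ∧ C.HasPeriod P.length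

end Words

/-! ### Primitive torsion -/

section Torsion

variable {Q : Type v} [Quiver.{w} Q] (k : Type u) [Field k] (ρ : Set (QPath Q))

/-- The sum `z_a` of all primitive cycles with head `a`. (There are at most two of them.) -/
def zElt (a : Q) : UAlg k ρ :=
  ∑ᶠ P : {P : Quiver.Path a a // IsPrimitiveCycle ρ P}, pathElt k ρ ⟨a, a, P⟩

variable (M : Type*) [AddCommGroup M] [Module (UAlg k ρ) M]

/-- The primitive torsion `τ¹(M)` of a unital module: the set of all `m` with `f(z) m = 0` for some
polynomial `f` with `f(0) = 1`. Here `z` acts on `M = ⨁ e_a M` as multiplication by `z_a` on `e_a M`,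
so that `f(z) m` has component `f(z_a) e_a m` in `e_a M`. -/
def primitiveTorsion : Set M :=
  {m | ∃ f : Polynomial k, f.eval 0 = 1 ∧
    ∀ a : Q, Polynomial.aeval (zElt k ρ a) f • (idem k ρ a • m) = 0}

end Torsion

/-! ### String modules -/

section StringModules

variable {Q : Type v} [Quiver.{w} Q] (k : Type u) [Field k] {ρ : Set (QPath Q)}

/-- The string module `M(C)`: the vector space with basis the symbols `bᵢ` with `i ∈ I`. -/
def StringModule (C : Word ρ) := C.shape.idx →₀ k

variable {k} (C : Word ρ)

instance : AddCommGroup (StringModule k C) := inferInstanceAs (AddCommGroup (C.shape.idx →₀ k))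

instance : Module k (StringModule k C) := inferInstanceAs (Module k (C.shape.idx →₀ k))

namespace StringModule

variable (k)

/-- The basis element `bᵢ` for `i ∈ I`. -/
def single (i : C.shape.idx) : StringModule k C := Finsupp.single i 1

/-- The basis element `bᵢ` for `i ∈ I`, and `0` for other `i`. -/
def b (i : ℤ) : StringModule k C :=
  if h : i ∈ C.shape.idx then single k C ⟨i, h⟩ else 0

variable {k}

/-- The linear map with given values on the basis elements. -/
def lin {A : Type*} [AddCommGroup A] [Module k A] (f : ℤ → A) : StringModule k C →ₗ[k] A :=
  Finsupp.linearCombination k fun i : C.shape.idx => f i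

theorem lin_b {A : Type*} [AddCommGroup A] [Module k A] (f : ℤ → A) {i : ℤ}
    (hi : i ∈ C.shape.idx) : lin C f (b k C i) = f i := by
  rw [b, dif_pos hi]
  exact (Finsupp.linearCombination_single k 1 _).trans (one_smul k _)

variable {C}

theorem hom_ext {A : Type*} [AddCommGroup A] [Module k A] {f g : StringModule k C →ₗ[k] A}
    (h : ∀ i ∈ C.shape.idx, f (b k C i) = g (b k C i)) : f = g :=
  Finsupp.lhom_ext' fun i => LinearMap.ext_ring <| by
    have := h i i.2
    rw [b, dif_pos i.2] at this
    exact this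

variable (k) (C)

/-- The action of `e_a` on `M(C)`: `e_a bᵢ = bᵢ` if `vᵢ(C) = a`, and `e_a bᵢ = 0` otherwise. -/
def idemAct (a : Q) : Module.End k (StringModule k C) :=
  lin C fun i => if C.vertex i = some a then b k C i else 0

/-- The action of an arrow `x` on `M(C)`: `x bᵢ` is `bᵢ₋₁` if `Cᵢ = x`, it is `bᵢ₊₁` if
`Cᵢ₊₁ = x⁻¹`, and it is `0` otherwise. -/
def arrowAct (x : Arrow Q) : Module.End k (StringModule k C) :=
  lin C fun i =>
    if C.letter i = some (.dir x) then b k C (i - 1)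
    else if C.letter (i + 1) = some (.inv x) then b k C (i + 1)
    else 0

variable {k} {C}

theorem mem_of_letter {i : ℤ} {l : Letter Q} (h : C.letter i = some l) :
    i ∈ C.shape.idx ∧ i - 1 ∈ C.shape.idx :=
  (C.letter_isSome i).1 (by simp [h])

theorem mem_of_letter_succ {i : ℤ} {l : Letter Q} (h : C.letter (i + 1) = some l) :
    i ∈ C.shape.idx ∧ i + 1 ∈ C.shape.idx := by
  have := mem_of_letter h
  simpa [and_comm] using this

theorem idemAct_b (a : Q) {i : ℤ} (hi : i ∈ C.shape.idx) :
    idemAct k C a (b k C i) = if C.vertex i = some a then b k C i else 0 := lin_b C _ hi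

theorem arrowAct_b (x : Arrow Q) {i : ℤ} (hi : i ∈ C.shape.idx) :
    arrowAct k C x (b k C i) =
      if C.letter i = some (.dir x) then b k C (i - 1)
      else if C.letter (i + 1) = some (.inv x) then b k C (i + 1)
      else 0 := lin_b C _ hi

theorem idemAct_mul_self (a : Q) : idemAct k C a * idemAct k C a = idemAct k C a := by
  refine hom_ext fun i hi => ?_
  simp only [Module.End.mul_apply, idemAct_b a hi]
  split_ifs with h
  · simp [idemAct_b a hi, h]
  · simp

theorem idemAct_mul_of_ne (a c : Q) (hac : a ≠ c) : idemAct k C a * idemAct k C c = 0 := by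
  refine hom_ext fun i hi => ?_
  simp only [Module.End.mul_apply, idemAct_b c hi]
  split_ifs with h
  · simp [idemAct_b a hi, h, hac.symm]
  · simp

theorem idemAct_mul_arrowAct (x : Arrow Q) :
    idemAct k C x.right * arrowAct k C x = arrowAct k C x := by
  refine hom_ext fun i hi => ?_
  simp only [Module.End.mul_apply, arrowAct_b x hi]
  split_ifs with h h'
  · simp [idemAct_b _ (mem_of_letter h).2, C.vertex_head i _ h, Letter.head]
  · simp [idemAct_b _ (mem_of_letter h').1, C.vertex_tail _ _ h', Letter.tail]
  · simp

/-- A non-trivial path acts on a basis element by moving along `C` in one direction. -/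
theorem evalPath_b {a c : Q} (p : Quiver.Path a c) {i : ℤ} (hi : i ∈ C.shape.idx) :
    evalPath (idemAct k C) (arrowAct k C) p (b k C i) = 0 ∨
    (OccursAt C.letter (i - p.length + 1) (dirLetters p) ∧ i - p.length ∈ C.shape.idx ∧
      evalPath (idemAct k C) (arrowAct k C) p (b k C i) = b k C (i - p.length)) ∨
    (OccursAt C.letter (i + 1) (invLetters p) ∧ i + p.length ∈ C.shape.idx ∧
      evalPath (idemAct k C) (arrowAct k C) p (b k C i) = b k C (i + p.length)) := by
  induction p with
  | nil =>
    rw [evalPath, idemAct_b a hi]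
    split_ifs with h
    · exact Or.inr (Or.inl ⟨by simp [OccursAt, dirLetters, arrows], by simpa using hi, by simp⟩)
    · exact Or.inl rfl
  | @cons d c p x ih =>
    rw [evalPath, Module.End.mul_apply]
    have hd : dirLetters (p.cons x) = .dir ⟨_, _, x⟩ :: dirLetters p := by
      simp [dirLetters, arrows]
    have hv : invLetters (p.cons x) = invLetters p ++ [.inv ⟨_, _, x⟩] := by
      simp [invLetters, arrows]
    have hdl : (dirLetters p).length = p.length := by simp [dirLetters, length_arrows]
    have hvl : (invLetters p).length = p.length := by simp [invLetters, length_arrows]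
    -- The two ways to extend an occurrence by one letter.
    have ed : OccursAt C.letter (i - p.length + 1) (dirLetters p) →
        C.letter (i - p.length) = some (.dir ⟨_, _, x⟩) →
        OccursAt C.letter (i - (p.cons x).length + 1) (dirLetters (p.cons x)) := by
      intro ho hx j hj
      rw [hd] at hj ⊢
      rcases j with _ | j
      · rw [show i - ((p.cons x).length : ℤ) + 1 + ((0 : ℕ) : ℤ) = i - p.length by
          simp only [Quiver.Path.length_cons]; push_cast; ring]
        simpa using hx
      · rw [show i - ((p.cons x).length : ℤ) + 1 + ((j + 1 : ℕ) : ℤ) = i - p.length + 1 + j by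
          simp only [Quiver.Path.length_cons]; push_cast; ring]
        simpa using ho j (by simpa using hj)
    have ev : OccursAt C.letter (i + 1) (invLetters p) →
        C.letter (i + p.length + 1) = some (.inv ⟨_, _, x⟩) →
        OccursAt C.letter (i + 1) (invLetters (p.cons x)) := by
      intro ho hx j hj
      rw [hv] at hj ⊢
      rcases lt_or_ge j p.length with h | h
      · rw [List.getElem?_append_left (by omega)]
        exact ho j (by omega)
      · have : j = p.length := by simp [hvl] at hj; omega
        subst this
        rw [List.getElem?_append_right (by omega), hvl, add_right_comm, hx]
        simp
    have nil_case : p.length = 0 → OccursAt C.letter (i - p.length + 1) (dirLetters p) ∧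
        OccursAt C.letter (i + 1) (invLetters p) := by
      intro h
      constructor <;> intro j hj <;> omega
    rcases ih with h | ⟨ho, hm, h⟩ | ⟨ho, hm, h⟩
    · exact Or.inl (by simp [h])
    · rw [h, arrowAct_b _ hm]
      split_ifs with h1 h2
      · refine Or.inr (Or.inl ⟨ed ho h1, ?_, ?_⟩)
        · have := (mem_of_letter h1).2
          simpa [sub_sub] using this
        · simp [sub_sub]
      · rcases Nat.eq_zero_or_pos p.length with h0 | h0
        · have h2' : C.letter (i + p.length + 1) = some (.inv ⟨_, _, x⟩) := by
            simpa [h0] using h2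
          refine Or.inr (Or.inr ⟨ev (nil_case h0).2 h2', ?_, ?_⟩)
          · simpa [add_assoc] using (mem_of_letter h2').1
          · simp [h0]
        · have := ho 0 (by omega)
          simp only [Nat.cast_zero, add_zero, h2] at this
          exfalso
          rw [List.getElem?_eq_getElem (by omega)] at this
          simp [dirLetters] at this
      · exact Or.inl rfl
    · rw [h, arrowAct_b _ hm]
      split_ifs with h1 h2
      · rcases Nat.eq_zero_or_pos p.length with h0 | h0
        · have h1' : C.letter (i - p.length) = some (.dir ⟨_, _, x⟩) := by
            simpa [h0] using h1
          refine Or.inr (Or.inl ⟨ed (nil_case h0).1 h1', ?_, ?_⟩)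
          · simpa [sub_sub] using (mem_of_letter h1').2
          · simp [h0]
        · have := ho (p.length - 1) (by omega)
          rw [show i + 1 + ((p.length - 1 : ℕ) : ℤ) = i + p.length by omega, h1] at this
          exfalso
          rw [List.getElem?_eq_getElem (by omega)] at this
          simp [invLetters] at this
      · refine Or.inr (Or.inr ⟨ev ho h2, ?_, ?_⟩)
        · simpa [add_assoc] using (mem_of_letter h2).1
        · simp [add_assoc]
      · exact Or.inl rfl

theorem evalPath_rel (p : QPath Q) (hp : p ∈ ρ) :
    evalPath (idemAct k C) (arrowAct k C) p.path = 0 := by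
  refine hom_ext fun i hi => ?_
  rcases evalPath_b (k := k) p.path hi with h | ⟨ho, _⟩ | ⟨ho, _⟩
  · simpa using h
  · exact absurd ho (C.not_rel p hp _)
  · exact absurd ho (C.not_rel_inv p hp _)

variable (k C)

/-- The action of `k ⊕ Λ` on the string module `M(C)`. -/
def act : UAlg k ρ →ₐ[k] Module.End k (StringModule k C) :=
  UAlg.lift ρ (e := idemAct k C) (f := arrowAct k C) idemAct_mul_of_ne idemAct_mul_self
    idemAct_mul_arrowAct evalPath_rel

instance : Module (UAlg k ρ) (StringModule k C) :=
  Module.compHom (StringModule k C) (act k C).toRingHom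

variable {k C}

theorem smul_def (a : UAlg k ρ) (m : StringModule k C) : a • m = act k C a m := rfl

theorem idem_smul_b (a : Q) {i : ℤ} (hi : i ∈ C.shape.idx) :
    idem k ρ a • b k C i = if C.vertex i = some a then b k C i else 0 := by
  rw [smul_def, idem, act, UAlg.lift_pathElt]
  exact idemAct_b a hi

theorem arrowElt_smul_b (x : Arrow Q) {i : ℤ} (hi : i ∈ C.shape.idx) :
    arrowElt k ρ x • b k C i =
      if C.letter i = some (.dir x) then b k C (i - 1)
      else if C.letter (i + 1) = some (.inv x) then b k C (i + 1)
      else 0 := by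
  rw [smul_def, arrowElt, act, UAlg.lift_pathElt]
  change arrowAct k C x (idemAct k C x.left (b k C i)) = _
  rw [idemAct_b _ hi]
  split_ifs with h1 h2 h3 h3 h2
  · rw [arrowAct_b x hi, if_pos h2]
  · rw [arrowAct_b x hi, if_neg h2, if_pos h3]
  · rw [arrowAct_b x hi, if_neg h2, if_neg h3]
  · exact absurd (C.vertex_tail _ _ h3) h1
  · have := C.vertex_head _ _ h2
    simp only [add_sub_cancel_right] at this
    exact absurd this h1
  · simp

end StringModule
end StringModules

/-! ### Band modules -/

section BandModules

variable {Q : Type v} [Quiver.{w} Q] (k : Type u) [Field k] {ρ : Set (QPath Q)}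

/-- The `Λ`-`k[T,T⁻¹]`-bimodule `M(C)` for a periodic `ℤ`-word `C` of period `n`. -/
def Bimodule {C : Word ρ} {n : ℕ} (_ : C.HasPeriod n) := StringModule k C

variable {C : Word ρ} {n : ℕ} (h : C.HasPeriod n)

instance : AddCommGroup (Bimodule k h) := inferInstanceAs (AddCommGroup (StringModule k C))

instance : Module k (Bimodule k h) := inferInstanceAs (Module k (StringModule k C))

instance : Module (UAlg k ρ) (Bimodule k h) :=
  inferInstanceAs (Module (UAlg k ρ) (StringModule k C))

theorem Word.HasPeriod.mem {C : Word ρ} {n : ℕ} (h : C.HasPeriod n) (i : ℤ) :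
    i ∈ C.shape.idx := by
  rw [h.shape_eq]
  trivial

theorem Word.HasPeriod.letter_sub {C : Word ρ} {n : ℕ} (h : C.HasPeriod n) (m i : ℤ) :
    C.letter (i - m * n) = C.letter i := by
  have h1 : Function.Periodic C.letter (n : ℤ) := h.periodic
  have h2 := h1.int_mul m
  simpa using (h2 (i - m * n)).symm

theorem Word.HasPeriod.vertex_sub {C : Word ρ} {n : ℕ} (h : C.HasPeriod n) (m i : ℤ) :
    C.vertex (i - m * n) = C.vertex i := by
  obtain ⟨l, hl⟩ := Option.isSome_iff_exists.1 ((C.letter_isSome i).2 ⟨h.mem _, h.mem _⟩)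
  rw [C.vertex_tail _ _ hl, C.vertex_tail _ _ ((h.letter_sub m i).trans hl)]

/-- The power `t^m` of the isomorphism `t = t_{C,n} : M(C) → M(C)` with `t(bᵢ) = bᵢ₋ₙ`. -/
def shiftAct {C : Word ρ} {n : ℕ} (_ : C.HasPeriod n) (m : ℤ) :
    Module.End k (StringModule k C) :=
  StringModule.lin C fun i => StringModule.b k C (i - m * n)

theorem shiftAct_b (m i : ℤ) :
    shiftAct k h m (StringModule.b k C i) = StringModule.b k C (i - m * n) :=
  StringModule.lin_b C _ (h.mem i)

/-- The action of `k[T,T⁻¹]` on `M(C)`, with `T` acting as `t_{C,n}`. -/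
def laurentAct {C : Word ρ} {n : ℕ} (h : C.HasPeriod n) :
    LaurentPolynomial k →ₐ[k] Module.End k (StringModule k C) :=
  AddMonoidAlgebra.lift k (Module.End k (StringModule k C)) ℤ
    { toFun := fun m => shiftAct k h m.toAdd
      map_one' := StringModule.hom_ext fun i _ => by simp [shiftAct_b]
      map_mul' := fun m m' => StringModule.hom_ext fun i _ => by
        simp only [toAdd_mul, shiftAct_b, Module.End.mul_apply]
        congr 1
        ring }

instance : Module (LaurentPolynomial k) (Bimodule k h) :=
  Module.compHom (StringModule k C) (laurentAct k h).toRingHom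

theorem shiftAct_idemAct (m : ℤ) (a : Q) :
    Commute (shiftAct k h m) (StringModule.idemAct k C a) := by
  refine StringModule.hom_ext fun i hi => ?_
  simp only [Module.End.mul_apply, StringModule.idemAct_b a (h.mem _), shiftAct_b, h.vertex_sub]
  split_ifs <;> simp [shiftAct_b]

theorem shiftAct_arrowAct (m : ℤ) (x : Arrow Q) :
    Commute (shiftAct k h m) (StringModule.arrowAct k C x) := by
  refine StringModule.hom_ext fun i hi => ?_
  have h1 := h.letter_sub m (i + 1)
  rw [show i + 1 - m * n = i - m * n + 1 by ring] at h1
  simp only [Module.End.mul_apply, StringModule.arrowAct_b x (h.mem _), shiftAct_b, h.letter_sub,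
    h1]
  split_ifs
  · rw [shiftAct_b]; congr 1; ring
  · rw [shiftAct_b]; congr 1; ring
  · simp

theorem shiftAct_act (m : ℤ) (a : UAlg k ρ) :
    Commute (shiftAct k h m) (StringModule.act k C a) := by
  induction a using UAlg.induction with
  | h1 => simp
  | hadd a b ha hb => rw [map_add]; exact ha.add_right hb
  | hsmul t a ha => rw [map_smul]; exact ha.smul_right t
  | hp p =>
    obtain ⟨a, c, p⟩ := p
    rw [StringModule.act, UAlg.lift_pathElt]
    induction p with
    | nil => exact shiftAct_idemAct k h m _
    | cons p x ih => exact (shiftAct_arrowAct k h m _).mul_right ih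

theorem laurentAct_act (p : LaurentPolynomial k) (a : UAlg k ρ) :
    Commute (laurentAct k h p) (StringModule.act k C a) := by
  induction p using LaurentPolynomial.induction_on' with
  | add p q hp hq => rw [map_add]; exact hp.add_left hq
  | C_mul_T m t =>
    have : laurentAct k h (LaurentPolynomial.C t * LaurentPolynomial.T m) =
        t • shiftAct k h m := by
      rw [← LaurentPolynomial.single_eq_C_mul_T]
      exact AddMonoidAlgebra.lift_single _ _ _
    rw [this]
    exact (shiftAct_act k h m a).smul_left t

instance : SMulCommClass (LaurentPolynomial k) (UAlg k ρ) (Bimodule k h) :=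
  ⟨fun p a m => congrArg (fun f : Module.End k (StringModule k C) => f m)
    (laurentAct_act k h p a)⟩

/-- The module `M(C,V) = M(C) ⊗ V`, where the tensor product is over `k[T,T⁻¹]`. -/
abbrev BandModule (V : Type*) [AddCommGroup V] [Module (LaurentPolynomial k) V] :=
  TensorProduct (LaurentPolynomial k) (Bimodule k h) V

/-- `V` is an indecomposable module. -/
def IsIndecomposableModule (R : Type*) [Ring R] (V : Type*) [AddCommGroup V] [Module R V] : Prop :=
  Nontrivial V ∧ ∀ A B : Submodule R V, IsCompl A B → A = ⊥ ∨ B = ⊥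

variable (ρ) (M : Type*) [AddCommGroup M] [Module (UAlg k ρ) M]

/-- `M` is isomorphic to a string module. -/
def IsStringModule : Prop :=
  ∃ C : Word ρ, Nonempty (M ≃ₗ[UAlg k ρ] StringModule k C)

/-- `M` is isomorphic to a band module `M(C,V)`: here `C` is a periodic `ℤ`-word, and `V` is a
finite-dimensional indecomposable `k[T,T⁻¹]`-module. -/
def IsBandModule : Prop :=
  ∃ (C : Word ρ) (n : ℕ) (h : C.HasPeriod n) (V : Type u) (_ : AddCommGroup V)
    (_ : Module (LaurentPolynomial k) V),
    Module.Finite k (RestrictScalars k (LaurentPolynomial k) V) ∧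
    IsIndecomposableModule (LaurentPolynomial k) V ∧
    Nonempty (M ≃ₗ[UAlg k ρ] BandModule k h V)

/-- `M` is a primitive simple: a simple, primitive torsion module. -/
def IsPrimitiveSimple : Prop :=
  IsSimpleModule (UAlg k ρ) M ∧ primitiveTorsion k ρ M = Set.univ

/-- `M` is isomorphic to `M(∞P∞, V)`, where `P` is a primitive cycle and `V` is a simple
`k[T,T⁻¹]`-module. -/
def IsSimpleOfCycle {a : Q} (P : Quiver.Path a a) : Prop :=
  ∃ (C : Word ρ) (h : C.HasPeriod P.length) (V : Type u) (_ : AddCommGroup V)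
    (_ : Module (LaurentPolynomial k) V),
    C.IsBiInfinitePower P ∧ IsSimpleModule (LaurentPolynomial k) V ∧
    Nonempty (M ≃ₗ[UAlg k ρ] BandModule k h V)

end BandModules

end StringAlg

end

/-!
Let `P` be a primitive cycle, `p` its class in `Λ`, and let `s = π(m)` be an element of the simple
module `S` with `p s ≠ 0`. Since `S` is primitive torsion, `s` may be chosen such that it is killed
by `f(p)` for an irreducible polynomial `f = 1 + X f₁`. Then `f(p) m` lies in `N`, and one tries to
divide its components in the `N_λ` by `f(p)`. This succeeds up to primitive torsion for band
modules, which are finite-dimensional. In a string module `M(C)` every element is the sum of one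
that is killed by a power of `p`, which is divisible by `f(p)`, and one in the `k[p]`-span of the
(at most two) `P`-peaks of `C`; the word `^∞P^∞` is excluded because `M` is finitely controlled. If
the division succeeds for all `λ`, then correcting `m` by the quotients makes `p m` primitive
torsion, hence `p s = 0`, a contradiction. So it fails for some `N_μ ≅ M(C)`, and after modifying
`m` we may assume that the component of `f(p) m` in `M(C)` is `b + y`, where `b` is the basis
element of a peak and `y` lies on the other side of it. Adding to the embedding of `M(C)` the
homomorphism which sends `b` to `-p f₁(p) m` gives a monomorphism from `M(C)` with `m` in its image
modulo the other summands, and this image is the new summand.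
-/

noncomputable section

namespace StringAlg

universe u v w

section Products

variable {Q : Type v} [Quiver.{w} Q] {k : Type u} [Field k] {ρ : Set (QPath Q)}

theorem UAlg.mk_inr_mul (a b : PathAlgebra k Q) :
    UAlg.mk k ρ (Unitization.inr a) * UAlg.mk k ρ (Unitization.inr b) =
      UAlg.mk k ρ (Unitization.inr (a * b)) := by
  rw [← map_mul, Unitization.inr_mul]

theorem pathElt_mul_pathElt {a b c : Q} (p : Quiver.Path b c) (q : Quiver.Path a b) :
    pathElt k ρ ⟨b, c, p⟩ * pathElt k ρ ⟨a, b, q⟩ = pathElt k ρ ⟨a, c, q.comp p⟩ := by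
  rw [pathElt, pathElt, UAlg.mk_inr_mul, PathAlgebra.of_mul_of]
  simp [PathAlgebra.pathMul, QPath.mul?, pathElt]

theorem pathElt_mul_of_ne {p q : QPath Q} (h : p.tail ≠ q.head) :
    pathElt k ρ p * pathElt k ρ q = 0 := by
  rw [pathElt, pathElt, UAlg.mk_inr_mul, PathAlgebra.of_mul_of]
  simp [PathAlgebra.pathMul, QPath.mul?, h]

theorem pathElt_of_mem {p : QPath Q} (h : p ∈ ρ) : pathElt k ρ p = 0 := by
  have : UAlg.mk k ρ (Unitization.inr (PathAlgebra.of k p)) = UAlg.mk k ρ 0 :=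
    RingQuot.mkAlgHom_rel k (ZeroRel.mk p h)
  rw [pathElt, this, map_zero]

theorem pathElt_cons {a b c : Q} (p : Quiver.Path a b) (x : b ⟶ c) :
    pathElt k ρ ⟨a, c, p.cons x⟩ = arrowElt k ρ ⟨b, c, x⟩ * pathElt k ρ ⟨a, b, p⟩ :=
  (pathElt_mul_pathElt (x.toPath) p).symm

theorem idem_mul_self (a : Q) : idem k ρ a * idem k ρ a = idem k ρ a :=
  pathElt_mul_pathElt _ _

theorem idem_mul_of_ne {a b : Q} (h : a ≠ b) : idem k ρ a * idem k ρ b = 0 :=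
  pathElt_mul_of_ne h

theorem idem_mul_pathElt {a b : Q} (p : Quiver.Path a b) :
    idem k ρ b * pathElt k ρ ⟨a, b, p⟩ = pathElt k ρ ⟨a, b, p⟩ :=
  pathElt_mul_pathElt (.nil) p

theorem pathElt_mul_idem {a b : Q} (p : Quiver.Path a b) :
    pathElt k ρ ⟨a, b, p⟩ * idem k ρ a = pathElt k ρ ⟨a, b, p⟩ := by
  exact (pathElt_mul_pathElt p (.nil)).trans (by rw [Quiver.Path.nil_comp])

theorem idem_mul_arrowElt (x : Arrow Q) :
    idem k ρ x.right * arrowElt k ρ x = arrowElt k ρ x := idem_mul_pathElt _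

theorem arrowElt_mul_idem (x : Arrow Q) :
    arrowElt k ρ x * idem k ρ x.left = arrowElt k ρ x := pathElt_mul_idem _

/-- The arrows `x`, `y` form a path `x y` of length two which is not in `ρ`. -/
inductive Allowed (ρ : Set (QPath Q)) : Arrow Q → Arrow Q → Prop
  | mk {a b c : Q} (x : b ⟶ c) (y : a ⟶ b) (h : (⟨a, c, y.toPath.cons x⟩ : QPath Q) ∉ ρ) :
      Allowed ρ ⟨b, c, x⟩ ⟨a, b, y⟩

theorem Allowed.left_eq_right {x y : Arrow Q} (h : Allowed ρ x y) : x.left = y.right := by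
  cases h; rfl

theorem Allowed.left_unique (hρ : IsString ρ) {x x' y : Arrow Q} (h : Allowed ρ x y)
    (h' : Allowed ρ x' y) : x = x' := by
  cases h with
  | mk x y h =>
    cases h' with
    | mk x' _ h' =>
      have := hρ.left_unique y ⟨h, _, x, rfl⟩ ⟨h', _, x', rfl⟩
      simp only [QPath.mk.injEq, true_and] at this
      obtain ⟨rfl, this⟩ := this
      have := eq_of_heq this
      injection this with _ _ _ hx
      rw [hx]

theorem Allowed.right_unique (hρ : IsString ρ) {x y y' : Arrow Q} (h : Allowed ρ x y)
    (h' : Allowed ρ x y') : y = y' := by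
  cases h with
  | mk x y h =>
    cases h' with
    | mk _ y' h' =>
      have := hρ.right_unique x ⟨h, _, y, rfl⟩ ⟨h', _, y', rfl⟩
      simp only [QPath.mk.injEq, true_and] at this
      obtain ⟨rfl, this⟩ := this
      have := eq_of_heq this
      injection this with _ _ hy
      injection hy with _ _ _ hy
      rw [hy]

theorem arrowElt_mul_of_not_allowed {x y : Arrow Q} (h : ¬ Allowed ρ x y) :
    arrowElt k ρ x * arrowElt k ρ y = 0 := by
  obtain ⟨b, c, x⟩ := x
  obtain ⟨a, b', y⟩ := y
  by_cases hb : b = b'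
  · subst hb
    rw [arrowElt, arrowElt, QPath.ofArrow, QPath.ofArrow, pathElt_mul_pathElt]
    refine pathElt_of_mem ?_
    by_contra h'
    exact h (.mk x y h')
  · exact pathElt_mul_of_ne hb

theorem Word.allowed_of_dir (C : Word ρ) {i : ℤ} {x y : Arrow Q}
    (hx : C.letter i = some (.dir x)) (hy : C.letter (i + 1) = some (.dir y)) :
    Allowed ρ x y := by
  have hv := C.vertex_head _ _ hy
  rw [add_sub_cancel_right, C.vertex_tail _ _ hx] at hv
  obtain ⟨b, c, x⟩ := x
  obtain ⟨a, b', y⟩ := y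
  simp only [Letter.tail, Letter.head, Option.some.injEq] at hv
  subst hv
  refine .mk x y fun h => C.not_rel _ h i ?_
  intro j hj
  simp only [dirLetters, arrows, Quiver.Hom.toPath, List.map_cons, List.map_nil,
    List.length_cons, List.length_nil] at hj ⊢
  interval_cases j
  · simpa using hx
  · simpa using hy

theorem Word.allowed_of_inv (C : Word ρ) {i : ℤ} {x y : Arrow Q}
    (hx : C.letter i = some (.inv x)) (hy : C.letter (i + 1) = some (.inv y)) :
    Allowed ρ y x := by
  have hv := C.vertex_head _ _ hy
  rw [add_sub_cancel_right, C.vertex_tail _ _ hx] at hv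
  obtain ⟨a, b', x⟩ := x
  obtain ⟨b, c, y⟩ := y
  simp only [Letter.tail, Letter.head, Option.some.injEq] at hv
  subst hv
  refine .mk y x fun h => C.not_rel_inv _ h i ?_
  intro j hj
  simp only [invLetters, arrows, Quiver.Hom.toPath, List.reverse_cons, List.reverse_nil,
    List.nil_append, List.cons_append, List.map_cons, List.map_nil,
    List.length_cons, List.length_nil] at hj ⊢
  interval_cases j
  · simpa using hx
  · simpa using hy

theorem UAlg.induction_left {P : UAlg k ρ → Prop} (hone : P 1)
    (hadd : ∀ a b, P a → P b → P (a + b)) (hsmul : ∀ (t : k) a, P a → P (t • a))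
    (hidem : ∀ v, P (idem k ρ v)) (harrow : ∀ x a, P a → P (arrowElt k ρ x * a))
    (a : UAlg k ρ) : P a := by
  refine UAlg.induction ρ hone ?_ hadd hsmul a
  rintro ⟨a, b, p⟩
  induction p with
  | nil => exact hidem a
  | cons p x ih => rw [pathElt_cons]; exact harrow _ _ ih

section Modules

variable {X Y : Type*} [AddCommGroup X] [Module k X] [Module (UAlg k ρ) X]
  [IsScalarTower k (UAlg k ρ) X] [AddCommGroup Y] [Module k Y] [Module (UAlg k ρ) Y]
  [IsScalarTower k (UAlg k ρ) Y]

/-- A linear map that commutes with the action of vertices and arrows, as a homomorphism. -/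
def homOfGenerators (φ : X →ₗ[k] Y) (hi : ∀ a x, φ (idem k ρ a • x) = idem k ρ a • φ x)
    (ha : ∀ y x, φ (arrowElt k ρ y • x) = arrowElt k ρ y • φ x) : X →ₗ[UAlg k ρ] Y where
  toFun := φ
  map_add' := φ.map_add
  map_smul' a x := by
    change φ (a • x) = a • φ x
    induction a using UAlg.induction_left generalizing x with
    | hone => rw [one_smul, one_smul]
    | hadd a b ha hb => rw [add_smul, add_smul, map_add, ha, hb]
    | hsmul t a ha => rw [smul_assoc, smul_assoc, map_smul, ha]
    | hidem v => exact hi v x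
    | harrow y a h => rw [mul_smul, mul_smul, ha, h]

/-- The linear span of a set, as a submodule, when vertices and arrows map the set into its span. -/
def stableSpan (G : Set X) (hi : ∀ a, ∀ x ∈ G, idem k ρ a • x ∈ Submodule.span k G)
    (ha : ∀ y, ∀ x ∈ G, arrowElt k ρ y • x ∈ Submodule.span k G) : Submodule (UAlg k ρ) X where
  __ := Submodule.span k G
  smul_mem' a x hx := by
    have key : ∀ {a : UAlg k ρ}, (∀ x ∈ G, a • x ∈ Submodule.span k G) →
        ∀ x ∈ Submodule.span k G, a • x ∈ Submodule.span k G := fun h x hx =>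
      (Submodule.span_le (p := (Submodule.span k G).comap (Algebra.lsmul k k X _))).2 h hx
    change a • x ∈ Submodule.span k G
    induction a using UAlg.induction_left with
    | hone => rwa [one_smul]
    | hadd a b ha hb => rw [add_smul]; exact add_mem ha hb
    | hsmul t a ha => rw [smul_assoc]; exact Submodule.smul_mem _ t ha
    | hidem v => exact key (hi v) x hx
    | harrow y a h => rw [mul_smul]; exact key (ha y) _ h

theorem mem_stableSpan {G : Set X} {hi : ∀ a, ∀ x ∈ G, idem k ρ a • x ∈ Submodule.span k G}
    {ha : ∀ y, ∀ x ∈ G, arrowElt k ρ y • x ∈ Submodule.span k G} {x : X} :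
    x ∈ stableSpan G hi ha ↔ x ∈ Submodule.span k G :=
  Iff.rfl

end Modules

end Products

section Cycles

variable {Q : Type v} [Quiver.{w} Q] {ρ : Set (QPath Q)}

theorem apply_add_eq_of_allowed (hρ : IsString ρ) {X Y : ℤ → Arrow Q}
    (hX : ∀ i, Allowed ρ (X i) (X (i + 1))) (hY : ∀ i, Allowed ρ (Y i) (Y (i + 1))) {i j : ℤ}
    (h : X i = Y j) (m : ℤ) : X (i + m) = Y (j + m) := by
  induction m using Int.induction_on with
  | zero => simpa using h
  | succ m ih =>
    have hY' := hY (j + m)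
    rw [← ih] at hY'
    rw [← add_assoc, ← add_assoc]
    exact (hX (i + m)).right_unique hρ hY'
  | pred m ih =>
    have hX' := hX (i + (-m - 1))
    have hY' := hY (j + (-m - 1))
    rw [show i + (-(m : ℤ) - 1) + 1 = i + -m by ring] at hX'
    rw [show j + (-(m : ℤ) - 1) + 1 = j + -m by ring, ← ih] at hY'
    exact hX'.left_unique hρ hY'

/-- A cyclic sequence of arrows, written as a sequence indexed by `ℤ` which repeats exactly modulo
`length`, such that the paths of two consecutive arrows are not in `ρ`. Primitive cycles give rise
to such sequences, which avoid the dependent types of paths and rotate without effort. -/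
structure ArrowCycle (ρ : Set (QPath Q)) where
  arrow : ℤ → Arrow Q
  length : ℕ
  length_pos : 0 < length
  allowed : ∀ i, Allowed ρ (arrow i) (arrow (i + 1))
  arrow_eq_iff : ∀ i j, arrow i = arrow j ↔ (length : ℤ) ∣ i - j

namespace ArrowCycle

variable (k : Type u) [Field k] (c : ArrowCycle ρ)

/-- The path of length `r` in the cycle whose first (rightmost) arrow is the arrow number `i`, so
that it runs through the arrows number `i`, `i - 1`, …, `i - r + 1`. -/
def seg (i : ℤ) : ℕ → UAlg k ρ
  | 0 => idem k ρ (c.arrow i).left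
  | r + 1 => arrowElt k ρ (c.arrow (i - r)) * seg i r

/-- The cycle, as an element of the algebra: for a primitive cycle `P` it is the class of `P`. -/
def elt : UAlg k ρ := c.seg k 0 c.length

variable {k}

theorem seg_succ (i : ℤ) (r : ℕ) :
    c.seg k i (r + 1) = arrowElt k ρ (c.arrow (i - r)) * c.seg k i r := rfl

theorem left_eq_right (i : ℤ) : (c.arrow i).left = (c.arrow (i + 1)).right :=
  (c.allowed i).left_eq_right

theorem seg_congr {i j : ℤ} (h : (c.length : ℤ) ∣ i - j) (r : ℕ) :
    c.seg k i r = c.seg k j r := by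
  induction r with
  | zero => rw [seg, seg, (c.arrow_eq_iff i j).2 h]
  | succ r ih => rw [seg_succ, seg_succ, ih, (c.arrow_eq_iff (i - r) (j - r)).2 (by simpa using h)]

theorem idem_mul_seg (i : ℤ) (r : ℕ) :
    idem k ρ (c.arrow (i - r)).left * c.seg k i r = c.seg k i r := by
  cases r with
  | zero => simp [seg, idem_mul_self]
  | succ r =>
    rw [seg_succ, ← mul_assoc, c.left_eq_right,
      show i - ((r + 1 : ℕ) : ℤ) + 1 = i - r by push_cast; ring, idem_mul_arrowElt]

theorem seg_add (i : ℤ) (r s : ℕ) : c.seg k i (r + s) = c.seg k (i - r) s * c.seg k i r := by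
  induction s with
  | zero => rw [add_zero, seg, idem_mul_seg]
  | succ s ih =>
    rw [← add_assoc, seg_succ, seg_succ, ih, mul_assoc]
    congr 3
    push_cast
    ring_nf

theorem arrowElt_mul_seg_of_ne (hρ : IsString ρ) {y : Arrow Q} {i : ℤ} {r : ℕ} (hr : 0 < r)
    (h : y ≠ c.arrow (i - r)) : arrowElt k ρ y * c.seg k i r = 0 := by
  obtain ⟨r, rfl⟩ := Nat.exists_eq_add_of_lt hr
  rw [zero_add] at h ⊢
  rw [seg_succ, ← mul_assoc, arrowElt_mul_of_not_allowed, zero_mul]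
  intro h'
  have hallowed := c.allowed (i - ((r + 1 : ℕ) : ℤ))
  rw [show i - ((r + 1 : ℕ) : ℤ) + 1 = i - r by push_cast; ring] at hallowed
  exact h (h'.left_unique hρ hallowed)

theorem seg_one (i : ℤ) : c.seg k i 1 = arrowElt k ρ (c.arrow i) := by
  rw [seg_succ, seg, Nat.cast_zero, sub_zero, arrowElt_mul_idem]

theorem seg_mul_seg_of_not_dvd (hρ : IsString ρ) {i j : ℤ} {r s : ℕ} (hr : 0 < r) (hs : 0 < s)
    (h : ¬ (c.length : ℤ) ∣ j - (i - r)) : c.seg k j s * c.seg k i r = 0 := by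
  obtain ⟨s, rfl⟩ := Nat.exists_eq_add_of_lt hs
  rw [zero_add, add_comm, seg_add, mul_assoc, seg_one, c.arrowElt_mul_seg_of_ne hρ hr, mul_zero]
  rwa [Ne, c.arrow_eq_iff]

theorem idem_mul_elt : idem k ρ (c.arrow 0).left * c.elt k = c.elt k := by
  have := c.idem_mul_seg (k := k) 0 c.length
  rwa [(c.arrow_eq_iff (0 - c.length) 0).2 (by simp)] at this

theorem seg_length_add (r : ℕ) : c.seg k 0 (c.length + r) = c.seg k 0 r * c.elt k := by
  rw [seg_add, c.seg_congr (j := 0) (by simp)]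
  rfl

theorem seg_length_mul (e : ℕ) : c.seg k 0 (c.length * (e + 1)) = c.elt k ^ (e + 1) := by
  induction e with
  | zero => simp [elt]
  | succ e ih => rw [mul_add, mul_one, add_comm, seg_length_add, ih, ← pow_succ]

theorem idem_smul_seg_mul_elt_mem (v : Q) (r : ℕ) :
    idem k ρ v • (c.seg k 0 r * c.elt k) ∈
      Submodule.span k (Set.range fun r : ℕ => c.seg k 0 r * c.elt k) := by
  rw [smul_eq_mul, ← mul_assoc]
  by_cases hv : v = (c.arrow (0 - r)).left
  · rw [hv, idem_mul_seg]
    exact Submodule.subset_span ⟨r, rfl⟩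
  · rw [← c.idem_mul_seg, ← mul_assoc, idem_mul_of_ne hv, zero_mul, zero_mul]
    exact zero_mem _

theorem arrowElt_smul_seg_mul_elt_mem (hρ : IsString ρ) (y : Arrow Q) (r : ℕ) :
    arrowElt k ρ y • (c.seg k 0 r * c.elt k) ∈
      Submodule.span k (Set.range fun r : ℕ => c.seg k 0 r * c.elt k) := by
  rw [smul_eq_mul]
  by_cases hy : y = c.arrow (0 - r)
  · rw [hy, ← mul_assoc, ← seg_succ]
    exact Submodule.subset_span ⟨r + 1, rfl⟩
  · have hper : c.arrow (0 - (c.length + r : ℕ)) = c.arrow (0 - r) :=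
      (c.arrow_eq_iff _ _).2 (by push_cast; simp)
    rw [← seg_length_add, c.arrowElt_mul_seg_of_ne hρ (by have := c.length_pos; omega) (hper ▸ hy)]
    exact zero_mem _

theorem mul_elt_mem (hρ : IsString ρ) (a : UAlg k ρ) :
    a * c.elt k ∈ Submodule.span k (Set.range fun r : ℕ => c.seg k 0 r * c.elt k) := by
  have h : c.elt k ∈ Submodule.span k (Set.range fun r : ℕ => c.seg k 0 r * c.elt k) :=
    Submodule.subset_span ⟨0, by simpa only [seg, Nat.cast_zero] using c.idem_mul_elt⟩
  refine (stableSpan _ ?_ ?_).smul_mem a (mem_stableSpan.2 h)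
  · rintro v _ ⟨r, rfl⟩
    exact c.idem_smul_seg_mul_elt_mem v r
  · rintro y _ ⟨r, rfl⟩
    exact c.arrowElt_smul_seg_mul_elt_mem hρ y r

theorem elt_mul_seg_mul_elt (hρ : IsString ρ) (r : ℕ) :
    ∃ h : Polynomial k,
      c.elt k * (c.seg k 0 r * c.elt k) = Polynomial.aeval (c.elt k) h * c.elt k := by
  have hn := c.length_pos
  rw [← seg_length_add]
  by_cases hr : (c.length : ℤ) ∣ r
  · obtain ⟨e, rfl⟩ := Int.natCast_dvd_natCast.1 hr
    refine ⟨Polynomial.X ^ (e + 1), ?_⟩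
    rw [show c.length + c.length * e = c.length * (e + 1) by ring, seg_length_mul, map_pow,
      Polynomial.aeval_X, ← pow_succ, ← pow_succ']
  · refine ⟨0, ?_⟩
    rw [map_zero, zero_mul]
    refine c.seg_mul_seg_of_not_dvd hρ (by omega) hn ?_
    rwa [show (0 : ℤ) - (0 - ((c.length + r : ℕ) : ℤ)) = c.length * 1 + r by push_cast; ring,
      dvd_add_right (Dvd.intro _ rfl)]

theorem elt_mul_mul_elt (hρ : IsString ρ) (a : UAlg k ρ) :
    ∃ h : Polynomial k, c.elt k * a * c.elt k = Polynomial.aeval (c.elt k) h * c.elt k := by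
  rw [mul_assoc]
  have hb := c.mul_elt_mem hρ a
  generalize a * c.elt k = b at hb ⊢
  induction hb using Submodule.span_induction with
  | mem x hx =>
    obtain ⟨r, rfl⟩ := hx
    exact c.elt_mul_seg_mul_elt hρ r
  | zero => exact ⟨0, by simp⟩
  | add x y _ _ hx hy =>
    obtain ⟨h, hx⟩ := hx
    obtain ⟨h', hy⟩ := hy
    exact ⟨h + h', by rw [mul_add, hx, hy, map_add, add_mul]⟩
  | smul t x _ hx =>
    obtain ⟨h, hx⟩ := hx
    exact ⟨t • h, by rw [mul_smul_comm, hx, map_smul, smul_mul_assoc]⟩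

end ArrowCycle

theorem arrows_injective {a b : Q} {p q : Quiver.Path a b} (h : arrows p = arrows q) : p = q := by
  induction p with
  | nil =>
    cases q with
    | nil => rfl
    | cons q x => simp [arrows] at h
  | cons p x ih =>
    cases q with
    | nil => simp [arrows] at h
    | cons q y =>
      simp only [arrows, List.cons.injEq, Quiver.Total.mk.injEq] at h
      obtain ⟨⟨rfl, _, hx⟩, hp⟩ := h
      rw [eq_of_heq hx, ih hp]

theorem left_of_getLast?_arrows {a b : Q} {P : Quiver.Path a b} {x : Arrow Q}
    (h : (arrows P).getLast? = some x) : x.left = a := by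
  induction P with
  | nil => simp [arrows] at h
  | cons P y ih =>
    cases P with
    | nil =>
      rw [arrows, arrows, List.getLast?_singleton, Option.some.injEq] at h
      rw [← h]
    | cons P z =>
      rw [arrows, arrows, List.getLast?_cons_cons] at h
      exact ih h

theorem ArrowCycle.pathElt_eq_seg (k : Type u) [Field k] (c : ArrowCycle ρ) {i : ℤ} {a b : Q}
    {P : Quiver.Path a b} (ha : (c.arrow i).left = a)
    (h : ∀ t : ℕ, t < P.length → (arrows P)[t]? = some (c.arrow (i - P.length + 1 + t))) :
    pathElt k ρ ⟨a, b, P⟩ = c.seg k i P.length := by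
  induction P with
  | nil =>
    subst ha
    rfl
  | @cons d b P x ih =>
    have hx : c.arrow (i - P.length) = ⟨d, b, x⟩ := by
      have := h 0 (by simp)
      simp only [arrows, Quiver.Path.length_cons, List.getElem?_cons_zero,
        Option.some.injEq] at this
      rw [this]
      congr 1
      push_cast
      ring
    have hP : pathElt k ρ ⟨a, d, P⟩ = c.seg k i P.length := ih fun t ht => by
      have := h (t + 1) (by simpa using ht)
      rw [arrows, List.getElem?_cons_succ] at this
      rw [this]
      congr 2
      simp only [Quiver.Path.length_cons]
      push_cast
      ring
    rw [pathElt_cons, hP, Quiver.Path.length_cons, ArrowCycle.seg_succ, hx]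

/-- `c` runs through the arrows `x₁ ⋯ xₙ` of the path `P`, with arrow number `1` being `x₁`. -/
structure ArrowCycle.Represents (c : ArrowCycle ρ) {a : Q} (P : Quiver.Path a a) : Prop where
  length_eq : c.length = P.length
  getElem?_arrows : ∀ i : ℤ, (arrows P)[((i - 1) % (P.length : ℤ)).toNat]? = some (c.arrow i)

theorem Word.HasPeriod.dvd_of_forall_letter_add {C : Word ρ} {n : ℕ} (hper : C.HasPeriod n) {m : ℤ}
    (h : ∀ i, C.letter (i + m) = C.letter i) : (n : ℤ) ∣ m := by
  have hn : (n : ℤ) ≠ 0 := by exact_mod_cast hper.pos.ne'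
  obtain ⟨r, hr⟩ := Int.eq_ofNat_of_zero_le (Int.emod_nonneg m hn)
  have hrn : m % n < n := Int.emod_lt_of_pos m (by exact_mod_cast hper.pos)
  have hrper : ∀ i, C.letter (i + r) = C.letter i := fun i => by
    rw [← hr, Int.emod_def, show i + (m - n * (m / n)) = i + m - m / n * n by ring,
      hper.letter_sub, h]
  rw [Int.dvd_iff_emod_eq_zero]
  by_contra hm
  have := hper.minimal r (by omega) hrper
  omega

theorem IsPrimitiveCycle.exists_arrowCycle (hρ : IsString ρ) {a : Q} {P : Quiver.Path a a}
    (hP : IsPrimitiveCycle ρ P) : ∃ c : ArrowCycle ρ, c.Represents P := by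
  obtain ⟨C, hC, hper⟩ := hP
  have hn := hper.pos
  have harrow (i : ℤ) : ∃ x : Arrow Q,
      (arrows P)[((i - 1) % (P.length : ℤ)).toNat]? = some x := by
    have := Int.emod_lt_of_pos (i - 1) (Int.natCast_pos.2 hn)
    have := Int.emod_nonneg (i - 1) (Int.natCast_pos.2 hn).ne'
    exact ⟨_, List.getElem?_eq_getElem (by rw [length_arrows]; omega)⟩
  choose X hX using harrow
  have hletter (i) : C.letter i = some (.dir (X i)) := by
    rw [hC.2, dirLetters, List.getElem?_map, hX]
    rfl
  have hallowed (i) : Allowed ρ (X i) (X (i + 1)) := C.allowed_of_dir (hletter i) (hletter _)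
  have hletter_iff (i j) : C.letter i = C.letter j ↔ X i = X j := by simp [hletter]
  refine ⟨⟨X, P.length, hn, hallowed, fun i j => ⟨fun h => ?_, fun ⟨m, hm⟩ => ?_⟩⟩, rfl, hX⟩
  · refine hper.dvd_of_forall_letter_add fun l => (hletter_iff _ _).2 ?_
    have := apply_add_eq_of_allowed hρ hallowed hallowed h (l - j)
    rwa [show i + (l - j) = l + (i - j) by ring, add_sub_cancel] at this
  · rw [← hletter_iff, show j = i - m * P.length by linarith, hper.letter_sub]

namespace ArrowCycle.Represents

variable {c : ArrowCycle ρ} {a : Q} {P : Quiver.Path a a}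

theorem getElem? (h : c.Represents P) {t : ℕ} (ht : t < P.length) :
    (arrows P)[t]? = some (c.arrow (t + 1)) := by
  rw [← h.getElem?_arrows (t + 1), add_sub_cancel_right, Int.emod_eq_of_lt (by omega) (by omega)]
  simp

theorem left_arrow_zero (h : c.Represents P) : (c.arrow 0).left = a := by
  have hn := c.length_pos
  have hlen := h.length_eq
  refine left_of_getLast?_arrows (P := P) ?_
  rw [List.getLast?_eq_getElem?, length_arrows, h.getElem? (by omega), Option.some.injEq,
    c.arrow_eq_iff]
  exact ⟨1, by omega⟩

theorem pathElt_eq (h : c.Represents P) (k : Type u) [Field k] :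
    pathElt k ρ ⟨a, a, P⟩ = c.elt k := by
  rw [ArrowCycle.elt, h.length_eq]
  refine c.pathElt_eq_seg k h.left_arrow_zero fun t ht => ?_
  rw [h.getElem? ht, Option.some.injEq, c.arrow_eq_iff, h.length_eq]
  exact ⟨1, by ring⟩

theorem getElem?_dirLetters (h : c.Represents P) {t : ℕ} (ht : t < P.length) :
    (dirLetters P)[t]? = some (.dir (c.arrow (t + 1))) := by
  rw [dirLetters, List.getElem?_map, h.getElem? ht]
  rfl

theorem getElem?_invLetters (h : c.Represents P) (t : ℕ) :
    (invLetters P)[t % P.length]? = some (.inv (c.arrow (-t))) := by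
  have hn : 0 < P.length := h.length_eq ▸ c.length_pos
  have ht := Nat.mod_lt t hn
  rw [invLetters, List.getElem?_map, List.getElem?_reverse (by rwa [length_arrows]),
    length_arrows, h.getElem? (by omega), Option.map_some, Option.some.injEq, Letter.inv.injEq,
    c.arrow_eq_iff, h.length_eq]
  refine ⟨1 + t / P.length, ?_⟩
  have hdiv : (t % P.length + P.length * (t / P.length) : ℤ) = t := Int.emod_add_mul_ediv _ _
  have hcast : ((P.length - 1 - t % P.length : ℕ) : ℤ) = P.length - 1 - (t % P.length : ℤ) := by
    push_cast [Nat.cast_sub (show t % P.length ≤ P.length - 1 by omega),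
      Nat.cast_sub (show 1 ≤ P.length by omega)]
    ring
  rw [hcast]
  linarith

end ArrowCycle.Represents

theorem ArrowCycle.Represents.eq_of_arrow_zero_eq (hρ : IsString ρ) {a : Q}
    {P P' : Quiver.Path a a} {c c' : ArrowCycle ρ} (h : c.Represents P) (h' : c'.Represents P')
    (h0 : c.arrow 0 = c'.arrow 0) : P = P' := by
  have harrow : c.arrow = c'.arrow := funext fun i => by
    simpa using apply_add_eq_of_allowed hρ c.allowed c'.allowed h0 i
  have hdvd (i j : ℤ) : (c.length : ℤ) ∣ i - j ↔ (c'.length : ℤ) ∣ i - j := by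
    rw [← c.arrow_eq_iff, ← c'.arrow_eq_iff, harrow]
  have hlength : P.length = P'.length := by
    rw [← h.length_eq, ← h'.length_eq]
    refine Nat.dvd_antisymm (Int.natCast_dvd_natCast.1 ?_) (Int.natCast_dvd_natCast.1 ?_)
    · simpa using (hdvd c'.length 0).2 (by simp)
    · simpa using (hdvd c.length 0).1 (by simp)
  refine arrows_injective (List.ext_getElem? fun t => ?_)
  rcases lt_or_ge t P.length with ht | ht
  · rw [h.getElem? ht, h'.getElem? (hlength ▸ ht), harrow]
  · rw [List.getElem?_eq_none (by rwa [length_arrows]),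
      List.getElem?_eq_none (by rwa [length_arrows, ← hlength])]

theorem finite_primitiveCycles (hρ : IsString ρ) (a : Q) :
    Finite {P : Quiver.Path a a // IsPrimitiveCycle ρ P} := by
  have hf : {x : Arrow Q | x.left = a}.Finite :=
    Set.finite_of_encard_le_coe (k := 2) (hρ.tails a)
  have := hf.to_subtype
  choose c hc using
    fun P : {P : Quiver.Path a a // IsPrimitiveCycle ρ P} => P.2.exists_arrowCycle hρ
  refine Finite.of_injective (β := {x : Arrow Q | x.left = a})
    (fun P => ⟨(c P).arrow 0, (hc P).left_arrow_zero⟩) fun P P' h => ?_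
  exact Subtype.ext ((hc P).eq_of_arrow_zero_eq hρ (hc P') (congrArg Subtype.val h))

variable (k : Type u) [Field k]

theorem zElt_mul_elt (hρ : IsString ρ) {a : Q} {P : Quiver.Path a a} (hP : IsPrimitiveCycle ρ P)
    {c : ArrowCycle ρ} (hc : c.Represents P) : zElt k ρ a * c.elt k = c.elt k * c.elt k := by
  have := finite_primitiveCycles hρ a
  have := Fintype.ofFinite {P : Quiver.Path a a // IsPrimitiveCycle ρ P}
  rw [zElt, finsum_eq_sum_of_fintype, Finset.sum_mul, Finset.sum_eq_single ⟨P, hP⟩]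
  · rw [hc.pathElt_eq k]
  · rintro ⟨P', hP'⟩ - hne
    obtain ⟨c', hc'⟩ := hP'.exists_arrowCycle hρ
    rw [hc'.pathElt_eq k]
    have h0 : c'.arrow 0 ≠ c.arrow 0 := fun h =>
      hne (Subtype.ext (hc'.eq_of_arrow_zero_eq hρ hc h))
    obtain ⟨n, hn⟩ := Nat.exists_eq_add_of_lt c'.length_pos
    rw [ArrowCycle.elt, hn, zero_add, add_comm, ArrowCycle.seg_add, mul_assoc, ArrowCycle.seg_one,
      ArrowCycle.elt, c.arrowElt_mul_seg_of_ne hρ c.length_pos, mul_zero]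
    rwa [(c.arrow_eq_iff (0 - c.length) 0).2 (by simp)]
  · simp

end Cycles

/-! ### Words seen from a given position in a given direction -/

/-- A position in a word, together with a direction: `true` is the direction of increasing indices.
Seen from a flag, every word can be read as if its direction were the increasing one. -/
structure Flag where
  i : ℤ
  d : Bool

namespace Flag

variable (s : Flag)

/-- The position at distance `l` in the given direction. -/
def pos (l : ℤ) : ℤ := if s.d then s.i + l else s.i - l

/-- The signed distance of a position. -/
def rel (j : ℤ) : ℤ := if s.d then j - s.i else s.i - j

/-- Move the position by `m` steps in the given direction. -/
def shift (m : ℤ) : Flag := ⟨s.pos m, s.d⟩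

@[simp] theorem pos_zero : s.pos 0 = s.i := by simp [pos]

@[simp] theorem rel_pos (l : ℤ) : s.rel (s.pos l) = l := by
  rcases s with ⟨i, _ | _⟩ <;> simp [rel, pos]

@[simp] theorem pos_rel (j : ℤ) : s.pos (s.rel j) = j := by
  rcases s with ⟨i, _ | _⟩ <;> simp [rel, pos]

theorem pos_shift (m l : ℤ) : (s.shift m).pos l = s.pos (m + l) := by
  rcases s with ⟨i, _ | _⟩ <;> simp [shift, pos] <;> ring

end Flag

section Flags

variable {Q : Type v} [Quiver.{w} Q] {ρ : Set (QPath Q)}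

theorem Letter.inverse_inverse (l : Letter Q) : l.inverse.inverse = l := by cases l <;> rfl

theorem Letter.head_inverse (l : Letter Q) : l.inverse.head = l.tail := by cases l <;> rfl

namespace Word

variable (C : Word ρ) (s : Flag)

/-- The letter number `l` of `C`, seen from the flag `s`. -/
def letterAt (l : ℤ) : Option (Letter Q) :=
  if s.d then C.letter (s.i + l) else (C.letter (s.i + 1 - l)).map Letter.inverse

theorem letterAt_shift (m l : ℤ) : C.letterAt (s.shift m) l = C.letterAt s (m + l) := by
  rcases s with ⟨i, _ | _⟩
  · simp only [letterAt, Flag.shift, Flag.pos, Bool.false_eq_true, if_false]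
    rw [show i - m + 1 - l = i + 1 - (m + l) by ring]
  · simp only [letterAt, Flag.shift, Flag.pos, if_true]
    rw [add_assoc]

variable {C s}

theorem mem_of_letterAt {l : ℤ} {x : Letter Q} (h : C.letterAt s l = some x) :
    s.pos l ∈ C.shape.idx ∧ s.pos (l - 1) ∈ C.shape.idx := by
  rcases s with ⟨i, _ | _⟩
  · simp only [letterAt, Bool.false_eq_true, if_false, Option.map_eq_some_iff] at h
    obtain ⟨y, hy, -⟩ := h
    have := StringModule.mem_of_letter hy
    simp only [Flag.pos, Bool.false_eq_true, if_false]
    rw [show i - (l - 1) = i + 1 - l by ring, show i - l = i + 1 - l - 1 by ring]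
    exact ⟨this.2, this.1⟩
  · simp only [letterAt, if_true] at h
    have := StringModule.mem_of_letter h
    simp only [Flag.pos, if_true]
    rw [← add_sub_assoc]
    exact this

theorem vertex_head_at {l : ℤ} {x : Letter Q} (h : C.letterAt s (l + 1) = some x) :
    C.vertex (s.pos l) = some x.head := by
  rcases s with ⟨i, _ | _⟩
  · simp only [letterAt, Bool.false_eq_true, if_false, Option.map_eq_some_iff] at h
    obtain ⟨y, hy, rfl⟩ := h
    have := C.vertex_tail _ _ hy
    rw [Letter.head_inverse, ← this]
    simp only [Flag.pos, Bool.false_eq_true, if_false]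
    congr 1
    ring
  · simp only [letterAt, if_true] at h
    have := C.vertex_head _ _ h
    rw [← this]
    simp only [Flag.pos, if_true]
    congr 1
    ring

theorem letterAt_succ_ne {l : ℤ} {x : Letter Q} (h : C.letterAt s l = some x) :
    C.letterAt s (l + 1) ≠ some x.inverse := by
  rcases s with ⟨i, _ | _⟩
  · simp only [letterAt, Bool.false_eq_true, if_false, Option.map_eq_some_iff, ne_eq] at h ⊢
    obtain ⟨y, hy, rfl⟩ := h
    rintro ⟨z, hz, h'⟩
    rw [Letter.inverse_inverse] at h'
    refine C.not_inverse _ _ hz ?_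
    rw [h', ← hy]
    congr 1
    ring
  · simp only [letterAt, if_true] at h ⊢
    have := C.not_inverse _ _ h
    rwa [add_assoc] at this

theorem allowed_of_letterAt_inv {l : ℤ} {x y : Arrow Q} (hx : C.letterAt s l = some (.inv x))
    (hy : C.letterAt s (l + 1) = some (.inv y)) : Allowed ρ y x := by
  rcases s with ⟨i, _ | _⟩
  · simp only [letterAt, Bool.false_eq_true, if_false, Option.map_eq_some_iff] at hx hy
    obtain ⟨x', hx', hx⟩ := hx
    obtain ⟨y', hy', hy⟩ := hy
    have hx2 : x' = .dir x := by rw [← x'.inverse_inverse, hx]; rfl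
    have hy2 : y' = .dir y := by rw [← y'.inverse_inverse, hy]; rfl
    subst hx2 hy2
    refine C.allowed_of_dir hy' ?_
    rw [← hx']
    congr 1
    ring
  · simp only [letterAt, if_true] at hx hy
    rw [← add_assoc] at hy
    exact C.allowed_of_inv hx hy

variable (C s)

/-- The letter number `l`, seen from `s`, is the one which occurs at this place in the `ℤ`-word
`∞(P⁻¹)∞`, where `P` is the cycle `c`. -/
def AgreesAt (c : ArrowCycle ρ) (l : ℤ) : Prop :=
  C.letterAt s l = some (.inv (c.arrow (1 - l)))

/-- The word which starts at the flag `s` is `(P⁻¹)^∞`, where `P` is the cycle `c`. -/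
def IsDeepAt (c : ArrowCycle ρ) : Prop := ∀ l, 1 ≤ l → C.AgreesAt s c l

/-- The flag `s` is a peak whose agreement with `∞(P⁻¹)∞` extends exactly `t` letters backwards. -/
structure IsPeakAtWith (c : ArrowCycle ρ) (t : ℕ) : Prop where
  lt : t < c.length
  agreesAt : ∀ l : ℤ, -t < l → C.AgreesAt s c l
  not_agreesAt : ¬ C.AgreesAt s c (-t)

/-- The flag `s` is a `P`-peak, where `P` is the cycle `c`. -/
def IsPeakAt (c : ArrowCycle ρ) : Prop := ∃ t, C.IsPeakAtWith s c t

variable {C s}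

theorem IsPeakAtWith.isDeepAt {c : ArrowCycle ρ} {t : ℕ} (h : C.IsPeakAtWith s c t) :
    C.IsDeepAt s c := fun l hl => h.agreesAt l (by omega)

theorem IsPeakAt.isDeepAt {c : ArrowCycle ρ} (h : C.IsPeakAt s c) : C.IsDeepAt s c :=
  h.choose_spec.isDeepAt

variable (C s)

theorem agreesAt_shift {c : ArrowCycle ρ} {m : ℤ} (hm : (c.length : ℤ) ∣ m) (l : ℤ) :
    C.AgreesAt (s.shift m) c l ↔ C.AgreesAt s c (m + l) := by
  rw [AgreesAt, AgreesAt, letterAt_shift,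
    (c.arrow_eq_iff (1 - l) (1 - (m + l))).2 (by ring_nf; exact hm)]

variable {C s}

theorem side_eq_letterAt (m : ℕ) : C.side s.i s.d m = C.letterAt s (m + 1) := by
  rcases s with ⟨i, _ | _⟩
  · simp only [side, letterAt, Bool.false_eq_true, if_false]
    congr 2
    ring
  · simp only [side, letterAt, if_true]
    congr 1
    ring

theorem side_not_eq_letterAt (m : ℕ) :
    C.side s.i (!s.d) m = (C.letterAt s (-m)).map Letter.inverse := by
  rcases s with ⟨i, _ | _⟩
  · simp only [side, letterAt, Bool.not_false, Bool.false_eq_true, if_false, if_true,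
      Option.map_map, sub_neg_eq_add]
    rw [show Letter.inverse ∘ Letter.inverse = (id : Letter Q → Letter Q) from
      funext Letter.inverse_inverse, Option.map_id, id]
  · simp only [side, letterAt, Bool.not_true, Bool.false_eq_true, if_false, if_true,
      ← sub_eq_add_neg]

theorem IsPeakAt.isPeak {c : ArrowCycle ρ} {a : Q} {P : Quiver.Path a a} (hc : c.Represents P)
    (h : C.IsPeakAt s c) : C.IsPeak P s.i := by
  refine ⟨?_, s.d, fun m => ?_, fun hstart => ?_⟩
  · simpa using (mem_of_letterAt (h.isDeepAt 1 le_rfl)).2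
  · rw [hc.getElem?_invLetters, side_eq_letterAt, h.isDeepAt (m + 1) (by omega),
      show (1 : ℤ) - (m + 1) = -m by ring]
  · obtain ⟨t, ht⟩ := h
    have hlt : t < P.length := hc.length_eq ▸ ht.lt
    have hside := hstart t hlt
    rw [hc.getElem?_dirLetters hlt, side_not_eq_letterAt, Option.map_eq_some_iff] at hside
    obtain ⟨x, hx, hx'⟩ := hside
    refine ht.not_agreesAt ?_
    rw [AgreesAt, hx, sub_neg_eq_add, add_comm 1, ← x.inverse_inverse, hx']
    rfl

end Word

/-! ### String modules seen from a flag -/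

namespace StringModule

variable {k : Type u} [Field k] {C : Word ρ}

instance : IsScalarTower k (UAlg k ρ) (StringModule k C) :=
  ⟨fun t a m => by rw [smul_def, smul_def, map_smul]; rfl⟩

theorem b_mem_span (y : StringModule k C) :
    y ∈ Submodule.span k {y | ∃ i ∈ C.shape.idx, y = b k C i} := by
  refine Finsupp.induction_linear y (zero_mem _) (fun _ _ => add_mem) fun i t => ?_
  have : (Finsupp.single i t : C.shape.idx →₀ k) = t • (b k C i : StringModule k C) := by
    rw [b, dif_pos i.2]
    exact (Finsupp.smul_single_one i t).symm
  rw [this]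
  exact Submodule.smul_mem _ _ (Submodule.subset_span ⟨i, i.2, rfl⟩)

variable (k C) (s : Flag)

/-- The basis element at distance `l` from the flag `s`, and `0` if this position is not in `I`. -/
def bAt (l : ℤ) : StringModule k C := b k C (s.pos l)

theorem bAt_shift (m l : ℤ) : bAt k C (s.shift m) l = bAt k C s (m + l) := by
  rw [bAt, bAt, Flag.pos_shift]

variable {k C s}

open Classical in
theorem idem_smul_bAt (a : Q) {l : ℤ} (hl : s.pos l ∈ C.shape.idx) :
    idem k ρ a • bAt k C s l = if C.vertex (s.pos l) = some a then bAt k C s l else 0 :=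
  idem_smul_b a hl

open Classical in
theorem arrowElt_smul_bAt (x : Arrow Q) {l : ℤ} (hl : s.pos l ∈ C.shape.idx) :
    arrowElt k ρ x • bAt k C s l =
      if C.letterAt s l = some (.dir x) then bAt k C s (l - 1)
      else if C.letterAt s (l + 1) = some (.inv x) then bAt k C s (l + 1)
      else 0 := by
  rw [bAt, arrowElt_smul_b x hl]
  have hinv : ∀ y : Letter Q, y.inverse = .dir x ↔ y = .inv x := by
    rintro (y | y) <;> simp [Letter.inverse]
  have hdir : ∀ y : Letter Q, y.inverse = .inv x ↔ y = .dir x := by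
    rintro (y | y) <;> simp [Letter.inverse]
  rcases s with ⟨i, _ | _⟩
  · simp only [bAt, Word.letterAt, Flag.pos, Bool.false_eq_true, if_false, Option.map_eq_some_iff,
      hinv, hdir, exists_eq_right]
    rw [show i + 1 - (l + 1) = i - l by ring, show i - l + 1 = i + 1 - l by ring,
      show i - l - 1 = i - (l + 1) by ring, show i - (l - 1) = i + 1 - l by ring]
    by_cases hdir : C.letter (i - l) = some (.dir x)
    · have : C.letter (i - l + 1) ≠ some (.inv x) := C.not_inverse _ _ hdir
      rw [show i - l + 1 = i + 1 - l by ring] at this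
      rw [if_pos hdir, if_neg this, if_pos hdir]
    · rw [if_neg hdir, if_neg hdir]
  · simp only [bAt, Word.letterAt, Flag.pos, if_true]
    rw [add_sub_assoc, add_assoc]

/-- The linear map with given values on the basis elements. -/
def linAt {A : Type*} [AddCommGroup A] [Module k A] (s : Flag) (f : ℤ → A) :
    StringModule k C →ₗ[k] A :=
  lin C fun j => f (s.rel j)

theorem linAt_bAt {A : Type*} [AddCommGroup A] [Module k A] (f : ℤ → A) {l : ℤ}
    (hl : s.pos l ∈ C.shape.idx) : linAt s f (bAt k C s l) = f l := by
  rw [linAt, bAt, lin_b C _ hl, Flag.rel_pos]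

theorem hom_extAt {A : Type*} [AddCommGroup A] [Module k A] {f g : StringModule k C →ₗ[k] A}
    (s : Flag) (h : ∀ l, s.pos l ∈ C.shape.idx → f (bAt k C s l) = g (bAt k C s l)) : f = g := by
  refine hom_ext fun i hi => ?_
  have := h (s.rel i) (by simpa using hi)
  simpa [bAt] using this

/-- The coefficient of the basis element at distance `l`. -/
def coeffAt (s : Flag) (l : ℤ) : StringModule k C →ₗ[k] k :=
  linAt s fun m => if m = l then 1 else 0

theorem coeffAt_bAt {l m : ℤ} (hl : s.pos l ∈ C.shape.idx) :
    coeffAt s m (bAt k C s l) = if l = m then 1 else 0 := linAt_bAt _ hl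

theorem bAt_mem_span (s : Flag) (y : StringModule k C) :
    y ∈ Submodule.span k {y | ∃ l, s.pos l ∈ C.shape.idx ∧ y = bAt k C s l} := by
  refine Submodule.span_mono ?_ (b_mem_span y)
  rintro _ ⟨i, hi, rfl⟩
  exact ⟨s.rel i, by simpa using hi, by simp [bAt]⟩

variable {c : ArrowCycle ρ}

theorem idem_smul_bAt_of_agreesAt {l : ℤ} (h : C.AgreesAt s c (l + 1)) :
    idem k ρ (c.arrow (-l)).left • bAt k C s l = bAt k C s l := by
  have hpos := (Word.mem_of_letterAt h).2
  rw [add_sub_cancel_right] at hpos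
  rw [idem_smul_bAt _ hpos, if_pos]
  rw [Word.vertex_head_at h, show (1 : ℤ) - (l + 1) = -l by ring]
  rfl

theorem arrowElt_smul_bAt_of_agreesAt {l : ℤ} (h : C.AgreesAt s c (l + 1)) :
    arrowElt k ρ (c.arrow (-l)) • bAt k C s l = bAt k C s (l + 1) := by
  have hpos := (Word.mem_of_letterAt h).2
  rw [add_sub_cancel_right] at hpos
  rw [Word.AgreesAt, show (1 : ℤ) - (l + 1) = -l by ring] at h
  rw [arrowElt_smul_bAt _ hpos, if_pos h, if_neg]
  exact fun hdir => Word.letterAt_succ_ne hdir h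

theorem seg_smul_bAt_of_agreesAt {l : ℤ} {r : ℕ} (hfirst : C.AgreesAt s c (l + 1))
    (h : ∀ m, l < m → m ≤ l + r → C.AgreesAt s c m) :
    c.seg k (-l) r • bAt k C s l = bAt k C s (l + r) := by
  induction r with
  | zero => simpa [ArrowCycle.seg] using idem_smul_bAt_of_agreesAt hfirst
  | succ r ih =>
    rw [ArrowCycle.seg_succ, mul_smul, ih fun m hm hm' => h m hm (by push_cast; omega),
      show -l - (r : ℤ) = -(l + r) by ring,
      arrowElt_smul_bAt_of_agreesAt (h _ (by omega) (by push_cast; omega))]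
    congr 1
    push_cast
    ring

theorem seg_smul_bAt_of_isDeepAt (h : C.IsDeepAt s c) (r : ℕ) :
    c.seg k 0 r • bAt k C s 0 = bAt k C s r := by
  simpa using seg_smul_bAt_of_agreesAt (k := k) (l := 0) (r := r) (h 1 le_rfl)
    fun m hm _ => h m (by omega)

theorem elt_pow_smul_bAt_of_isDeepAt (h : C.IsDeepAt s c) (e : ℕ) :
    c.elt k ^ e • bAt k C s 0 = bAt k C s (c.length * e) := by
  cases e with
  | zero => simp
  | succ e =>
    rw [← ArrowCycle.seg_length_mul, seg_smul_bAt_of_isDeepAt h]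
    push_cast
    rfl

theorem elt_pow_smul_of_seg_smul {y : StringModule k C} {r : ℕ} (h : c.seg k 0 r • y = 0) :
    c.elt k ^ (r + 1) • y = 0 := by
  have hn := c.length_pos
  have : c.length * (r + 1) = r + (c.length * (r + 1) - r) := by
    have : 1 * (r + 1) ≤ c.length * (r + 1) := Nat.mul_le_mul_right _ hn
    omega
  rw [← ArrowCycle.seg_length_mul, this, ArrowCycle.seg_add, mul_smul, h, smul_zero]

theorem arrowElt_smul_bAt_of_not_agreesAt {l : ℤ} (h : C.AgreesAt s c l)
    (hne : ¬ C.AgreesAt s c (l + 1)) : arrowElt k ρ (c.arrow (-l)) • bAt k C s l = 0 := by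
  rw [Word.AgreesAt, show (1 : ℤ) - (l + 1) = -l by ring] at hne
  have hl := (Word.mem_of_letterAt h).1
  rw [Word.AgreesAt] at h
  rw [arrowElt_smul_bAt _ hl, if_neg (by simp [h]), if_neg hne]

theorem isDeepAt_or_exists_elt_pow_smul_bAt (h : C.AgreesAt s c 1) :
    C.IsDeepAt s c ∨ ∃ N, c.elt k ^ N • bAt k C s 0 = 0 := by
  classical
  by_cases hd : C.IsDeepAt s c
  · exact Or.inl hd
  right
  have hex : ∃ r : ℕ, ¬ C.AgreesAt s c (r + 1) := by
    by_contra! hall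
    refine hd fun l hl => ?_
    have := hall (l - 1).toNat
    rwa [Int.toNat_of_nonneg (by omega), sub_add_cancel] at this
  obtain ⟨r, hne, hmin⟩ : ∃ r : ℕ, ¬ C.AgreesAt s c (r + 1) ∧
      ∀ m : ℤ, 0 < m → m ≤ r → C.AgreesAt s c m := by
    refine ⟨Nat.find hex, Nat.find_spec hex, fun m hm hm' => ?_⟩
    have := Nat.find_min hex (m := (m - 1).toNat) (by omega)
    rwa [not_not, Int.toNat_of_nonneg (by omega), sub_add_cancel] at this
  have hr : 0 < r := Nat.pos_of_ne_zero fun h0 => hne (by simpa [h0] using h)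
  have hseg := seg_smul_bAt_of_agreesAt (k := k) (l := 0) (r := r) h (by simpa using hmin)
  rw [neg_zero, zero_add] at hseg
  refine ⟨r + 2, elt_pow_smul_of_seg_smul ?_⟩
  rw [ArrowCycle.seg_succ, mul_smul, hseg, zero_sub]
  exact arrowElt_smul_bAt_of_not_agreesAt (hmin r (by omega) le_rfl) hne

theorem exists_isDeepAt_or_exists_elt_pow_smul_b {j : ℤ} (hj : j ∈ C.shape.idx) (c : ArrowCycle ρ) :
    (∃ d, C.IsDeepAt ⟨j, d⟩ c) ∨ ∃ N, c.elt k ^ N • b k C j = 0 := by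
  by_cases h : ∃ d, C.AgreesAt ⟨j, d⟩ c 1
  · obtain ⟨d, hd⟩ := h
    rcases isDeepAt_or_exists_elt_pow_smul_bAt (k := k) hd with h | ⟨N, h⟩
    · exact Or.inl ⟨d, h⟩
    · exact Or.inr ⟨N, by simpa [bAt] using h⟩
  · push Not at h
    right
    refine ⟨2, elt_pow_smul_of_seg_smul ?_⟩
    rw [ArrowCycle.seg_succ, ArrowCycle.seg, mul_smul]
    have hzero : arrowElt k ρ (c.arrow 0) • b k C j = 0 := by
      rw [arrowElt_smul_b _ hj, if_neg, if_neg]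
      · intro hinv
        apply h true
        simpa [Word.AgreesAt, Word.letterAt] using hinv
      · intro hdir
        apply h false
        simp [Word.AgreesAt, Word.letterAt, hdir, Letter.inverse]
    rw [Nat.cast_zero, sub_zero, ← mul_smul, arrowElt_mul_idem, hzero]

end StringModule

end Flags

/-! ### Peaks -/

section Peaks

variable {Q : Type v} [Quiver.{w} Q] {ρ : Set (QPath Q)} {C : Word ρ} {s : Flag} {c : ArrowCycle ρ}

namespace Word

theorem IsPeakAtWith.pos_mem {t : ℕ} (h : C.IsPeakAtWith s c t) {l : ℤ} (hl : -t ≤ l) :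
    s.pos l ∈ C.shape.idx := by
  have := (mem_of_letterAt (h.agreesAt (l + 1) (by omega))).2
  rwa [add_sub_cancel_right] at this

theorem IsDeepAt.forall_agreesAt_or_exists_isPeakAt (h : C.IsDeepAt s c) :
    (∀ l, C.AgreesAt s c l) ∨ ∃ e : ℕ, C.IsPeakAt (s.shift (-(c.length * e))) c := by
  classical
  by_cases hall : ∀ l, C.AgreesAt s c l
  · exact Or.inl hall
  right
  have hex : ∃ t : ℕ, ¬ C.AgreesAt s c (-t) := by
    by_contra! hneg
    refine hall fun l => ?_
    rcases le_or_gt 1 l with hl | hl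
    · exact h l hl
    · have := hneg (-l).toNat
      rwa [Int.toNat_of_nonneg (by omega), neg_neg] at this
  obtain ⟨t, hne, hmin⟩ : ∃ t : ℕ, ¬ C.AgreesAt s c (-t) ∧ ∀ m : ℤ, -t < m → C.AgreesAt s c m := by
    refine ⟨Nat.find hex, Nat.find_spec hex, fun m hm => ?_⟩
    rcases le_or_gt 1 m with hm' | hm'
    · exact h m hm'
    · have := Nat.find_min hex (m := (-m).toNat) (by omega)
      rwa [not_not, Int.toNat_of_nonneg (by omega), neg_neg] at this
  have hdiv : ((t % c.length : ℕ) : ℤ) + c.length * (t / c.length : ℕ) = t :=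
    mod_cast Nat.mod_add_div t c.length
  have hdvd : (c.length : ℤ) ∣ -(c.length * (t / c.length : ℕ)) := ⟨-(t / c.length : ℕ), by ring⟩
  refine ⟨t / c.length, t % c.length, Nat.mod_lt _ c.length_pos, fun l hl => ?_, ?_⟩
  · rw [C.agreesAt_shift s hdvd]
    exact hmin _ (by linarith)
  · rw [C.agreesAt_shift s hdvd]
    convert hne using 2
    linarith

theorem AgreesAt.dvd_of_shift {r l : ℤ} (h : C.AgreesAt s c (r + l))
    (hr : C.AgreesAt (s.shift r) c l) : (c.length : ℤ) ∣ r := by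
  rw [AgreesAt, letterAt_shift] at hr
  rw [AgreesAt, hr, Option.some.injEq, Letter.inv.injEq, c.arrow_eq_iff] at h
  convert h using 1
  ring

theorem IsPeakAt.exists_eq_of_isDeepAt_shift (h : C.IsPeakAt s c) {r : ℤ}
    (hr : C.IsDeepAt (s.shift r) c) : ∃ e : ℕ, r = c.length * e := by
  have hn : (0 : ℤ) < c.length := mod_cast c.length_pos
  have hdvd : (c.length : ℤ) ∣ r := by
    rcases le_or_gt 0 r with h0 | h0
    · exact (h.isDeepAt (r + 1) (by omega)).dvd_of_shift (hr 1 le_rfl)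
    · refine AgreesAt.dvd_of_shift (l := -r + 1) ?_ (hr _ (by omega))
      simpa using h.isDeepAt 1 le_rfl
  have hr0 : 0 ≤ r := by
    obtain ⟨t, ht⟩ := h
    by_contra! hneg
    have hle : (c.length : ℤ) ≤ -r := Int.le_of_dvd (by omega) ((dvd_neg).2 hdvd)
    have hlt := ht.lt
    have := hr (-r - t) (by omega)
    rw [C.agreesAt_shift s hdvd, show r + (-r - (t : ℤ)) = -t by ring] at this
    exact ht.not_agreesAt this
  obtain ⟨e, rfl⟩ := hdvd
  obtain ⟨e, rfl⟩ := Int.eq_ofNat_of_zero_le (nonneg_of_mul_nonneg_right hr0 hn)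
  exact ⟨e, rfl⟩

end Word

namespace StringModule

variable {k : Type u} [Field k]

theorem exists_bAt_eq_elt_pow_smul (h : C.IsPeakAt s c) {r : ℤ} (hr : C.IsDeepAt (s.shift r) c) :
    ∃ e : ℕ, bAt k C s r = c.elt k ^ e • bAt k C s 0 := by
  obtain ⟨e, rfl⟩ := h.exists_eq_of_isDeepAt_shift hr
  exact ⟨e, (elt_pow_smul_bAt_of_isDeepAt h.isDeepAt e).symm⟩

theorem exists_isPeakAt_of_forall_not_agreesAt (hC : ¬ ∃ s, ∀ l, C.AgreesAt s c l) (d : Bool) :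
    ∃ i, ∀ j, C.IsDeepAt ⟨j, d⟩ c →
      C.IsPeakAt ⟨i, d⟩ c ∧ ∃ e : ℕ, b k C j = c.elt k ^ e • bAt k C ⟨i, d⟩ 0 := by
  by_cases hd : ∃ j, C.IsDeepAt ⟨j, d⟩ c
  · obtain ⟨j, hj⟩ := hd
    obtain ⟨e, he⟩ := hj.forall_agreesAt_or_exists_isPeakAt.resolve_left fun h => hC ⟨_, h⟩
    set t : Flag := (⟨j, d⟩ : Flag).shift (-(c.length * e))
    refine ⟨t.i, fun j' hj' => ⟨he, ?_⟩⟩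
    have ht : t.shift (t.rel j') = ⟨j', d⟩ := by
      rw [Flag.shift, Flag.pos_rel]
      rfl
    obtain ⟨e', he'⟩ := exists_bAt_eq_elt_pow_smul (k := k) he (r := t.rel j') (ht ▸ hj')
    rw [bAt, Flag.pos_rel] at he'
    exact ⟨e', he'⟩
  · exact ⟨0, fun j hj => absurd ⟨j, hj⟩ hd⟩

open Polynomial in
/-- A word has at most one peak in each direction. -/
theorem exists_peak_decomposition (hC : ¬ ∃ s, ∀ l, C.AgreesAt s c l) (y : StringModule k C) :
    ∃ (N : ℕ) (y₀ : StringModule k C) (i : Bool → ℤ) (g : Bool → k[X]),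
      c.elt k ^ N • y₀ = 0 ∧ (∀ d, g d = 0 ∨ C.IsPeakAt ⟨i d, d⟩ c) ∧
      y = y₀ + ∑ d, aeval (c.elt k) (g d) • bAt k C ⟨i d, d⟩ 0 := by
  choose i hi using exists_isPeakAt_of_forall_not_agreesAt (k := k) hC
  suffices h : ∃ (N : ℕ) (y₀ : StringModule k C) (g : Bool → k[X]),
      c.elt k ^ N • y₀ = 0 ∧ (∀ d, g d = 0 ∨ C.IsPeakAt ⟨i d, d⟩ c) ∧
      y = y₀ + ∑ d, aeval (c.elt k) (g d) • bAt k C ⟨i d, d⟩ 0 by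
    obtain ⟨N, y₀, g, h⟩ := h
    exact ⟨N, y₀, i, g, h⟩
  induction b_mem_span y using Submodule.span_induction with
  | mem y hy =>
    obtain ⟨j, hj, rfl⟩ := hy
    rcases exists_isDeepAt_or_exists_elt_pow_smul_b (k := k) hj c with ⟨d, hd⟩ | ⟨N, hN⟩
    · obtain ⟨hpeak, e, he⟩ := hi d j hd
      refine ⟨0, 0, Pi.single d (X ^ e), by simp, fun d' => ?_, by cases d <;> simp [he]⟩
      rcases eq_or_ne d' d with rfl | h
      · exact Or.inr hpeak
      · exact Or.inl (by simp [h])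
    · exact ⟨N, _, 0, hN, fun _ => Or.inl rfl, by simp⟩
  | zero => exact ⟨0, 0, 0, by simp, fun _ => Or.inl rfl, by simp⟩
  | add y z _ _ hy hz =>
    obtain ⟨N, y₀, g, hy₀, hg, rfl⟩ := hy
    obtain ⟨N', z₀, g', hz₀, hg', rfl⟩ := hz
    refine ⟨N + N', y₀ + z₀, g + g', ?_, fun d => ?_, ?_⟩
    · rw [smul_add, pow_add, mul_smul, mul_smul, hz₀, smul_zero, add_zero, ← mul_smul, ← pow_add,
        add_comm, pow_add, mul_smul, hy₀, smul_zero]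
    · rcases hg d with h | h
      · exact (hg' d).imp_left fun h' => by simp [h, h']
      · exact Or.inr h
    · simp only [Pi.add_apply, map_add, add_smul, Finset.sum_add_distrib]
      abel
  | smul t y _ hy =>
    obtain ⟨N, y₀, g, hy₀, hg, rfl⟩ := hy
    refine ⟨N, t • y₀, t • g, by rw [smul_comm, hy₀, smul_zero], fun d => ?_, ?_⟩
    · exact (hg d).imp_left fun h => by simp [h]
    · simp only [Pi.smul_apply, map_smul, smul_add, smul_assoc, Finset.smul_sum]

variable {Z : Type*} [AddCommGroup Z] [Module k Z] [Module (UAlg k ρ) Z] {t : ℕ}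

/-- The linear map underlying `peakHom`: it kills the basis elements before distance `-t` from `s`,
and sends the others to the images of `x` under the paths which go round the cycle. -/
def peakMap (s : Flag) (c : ArrowCycle ρ) (t : ℕ) (x : Z) : StringModule k C →ₗ[k] Z :=
  linAt s fun l => if -t ≤ l then c.seg k 0 (c.length + l).toNat • x else 0

theorem peakMap_bAt_of_le (h : C.IsPeakAtWith s c t) (x : Z) {l : ℤ} (hl : -t ≤ l) :
    peakMap s c t x (bAt k C s l) = c.seg k 0 (c.length + l).toNat • x := by
  rw [peakMap, linAt_bAt _ (h.pos_mem hl), if_pos hl]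

theorem peakMap_bAt_of_lt (x : Z) {l : ℤ} (hl : l < -t) (hidx : s.pos l ∈ C.shape.idx) :
    peakMap s c t x (bAt k C s l) = 0 := by
  rw [peakMap, linAt_bAt _ hidx, if_neg (by omega)]

theorem arrow_sub_toNat {l : ℤ} (hl : 0 ≤ c.length + l) :
    c.arrow (0 - ((c.length + l).toNat : ℤ)) = c.arrow (-l) := by
  rw [c.arrow_eq_iff, Int.toNat_of_nonneg hl]
  exact ⟨-1, by ring⟩

variable [IsScalarTower k (UAlg k ρ) Z] in
theorem peakMap_idem_smul (h : C.IsPeakAtWith s c t) (x : Z) (a : Q) (y : StringModule k C) :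
    peakMap s c t x (idem k ρ a • y) = idem k ρ a • peakMap s c t x y := by
  have htn := h.lt
  suffices hcomp : peakMap s c t x ∘ₗ Algebra.lsmul k k _ (idem k ρ a) =
      Algebra.lsmul k k Z (idem k ρ a) ∘ₗ peakMap s c t x from LinearMap.congr_fun hcomp y
  refine hom_extAt s fun l hl => ?_
  simp only [LinearMap.comp_apply, Algebra.lsmul_coe]
  rw [idem_smul_bAt _ hl]
  rcases le_or_gt (-(t : ℤ)) l with hlt | hlt
  · have hX := arrow_sub_toNat (c := c) (l := l) (by omega)
    have hv := Word.vertex_head_at (h.agreesAt (l + 1) (by omega))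
    rw [show (1 : ℤ) - (l + 1) = -l by ring] at hv
    rw [hv, peakMap_bAt_of_le h x hlt, ← c.idem_mul_seg, hX, ← mul_smul, ← mul_assoc]
    by_cases ha : (c.arrow (-l)).left = a
    · subst ha
      rw [if_pos (by rfl), peakMap_bAt_of_le h x hlt, idem_mul_self, ← hX, c.idem_mul_seg]
    · rw [if_neg, map_zero, idem_mul_of_ne (Ne.symm ha), zero_mul, zero_smul]
      simpa [Letter.head] using ha
  · rw [peakMap_bAt_of_lt x hlt hl, smul_zero]
    split_ifs
    · exact peakMap_bAt_of_lt x hlt hl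
    · exact map_zero _

theorem peakMap_arrowElt_smul_bAt_of_le (hρ : IsString ρ) (h : C.IsPeakAtWith s c t) (x : Z)
    (y : Arrow Q) {l : ℤ} (hl : -t ≤ l) :
    peakMap s c t x (arrowElt k ρ y • bAt k C s l) =
      arrowElt k ρ y • peakMap s c t x (bAt k C s l) := by
  have htn := h.lt
  have hX := arrow_sub_toNat (c := c) (l := l) (by omega)
  have hagree := h.agreesAt (l + 1) (by omega)
  rw [peakMap_bAt_of_le h x hl, ← mul_smul]
  rcases eq_or_ne y (c.arrow (-l)) with rfl | hy
  · rw [arrowElt_smul_bAt_of_agreesAt hagree, peakMap_bAt_of_le h x (by omega), ← hX, ← c.seg_succ]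
    congr 2
    omega
  · rw [c.arrowElt_mul_seg_of_ne hρ (by omega) (by rwa [hX]), zero_smul,
      arrowElt_smul_bAt _ (h.pos_mem hl)]
    split_ifs with hdir hinv
    · refine peakMap_bAt_of_lt x ?_ (Word.mem_of_letterAt hdir).2
      by_contra! hle
      have := h.agreesAt l (by omega)
      rw [Word.AgreesAt, hdir] at this
      simp at this
    · rw [Word.AgreesAt, hinv, show (1 : ℤ) - (l + 1) = -l by ring, Option.some.injEq,
        Letter.inv.injEq] at hagree
      exact absurd hagree hy
    · exact map_zero _

theorem peakMap_arrowElt_smul_bAt_of_lt (hρ : IsString ρ) (h : C.IsPeakAtWith s c t) (x : Z)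
    (y : Arrow Q) {l : ℤ} (hl : l < -t) (hidx : s.pos l ∈ C.shape.idx) :
    peakMap s c t x (arrowElt k ρ y • bAt k C s l) =
      arrowElt k ρ y • peakMap s c t x (bAt k C s l) := by
  rw [peakMap_bAt_of_lt x hl hidx, smul_zero, arrowElt_smul_bAt _ hidx]
  split_ifs with hdir hinv
  · exact peakMap_bAt_of_lt x (by omega) (Word.mem_of_letterAt hdir).2
  · refine peakMap_bAt_of_lt x ?_ (Word.mem_of_letterAt hinv).1
    -- otherwise `y⁻¹` precedes the first letter of agreement and extends it
    by_contra! hle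
    obtain rfl : l = -t - 1 := by omega
    rw [sub_add_cancel] at hinv
    apply h.not_agreesAt
    have hallowed := Word.allowed_of_letterAt_inv hinv (h.agreesAt (-t + 1) (by omega))
    rw [Word.AgreesAt, hinv, hallowed.right_unique hρ (c.allowed (1 - (-(t : ℤ) + 1)))]
    congr 3
    ring
  · exact map_zero _

variable [IsScalarTower k (UAlg k ρ) Z]

theorem peakMap_arrowElt_smul (hρ : IsString ρ) (h : C.IsPeakAtWith s c t) (x : Z)
    (y : Arrow Q) (z : StringModule k C) :
    peakMap s c t x (arrowElt k ρ y • z) = arrowElt k ρ y • peakMap s c t x z := by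
  suffices hcomp : peakMap s c t x ∘ₗ Algebra.lsmul k k _ (arrowElt k ρ y) =
      Algebra.lsmul k k Z (arrowElt k ρ y) ∘ₗ peakMap s c t x from LinearMap.congr_fun hcomp z
  refine hom_extAt s fun l hl => ?_
  rcases le_or_gt (-(t : ℤ)) l with hlt | hlt
  · exact peakMap_arrowElt_smul_bAt_of_le hρ h x y hlt
  · exact peakMap_arrowElt_smul_bAt_of_lt hρ h x y hlt hl

variable (k) in
/-- The homomorphism `M(C) ⟶ Z` defined by a peak `s` and an element `x` of `Z`: it sends the peak
to `p • x`, where `p` is the cycle, and kills all that lies before the cycle containing the peak. -/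
def peakHom (hρ : IsString ρ) (h : C.IsPeakAtWith s c t) (x : Z) :
    StringModule k C →ₗ[UAlg k ρ] Z :=
  homOfGenerators (peakMap s c t x) (peakMap_idem_smul h x) (peakMap_arrowElt_smul hρ h x)

theorem peakHom_bAt_of_le (hρ : IsString ρ) (h : C.IsPeakAtWith s c t) (x : Z) {l : ℤ}
    (hl : -t ≤ l) : peakHom k hρ h x (bAt k C s l) = c.seg k 0 (c.length + l).toNat • x :=
  peakMap_bAt_of_le h x hl

theorem peakHom_bAt_of_lt (hρ : IsString ρ) (h : C.IsPeakAtWith s c t) (x : Z) {l : ℤ}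
    (hl : l < -t) (hidx : s.pos l ∈ C.shape.idx) : peakHom k hρ h x (bAt k C s l) = 0 :=
  peakMap_bAt_of_lt x hl hidx

end StringModule

end Peaks

section PeakExtensions

open Polynomial

variable {Q : Type v} [Quiver.{w} Q] {ρ : Set (QPath Q)} {C : Word ρ} {s : Flag} {c : ArrowCycle ρ}
  {k : Type u} [Field k]

namespace ArrowCycle

theorem seg_mul_seg_succ (hρ : IsString ρ) (c : ArrowCycle ρ) {j : ℕ} (hj : j < c.length) (r : ℕ) :
    c.seg k (-(j + 1 : ℕ)) (2 * c.length - 1 - j) * c.seg k 0 (r + 1) =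
      if r % c.length = j then c.elt k ^ (r / c.length + 2) else 0 := by
  have hdiv := Nat.mod_add_div r c.length
  split_ifs with hr
  · rw [hr] at hdiv
    have hlen : r + 1 + (2 * c.length - 1 - j) = c.length * (r / c.length + 1 + 1) := by
      rw [mul_add, mul_add]
      omega
    rw [c.seg_congr (j := 0 - (r + 1 : ℕ)), ← c.seg_add, hlen, c.seg_length_mul]
    generalize r / c.length = e at hdiv
    exact ⟨e, by rw [← hdiv]; push_cast; ring⟩
  · refine c.seg_mul_seg_of_not_dvd hρ (by omega) (by omega) ?_
    rintro ⟨e, he⟩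
    apply hr
    have hr' : (r : ℤ) = j + c.length * e := by push_cast at he; linarith
    zify
    rw [hr', Int.add_mul_emod_self_left, Int.emod_eq_of_lt (by omega) (by omega)]

theorem exists_mul_linearCombination_seg_eq (hρ : IsString ρ) (c : ArrowCycle ρ) {a : ℕ →₀ k}
    (ha : a ≠ 0) : ∃ (u : UAlg k ρ) (g : k[X]), g ≠ 0 ∧
      u * Finsupp.linearCombination k (fun r => c.seg k 0 (r + 1)) a =
        aeval (c.elt k) g * c.elt k := by
  obtain ⟨r₀, hr₀⟩ := Finsupp.ne_iff.1 ha
  let g : k[X] := ∑ r ∈ a.support,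
    a r • if r % c.length = r₀ % c.length then X ^ (r / c.length + 1) else 0
  have hg : g.coeff (r₀ / c.length + 1) = a r₀ := by
    rw [finsetSum_coeff, Finset.sum_eq_single r₀]
    · simp
    · intro r _ hne
      rw [coeff_smul]
      split_ifs with hmod
      · rw [coeff_X_pow, if_neg, smul_zero]
        intro hquot
        apply hne
        rw [← Nat.mod_add_div r c.length, ← Nat.mod_add_div r₀ c.length, hmod,
          Nat.succ_injective hquot]
      · simp
    · intro h
      simp [Finsupp.notMem_support_iff.1 h]
  refine ⟨c.seg k (-(r₀ % c.length + 1 : ℕ)) (2 * c.length - 1 - r₀ % c.length), g,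
    fun h0 => hr₀ (by rw [← hg, h0, coeff_zero, Finsupp.zero_apply]), ?_⟩
  rw [Finsupp.linearCombination_apply, Finsupp.sum, Finset.mul_sum, map_sum, Finset.sum_mul]
  refine Finset.sum_congr rfl fun r _ => ?_
  rw [mul_smul_comm, c.seg_mul_seg_succ hρ (Nat.mod_lt _ c.length_pos), map_smul, smul_mul_assoc]
  split_ifs
  · rw [map_pow, aeval_X, ← pow_succ]
  · rw [map_zero, zero_mul]

end ArrowCycle

namespace StringModule

theorem coeffAt_aeval_smul_bAt (h : C.IsDeepAt s c) (g : k[X]) (e : ℕ) :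
    coeffAt s (c.length * e) (aeval (c.elt k) g • bAt k C s 0) = g.coeff e := by
  induction g using Polynomial.induction_on' with
  | add g g' hg hg' => rw [map_add, add_smul, map_add, hg, hg', coeff_add]
  | monomial e' t =>
    have he' : (0 : ℤ) ≤ c.length * e' := by positivity
    have hpos := (Word.mem_of_letterAt (h (c.length * e' + 1) (by omega))).2
    rw [add_sub_cancel_right] at hpos
    rw [aeval_monomial, mul_smul, elt_pow_smul_bAt_of_isDeepAt h, algebraMap_smul, map_smul,
      coeffAt_bAt hpos, coeff_monomial, smul_eq_mul]
    simp [c.length_pos.ne']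

/-- The span of the basis elements at distance less than `N` from the flag `s`. -/
def spanBelow (s : Flag) (N : ℤ) : Submodule k (StringModule k C) :=
  Submodule.span k {y | ∃ l < N, s.pos l ∈ C.shape.idx ∧ y = bAt k C s l}

theorem map_eq_zero_of_mem_spanBelow {A : Type*} [AddCommGroup A] [Module k A] {N : ℤ}
    {φ : StringModule k C →ₗ[k] A} (hφ : ∀ l < N, s.pos l ∈ C.shape.idx → φ (bAt k C s l) = 0)
    {y : StringModule k C} (hy : y ∈ spanBelow s N) : φ y = 0 := by
  refine (Submodule.span_le (p := LinearMap.ker φ)).2 ?_ hy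
  rintro _ ⟨l, hl, hidx, rfl⟩
  exact hφ l hl hidx

theorem eq_zero_of_aeval_smul_bAt_add_eq_zero (h : C.IsDeepAt s c) {g : k[X]}
    {y : StringModule k C} (hy : aeval (c.elt k) g • y ∈ spanBelow s (-c.length))
    (hg : aeval (c.elt k) g • (bAt k C s 0 + y) = 0) : g = 0 := by
  ext e
  have hcoeff := congrArg (coeffAt s (c.length * e)) hg
  rwa [smul_add, map_add, coeffAt_aeval_smul_bAt h,
    map_eq_zero_of_mem_spanBelow (fun l hl hidx => ?_) hy, map_zero, add_zero] at hcoeff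
  rw [coeffAt_bAt hidx, if_neg]
  have : (0 : ℤ) ≤ c.length * e := by positivity
  omega

variable {Z : Type*} [AddCommGroup Z] [Module k Z] [Module (UAlg k ρ) Z]
  [IsScalarTower k (UAlg k ρ) Z] {t : ℕ}

theorem peakHom_bAt_zero (hρ : IsString ρ) (h : C.IsPeakAtWith s c t) (x : Z) :
    peakHom k hρ h x (bAt k C s 0) = c.elt k • x := by
  rw [peakHom_bAt_of_le hρ h x (by omega), add_zero, Int.toNat_natCast]
  rfl

theorem peakHom_eq_zero_of_mem_spanBelow (hρ : IsString ρ) (h : C.IsPeakAtWith s c t) (x : Z)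
    {y : StringModule k C} (hy : y ∈ spanBelow s (-c.length)) : peakHom k hρ h x y = 0 :=
  map_eq_zero_of_mem_spanBelow (φ := peakMap s c t x)
    (fun l hl hidx => peakMap_bAt_of_lt x (by have := h.lt; omega) hidx) hy

theorem exists_peakHom_eq_linearCombination_seg_smul (hρ : IsString ρ)
    (h : C.IsPeakAtWith s c t) (x : Z) (y : StringModule k C) :
    ∃ a : ℕ →₀ k, peakHom k hρ h x y =
      Finsupp.linearCombination k (fun r => c.seg k 0 (r + 1)) a • x := by
  induction bAt_mem_span s y using Submodule.span_induction with
  | mem y hy =>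
    obtain ⟨l, hl, rfl⟩ := hy
    rcases le_or_gt (-(t : ℤ)) l with hlt | hlt
    · have htn := h.lt
      refine ⟨Finsupp.single (c.length + l - 1).toNat 1, ?_⟩
      rw [peakHom_bAt_of_le hρ h x hlt, Finsupp.linearCombination_single, one_smul]
      congr 2
      omega
    · exact ⟨0, by rw [peakHom_bAt_of_lt hρ h x hlt hl, map_zero, zero_smul]⟩
  | zero => exact ⟨0, by rw [map_zero, map_zero, zero_smul]⟩
  | add y z _ _ hy hz =>
    obtain ⟨a, ha⟩ := hy
    obtain ⟨a', ha'⟩ := hz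
    exact ⟨a + a', by rw [map_add, map_add, ha, ha', add_smul]⟩
  | smul r y _ hy =>
    obtain ⟨a, ha⟩ := hy
    exact ⟨r • a, by rw [LinearMap.map_smul_of_tower, map_smul, ha, smul_assoc]⟩

theorem exists_smul_peakHom_eq (hρ : IsString ρ) (h : C.IsPeakAtWith s c t) {x : Z}
    {y : StringModule k C} (hy : peakHom k hρ h x y ≠ 0) :
    ∃ (u : UAlg k ρ) (g : k[X]), g ≠ 0 ∧
      u • peakHom k hρ h x y = aeval (c.elt k) g • c.elt k • x := by
  obtain ⟨a, ha⟩ := exists_peakHom_eq_linearCombination_seg_smul hρ h x y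
  obtain ⟨u, g, hg, hu⟩ := c.exists_mul_linearCombination_seg_eq hρ (a := a) (by
    rintro rfl
    exact hy (by rw [ha, map_zero, zero_smul]))
  exact ⟨u, g, hg, by rw [ha, ← mul_smul, hu, mul_smul]⟩

end StringModule

theorem dvd_of_aeval_smul_eq_zero {A S : Type*} [Ring A] [Algebra k A] [AddCommGroup S] [Module A S]
    {p : A} {f g : k[X]} {x : S} (hf : Irreducible f) (hx : x ≠ 0) (hfx : aeval p f • x = 0)
    (hgx : aeval p g • x = 0) : f ∣ g := by
  by_contra h
  obtain ⟨a, b, hab⟩ := hf.coprime_iff_not_dvd.2 h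
  apply hx
  rw [← one_smul A x, ← map_one (aeval (R := k) p), ← hab, map_add, map_mul, map_mul, add_smul,
    mul_smul, mul_smul, hfx, hgx, smul_zero, smul_zero, add_zero]

theorem not_one_add_X_mul_dvd {f₁ : k[X]} (hf : ¬ IsUnit (1 + X * f₁)) : ¬ 1 + X * f₁ ∣ f₁ :=
  fun hd => hf (isUnit_of_dvd_one ((dvd_add_left (hd.mul_left X)).1 dvd_rfl))

theorem range_sup_span_singleton_eq_top {A Y Z S : Type*} [Ring A] [AddCommGroup Y] [Module A Y]
    [AddCommGroup Z] [Module A Z] [AddCommGroup S] [Module A S] [IsSimpleModule A S]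
    {ι : Y →ₗ[A] Z} {q : Z →ₗ[A] S} (hq : LinearMap.ker q = LinearMap.range ι) {m : Z}
    (hqm : q m ≠ 0) :
    LinearMap.range ι ⊔ Submodule.span A {m} = ⊤ := by
  rw [eq_top_iff]
  intro z _
  obtain ⟨u, hu⟩ : ∃ u : A, u • q m = q z :=
    Submodule.mem_span_singleton.1
      (IsSimpleModule.span_singleton_eq_top A hqm ▸ Submodule.mem_top)
  have hz : z - u • m ∈ LinearMap.range ι := by
    rw [← hq, LinearMap.mem_ker, map_sub, map_smul, hu, sub_self]
  exact Submodule.mem_sup.2 ⟨_, hz, _, Submodule.smul_mem _ u (Submodule.mem_span_singleton_self m),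
    sub_add_cancel _ _⟩

open StringModule

variable {Z : Type*} [AddCommGroup Z] [Module k Z] [Module (UAlg k ρ) Z]
  [IsScalarTower k (UAlg k ρ) Z] {ι : StringModule k C →ₗ[UAlg k ρ] Z} {f₁ : k[X]} {m : Z}
  {y : StringModule k C} {t : ℕ}

theorem add_peakHom_apply (hρ : IsString ρ) (h : C.IsPeakAtWith s c t)
    (hy : y ∈ spanBelow s (-c.length))
    (hm : aeval (c.elt k) (1 + X * f₁) • m = ι (bAt k C s 0 + y)) :
    (ι + peakHom k hρ h (-(aeval (c.elt k) f₁ • m))) (bAt k C s 0 + y) = m := by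
  rw [LinearMap.add_apply, ← hm, map_add (peakHom k hρ h _), peakHom_bAt_zero,
    peakHom_eq_zero_of_mem_spanBelow hρ h _ hy, map_add, map_one, map_mul, aeval_X, add_smul,
    one_smul, mul_smul, smul_neg]
  abel

variable {S : Type*} [AddCommGroup S] [Module (UAlg k ρ) S] {q : Z →ₗ[UAlg k ρ] S}

theorem exists_smul_eq_aeval_smul_of_add_peakHom_eq_zero (hρ : IsString ρ)
    (h : C.IsPeakAtWith s c t) (hι : Function.Injective ι)
    (hq : LinearMap.ker q = LinearMap.range ι) (hf : Irreducible (1 + X * f₁))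
    (hm : aeval (c.elt k) (1 + X * f₁) • m = ι y) (hqm : q (c.elt k • m) ≠ 0)
    {z : StringModule k C} (hz : (ι + peakHom k hρ h (-(aeval (c.elt k) f₁ • m))) z = 0)
    (hz0 : z ≠ 0) :
    ∃ (u : UAlg k ρ) (g : k[X]), g ≠ 0 ∧ u • z = aeval (c.elt k) (X * (g * f₁)) • y := by
  have hqι : ∀ z, q (ι z) = 0 := fun z => by
    rw [← LinearMap.mem_ker, hq]
    exact LinearMap.mem_range_self ι z
  have hmul : ∀ (g g' : k[X]) (z : Z), aeval (c.elt k) g • aeval (c.elt k) g' • z =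
      aeval (c.elt k) (g * g') • z := fun g g' z => by rw [map_mul, mul_smul]
  have hX : ∀ z : Z, c.elt k • z = aeval (c.elt k) (X : k[X]) • z := fun z => by rw [aeval_X]
  have hηz := eq_neg_of_add_eq_zero_right (LinearMap.add_apply ι _ z ▸ hz)
  have hιz : -ι z ≠ 0 := neg_ne_zero.2 ((map_ne_zero_iff ι hι).2 hz0)
  obtain ⟨u, h', hh', hu⟩ := exists_smul_peakHom_eq hρ h (hηz ▸ hιz)
  have hιuz : ι (u • z) = aeval (c.elt k) (h' * f₁ * X) • m := by
    rw [map_smul, ← neg_neg (ι z), ← hηz, smul_neg, hu, smul_neg, smul_neg, neg_neg, hX, hmul, hmul]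
    congr 2
    ring
  have hdvd : (1 + X * f₁) ∣ h' * f₁ := by
    refine dvd_of_aeval_smul_eq_zero (p := c.elt k) hf hqm ?_ ?_
    · rw [← map_smul, hX, hmul, mul_comm, ← hmul, hm, ← map_smul, hqι]
    · rw [← map_smul, hX, hmul, ← hιuz, hqι]
  obtain ⟨g, rfl⟩ :=
    (hf.prime.dvd_or_dvd hdvd).resolve_right (not_one_add_X_mul_dvd hf.not_isUnit)
  refine ⟨u, g, right_ne_zero_of_mul hh', hι ?_⟩
  rw [hιuz, map_smul, ← hm, hmul]
  congr 2
  ring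

theorem injective_add_peakHom (hρ : IsString ρ) (h : C.IsPeakAtWith s c t)
    (hι : Function.Injective ι) (hq : LinearMap.ker q = LinearMap.range ι)
    (hf : Irreducible (1 + X * f₁))
    (hy : ∀ g : k[X], aeval (c.elt k) g • y ∈ spanBelow s (-c.length))
    (hm : aeval (c.elt k) (1 + X * f₁) • m = ι (bAt k C s 0 + y)) (hqm : q (c.elt k • m) ≠ 0) :
    Function.Injective (ι + peakHom k hρ h (-(aeval (c.elt k) f₁ • m))) := by
  rw [injective_iff_map_eq_zero]
  intro z hz
  by_contra hz0
  obtain ⟨u, g, hg, huz⟩ :=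
    exists_smul_eq_aeval_smul_of_add_peakHom_eq_zero hρ h hι hq hf hm hqm hz hz0
  have hgm : aeval (c.elt k) (X * (g * f₁)) • m = 0 := by
    rw [← add_peakHom_apply hρ h (by simpa using hy 1) hm, ← map_smul, ← huz, map_smul, hz,
      smul_zero]
  have hgb : aeval (c.elt k) (X * (g * f₁)) • (bAt k C s 0 + y) = 0 := by
    apply hι
    rw [map_smul, ← hm, ← mul_smul, ← map_mul, mul_comm, map_mul, mul_smul, hgm, smul_zero,
      map_zero]
  have hf₁ : f₁ ≠ 0 := fun hf₁ => not_one_add_X_mul_dvd hf.not_isUnit (hf₁ ▸ dvd_zero _)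
  exact mul_ne_zero X_ne_zero (mul_ne_zero hg hf₁)
    (eq_zero_of_aeval_smul_bAt_add_eq_zero h.isDeepAt (hy _) hgb)

theorem surjective_add_peakHom (hρ : IsString ρ) [IsSimpleModule (UAlg k ρ) S]
    (h : C.IsPeakAtWith s c t) (hq : LinearMap.ker q = LinearMap.range ι)
    (hy : y ∈ spanBelow s (-c.length))
    (hm : aeval (c.elt k) (1 + X * f₁) • m = ι (bAt k C s 0 + y)) (hqm : q (c.elt k • m) ≠ 0) :
    Function.Surjective (ι + peakHom k hρ h (-(aeval (c.elt k) f₁ • m))) := by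
  set η := peakHom k hρ h (-(aeval (c.elt k) f₁ • m))
  have hm_mem : m ∈ LinearMap.range (ι + η) := ⟨_, add_peakHom_apply hρ h hy hm⟩
  have hη_mem : ∀ z, η z ∈ LinearMap.range (ι + η) := fun z => by
    obtain ⟨a, ha⟩ :=
      exists_peakHom_eq_linearCombination_seg_smul hρ h (-(aeval (c.elt k) f₁ • m)) z
    exact ha ▸ Submodule.smul_mem _ _ (neg_mem (Submodule.smul_mem _ _ hm_mem))
  rw [← LinearMap.range_eq_top, ← top_le_iff, ← range_sup_span_singleton_eq_top hq hqm, sup_le_iff,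
    Submodule.span_singleton_le_iff_mem]
  refine ⟨?_, Submodule.smul_mem _ _ hm_mem⟩
  rintro _ ⟨z, rfl⟩
  rw [← add_sub_cancel_right (ι z) (η z)]
  exact sub_mem ⟨z, rfl⟩ (hη_mem z)

end PeakExtensions

/-! ### The dichotomy for extensions by a string module -/

section Dichotomy

open Polynomial StringModule

variable {Q : Type v} [Quiver.{w} Q] {ρ : Set (QPath Q)} {C : Word ρ} {s : Flag} {c : ArrowCycle ρ}
  {k : Type u} [Field k]

section PolynomialAction

variable {A Y : Type*} [Ring A] [Algebra k A] [AddCommGroup Y] [Module A Y]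

theorem smul_aeval_smul_comm (p : A) (f : k[X]) (y : Y) :
    p • aeval p f • y = aeval p f • p • y := by
  have hcomm : Commute p (aeval p f) := by simpa only [aeval_X] using (commute_X f).map (aeval p)
  rw [← mul_smul, hcomm.eq, mul_smul]

theorem aeval_smul_aeval_smul_comm (p : A) (f g : k[X]) (y : Y) :
    aeval p f • aeval p g • y = aeval p g • aeval p f • y := by
  rw [← mul_smul, ← map_mul, mul_comm, map_mul, mul_smul]

theorem isCoprime_one_add_X_mul (f₁ : k[X]) (N : ℕ) : IsCoprime (1 + X * f₁) (X ^ N) :=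
  IsCoprime.pow_right ⟨1, -f₁, by ring⟩

theorem exists_eq_aeval_smul_add {f g : k[X]} (hfg : IsCoprime f g) (p : A) (y : Y) :
    ∃ (b : k[X]) (y' : Y), y = aeval p f • y' + aeval p (b * g) • y := by
  obtain ⟨a, b, hab⟩ := hfg
  refine ⟨b, aeval p a • y, ?_⟩
  rw [← mul_smul, ← map_mul, ← add_smul, ← map_add, mul_comm f, hab, map_one, one_smul]

theorem exists_eq_aeval_smul {p : A} (f₁ : k[X]) {N : ℕ} {y : Y} (hy : p ^ N • y = 0) :
    ∃ y' : Y, y = aeval p (1 + X * f₁) • y' := by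
  obtain ⟨b, y', hy'⟩ := exists_eq_aeval_smul_add (isCoprime_one_add_X_mul f₁ N) p y
  rw [map_mul, mul_smul, map_pow, aeval_X, hy, smul_zero, add_zero] at hy'
  exact ⟨y', hy'⟩

theorem exists_aeval_smul_sub_eq_zero (p : A) (f₁ : k[X]) {g : k[X]} (hg : g ≠ 0) {y : Y}
    (hy : aeval p g • y = 0) :
    ∃ (y' : Y) (f' : k[X]), f'.eval 0 = 1 ∧
      aeval p f' • (y - aeval p (1 + X * f₁) • y') = 0 := by
  obtain ⟨g', hgg', hnd⟩ := exists_eq_pow_rootMultiplicity_mul_and_not_dvd g hg 0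
  rw [map_zero, sub_zero] at hgg' hnd
  have hg'0 : g'.coeff 0 ≠ 0 := by rwa [Ne, ← X_dvd_iff]
  obtain ⟨b, y', hy'⟩ :=
    exists_eq_aeval_smul_add (isCoprime_one_add_X_mul f₁ (rootMultiplicity 0 g)) p y
  refine ⟨y', C (g'.coeff 0)⁻¹ * g', ?_, ?_⟩
  · rw [eval_mul, eval_C, ← coeff_zero_eq_eval_zero, inv_mul_cancel₀ hg'0]
  · have hmul : C (g'.coeff 0)⁻¹ * g' * (b * X ^ rootMultiplicity 0 g) =
        C (g'.coeff 0)⁻¹ * b * (X ^ rootMultiplicity 0 g * g') := by ring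
    rw [← eq_sub_iff_add_eq'.2 hy'.symm, ← mul_smul, ← map_mul, hmul, ← hgg', map_mul, mul_smul,
      hy, smul_zero]

-- With `e f + h g = 1` one has `f (h m + e b) = b + h g' b'`, and subtracting
-- `f (1 - X f₁) h g' b'`, where `f (1 - X f₁) = 1 - X² f₁²`, leaves a multiple of `X² g'`.
theorem exists_aeval_smul_eq_add {p : A} {f₁ g g' : k[X]} (hf : Irreducible (1 + X * f₁))
    (hg : ¬ 1 + X * f₁ ∣ g) {m b b' : Y}
    (hm : aeval p (1 + X * f₁) • m = aeval p g • b + aeval p g' • b') :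
    ∃ h r u v : k[X], ¬ 1 + X * f₁ ∣ h ∧
      aeval p (1 + X * f₁) • (aeval p h • m + (aeval p u • b + aeval p v • b')) =
        b + aeval p (X ^ 2 * (r * g')) • b' := by
  obtain ⟨e, h, heh⟩ := hf.coprime_iff_not_dvd.2 hg
  refine ⟨h, f₁ ^ 2 * h, e, -((1 - X * f₁) * h * g'), fun hd => ?_, ?_⟩
  · refine hf.not_isUnit (isUnit_of_dvd_one ?_)
    have hdvd := dvd_add (Dvd.intro_left e rfl) (hd.mul_right g)
    rwa [heh] at hdvd
  · let _ : Module k[X] Y := Module.compHom Y (aeval p).toRingHom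
    change (1 + X * f₁) • m = g • b + g' • b' at hm
    change (1 + X * f₁) • (h • m + (e • b + -((1 - X * f₁) * h * g') • b')) =
      b + (X ^ 2 * (f₁ ^ 2 * h * g')) • b'
    have hb : b = (e * (1 + X * f₁) + h * g) • b := by rw [heh, one_smul]
    nth_rewrite 2 [hb]
    linear_combination (norm := module) (h : k[X]) • hm

end PolynomialAction

theorem Word.IsDeepAt.rel_le {s' : Flag} (h : C.IsDeepAt s c) (h' : C.IsDeepAt s' c)
    (hd : s'.d = !s.d) (l : ℤ) : s.rel (s'.pos l) ≤ -l := by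
  rcases s with ⟨i, d⟩
  rcases s' with ⟨j, d'⟩
  obtain rfl : d' = !d := hd
  by_contra! hlt
  rcases d with _ | _
  · simp only [Flag.rel, Flag.pos, Bool.not_false, Bool.false_eq_true, if_false, if_true] at hlt
    have hi := h (i - j) (by omega)
    have hj := h' 1 le_rfl
    simp only [Word.AgreesAt, Word.letterAt, Bool.not_false, Bool.false_eq_true, if_false, if_true]
      at hi hj
    rw [show i + 1 - (i - j) = j + 1 by ring, hj] at hi
    simp [Letter.inverse] at hi
  · simp only [Flag.rel, Flag.pos, Bool.not_true, Bool.false_eq_true, if_false, if_true] at hlt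
    have hj := h' (j - i) (by omega)
    have hi := h 1 le_rfl
    simp only [Word.AgreesAt, Word.letterAt, Bool.not_true, Bool.false_eq_true, if_false, if_true]
      at hi hj
    rw [show j + 1 - (j - i) = i + 1 by ring, hi] at hj
    simp [Letter.inverse] at hj

theorem Word.IsDeepAt.pos_mem {l : ℤ} (h : C.IsDeepAt s c) (hl : 0 ≤ l) :
    s.pos l ∈ C.shape.idx := by
  have := (Word.mem_of_letterAt (h (l + 1) (by omega))).2
  rwa [add_sub_cancel_right] at this

theorem StringModule.aeval_smul_bAt_mem_spanBelow {s' : Flag} (h : C.IsDeepAt s c)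
    (h' : C.IsDeepAt s' c) (hd : s'.d = !s.d) (g : k[X]) :
    aeval (c.elt k) (X ^ 2 * g) • bAt k C s' 0 ∈ spanBelow s (-c.length) := by
  induction g using Polynomial.induction_on' with
  | add g g' hg hg' => rw [mul_add, map_add, add_smul]; exact add_mem hg hg'
  | monomial e t =>
    rw [X_pow_mul_monomial, aeval_monomial, mul_smul, elt_pow_smul_bAt_of_isDeepAt h',
      algebraMap_smul]
    refine Submodule.smul_mem _ _ (Submodule.subset_span
      ⟨s.rel (s'.pos (c.length * (e + 2 : ℕ))), ?_, ?_, by rw [bAt, bAt, Flag.pos_rel]⟩)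
    · have hle := h.rel_le h' hd (c.length * (e + 2 : ℕ))
      have hn := c.length_pos
      have : (c.length : ℤ) * 1 < c.length * (e + 2 : ℕ) := by
        apply mul_lt_mul_of_pos_left <;> push_cast <;> omega
      omega
    · rw [Flag.pos_rel]
      exact h'.pos_mem (by positivity)

variable {Z : Type*} [AddCommGroup Z] [Module (UAlg k ρ) Z] {S : Type*} [AddCommGroup S]
  [Module (UAlg k ρ) S] {ι : StringModule k C →ₗ[UAlg k ρ] Z} {q : Z →ₗ[UAlg k ρ] S} {f₁ : k[X]}
  {m : Z} {y : StringModule k C}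

theorem exists_bijective_add_peakHom [Module k Z] [IsScalarTower k (UAlg k ρ) Z] (hρ : IsString ρ)
    [IsSimpleModule (UAlg k ρ) S] (hι : Function.Injective ι)
    (hq : LinearMap.ker q = LinearMap.range ι) (hf : Irreducible (1 + X * f₁)) {s' : Flag}
    {g g' : k[X]} (hs : C.IsPeakAt s c) (hs' : g' = 0 ∨ C.IsPeakAt s' c) (hd : s'.d = !s.d)
    (hg : ¬ 1 + X * f₁ ∣ g)
    (hm : aeval (c.elt k) (1 + X * f₁) • m =
      ι (aeval (c.elt k) g • bAt k C s 0 + aeval (c.elt k) g' • bAt k C s' 0))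
    (hqm : c.elt k • q m ≠ 0) :
    ∃ (t : ℕ) (h : C.IsPeakAtWith s c t) (x : Z),
      Function.Bijective (ι + peakHom k hρ h x) := by
  obtain ⟨t, h⟩ := hs
  have hqι : ∀ z, q (ι z) = 0 := fun z => by
    rw [← LinearMap.mem_ker, hq]
    exact ⟨z, rfl⟩
  obtain ⟨h', r, u, v, hh', hm'⟩ := exists_aeval_smul_eq_add hf hg
    (hm.trans (by rw [map_add, map_smul, map_smul]))
  set m' := aeval (c.elt k) h' • m +
    (aeval (c.elt k) u • ι (bAt k C s 0) + aeval (c.elt k) v • ι (bAt k C s' 0)) with hm'def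
  rw [← map_smul ι, ← map_add] at hm'
  have hqm' : q (c.elt k • m') ≠ 0 := fun h0 => by
    rw [hm'def, ← map_smul ι, ← map_smul ι, ← map_add ι, map_smul q, map_add q, hqι, add_zero,
      map_smul, smul_aeval_smul_comm] at h0
    refine hh' (dvd_of_aeval_smul_eq_zero (p := c.elt k) hf hqm ?_ h0)
    rw [← smul_aeval_smul_comm, ← map_smul q, hm, hqι, smul_zero]
  have hy : ∀ a : k[X], aeval (c.elt k) a • aeval (c.elt k) (X ^ 2 * (r * g')) • bAt k C s' 0 ∈
      spanBelow s (-c.length) := fun a => by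
    rcases hs' with rfl | hs'
    · simp
    · rw [← mul_smul, ← map_mul, mul_left_comm]
      exact aeval_smul_bAt_mem_spanBelow h.isDeepAt hs'.isDeepAt hd _
  exact ⟨t, h, _, injective_add_peakHom hρ h hι hq hf hy hm' hqm',
    surjective_add_peakHom hρ h hq (by simpa using hy 1) hm' hqm'⟩

theorem dvd_or_exists_bijective_add_peakHom [Module k Z] [IsScalarTower k (UAlg k ρ) Z]
    (hρ : IsString ρ) [IsSimpleModule (UAlg k ρ) S] (hι : Function.Injective ι)
    (hq : LinearMap.ker q = LinearMap.range ι) (hf : Irreducible (1 + X * f₁))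
    (hm : aeval (c.elt k) (1 + X * f₁) • m = ι y) (hqm : c.elt k • q m ≠ 0)
    (hC : ¬ ∃ s, ∀ l, C.AgreesAt s c l) :
    (∃ y', y = aeval (c.elt k) (1 + X * f₁) • y') ∨
      ∃ (s : Flag) (t : ℕ) (h : C.IsPeakAtWith s c t) (x : Z),
        Function.Bijective (ι + peakHom k hρ h x) := by
  obtain ⟨N, y₀, i, g, hN, hg, hy⟩ := exists_peak_decomposition (k := k) hC y
  obtain ⟨y₀, rfl⟩ := exists_eq_aeval_smul f₁ hN
  by_cases hfg : ∀ d, 1 + X * f₁ ∣ g d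
  · choose g' hg' using hfg
    refine Or.inl ⟨y₀ + ∑ d, aeval (c.elt k) (g' d) • bAt k C ⟨i d, d⟩ 0, ?_⟩
    simp_rw [hy, hg', smul_add, Finset.smul_sum, map_mul, mul_smul]
  · push Not at hfg
    obtain ⟨d, hd⟩ := hfg
    have hsum : ∑ d, aeval (c.elt k) (g d) • bAt k C ⟨i d, d⟩ 0 =
        aeval (c.elt k) (g d) • bAt k C ⟨i d, d⟩ 0 +
          aeval (c.elt k) (g !d) • bAt k C ⟨i !d, !d⟩ 0 := by
      cases d
      · rw [Fintype.sum_bool, add_comm, Bool.not_false]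
      · rw [Fintype.sum_bool, Bool.not_true]
    refine Or.inr ⟨_, exists_bijective_add_peakHom (m := m - ι y₀) hρ hι hq hf
      ((hg d).resolve_left fun h0 => hd (h0 ▸ dvd_zero _)) (hg !d) rfl hd ?_ ?_⟩
    · rw [smul_sub, hm, hy, map_add, map_smul ι, add_sub_cancel_left, hsum]
    · have hqy₀ : q (ι y₀) = 0 := by
        rw [← LinearMap.mem_ker, hq]
        exact LinearMap.mem_range_self ι y₀
      rwa [map_sub, hqy₀, sub_zero]

namespace StringModule

/-- The submodule spanned by the basis elements at distance at least `B` from the flag `s`, in a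
string module whose word is `∞(P⁻¹)∞` when it is seen from `s`. -/
def submoduleFrom (k : Type u) [Field k] (h : ∀ l, C.AgreesAt s c l) (B : ℤ) :
    Submodule (UAlg k ρ) (StringModule k C) :=
  stableSpan {y : StringModule k C | ∃ l, B ≤ l ∧ y = bAt k C s l}
    (by
      classical
      rintro a _ ⟨l, hl, rfl⟩
      rw [idem_smul_bAt _ (Word.mem_of_letterAt (h l)).1]
      split_ifs
      · exact Submodule.subset_span ⟨l, hl, rfl⟩
      · exact zero_mem _)
    (by
      classical
      rintro x _ ⟨l, hl, rfl⟩
      have hne : C.letterAt s l ≠ some (.dir x) := fun hx => by simpa [hx] using (h l).symm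
      rw [arrowElt_smul_bAt _ (Word.mem_of_letterAt (h l)).1, if_neg hne]
      split_ifs
      · exact Submodule.subset_span ⟨l + 1, by omega, rfl⟩
      · exact zero_mem _)

variable (h : ∀ l, C.AgreesAt s c l)

theorem bAt_mem_submoduleFrom {B l : ℤ} (hl : B ≤ l) : bAt k C s l ∈ submoduleFrom k h B :=
  Submodule.subset_span (R := k) ⟨l, hl, rfl⟩

theorem submoduleFrom_antitone : Antitone (submoduleFrom k h) := by
  intro B B' hB z hz
  refine Submodule.span_mono ?_ (mem_stableSpan.1 hz)
  rintro _ ⟨l, hl, rfl⟩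
  exact ⟨l, hB.trans hl, rfl⟩

theorem iSup_submoduleFrom : ⨆ B, submoduleFrom k h B = ⊤ := by
  rw [eq_top_iff]
  rintro z -
  induction bAt_mem_span s z using Submodule.span_induction with
  | mem z hz =>
    obtain ⟨l, -, rfl⟩ := hz
    exact Submodule.mem_iSup_of_mem l (bAt_mem_submoduleFrom h le_rfl)
  | zero => exact zero_mem _
  | add z z' _ _ hz hz' => exact add_mem hz hz'
  | smul r z _ hz => exact Submodule.smul_of_tower_mem _ r hz

theorem coeffAt_eq_zero_of_mem_submoduleFrom {B l : ℤ} (hl : l < B) {z : StringModule k C}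
    (hz : z ∈ submoduleFrom k h B) : coeffAt s l z = 0 := by
  refine (Submodule.span_le (p := LinearMap.ker (coeffAt s l))).2 ?_ (mem_stableSpan.1 hz)
  rintro _ ⟨l', hl', rfl⟩
  rw [SetLike.mem_coe, LinearMap.mem_ker, coeffAt_bAt (Word.mem_of_letterAt (h l')).1,
    if_neg (by omega)]

theorem elt_smul_bAt (h : ∀ l, C.AgreesAt s c l) {l : ℤ} (hl : (c.length : ℤ) ∣ l) :
    c.elt k • bAt k C s l = bAt k C s (l + c.length) := by
  rw [← seg_smul_bAt_of_agreesAt (k := k) (h _) fun l' _ _ => h l', ArrowCycle.elt,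
    c.seg_congr (i := 0) (j := -l) (by simpa using hl)]

theorem coeffAt_aeval_smul_bAt_self (h : ∀ l, C.AgreesAt s c l) {l : ℤ}
    (hl : (c.length : ℤ) ∣ l) (g : k[X]) :
    coeffAt s l (aeval (c.elt k) g • bAt k C s l) = g.coeff 0 := by
  have hdeep : C.IsDeepAt (s.shift l) c := fun l' _ => (C.agreesAt_shift s hl l').2 (h _)
  have hcoeff := coeffAt_aeval_smul_bAt hdeep g 0
  rw [bAt_shift, add_zero, Nat.cast_zero, mul_zero] at hcoeff
  rw [← hcoeff]
  congr 1
  refine hom_extAt s fun l' hl' => ?_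
  rw [coeffAt_bAt hl', ← add_sub_cancel l l', ← bAt_shift, coeffAt_bAt]
  · simp [sub_eq_zero]
  · rwa [Flag.pos_shift, add_sub_cancel]

end StringModule

theorem exists_le_span_sup_map_submoduleFrom [IsSimpleModule (UAlg k ρ) S]
    (hs : ∀ l, C.AgreesAt s c l) (hq : LinearMap.ker q = LinearMap.range ι) (hqm : q m ≠ 0)
    {F : Submodule (UAlg k ρ) Z} (hF : F.FG) :
    ∃ B, F ≤ Submodule.span (UAlg k ρ) {m} ⊔ (submoduleFrom k hs B).map ι := by
  have hmono : Antitone fun B =>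
      Submodule.span (UAlg k ρ) {m} ⊔ (submoduleFrom k hs B).map ι := fun B B' hB =>
    sup_le_sup_left (Submodule.map_mono (submoduleFrom_antitone hs hB)) _
  have htop : ⨆ B, Submodule.span (UAlg k ρ) {m} ⊔ (submoduleFrom k hs B).map ι = ⊤ := by
    rw [← sup_iSup, ← Submodule.map_iSup, iSup_submoduleFrom, Submodule.map_top, sup_comm,
      range_sup_span_singleton_eq_top hq hqm]
  obtain ⟨_, ⟨B, rfl⟩, hB⟩ := (Submodule.fg_iff_compact F).1 hF _ _ (Set.range_nonempty _)
    hmono.directed_le.directedOn_range isLUB_iSup (htop ▸ le_top)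
  exact ⟨B, hB⟩

theorem ArrowCycle.exists_dvd_add_length_lt (c : ArrowCycle ρ) (B : ℤ) :
    ∃ l : ℤ, (c.length : ℤ) ∣ l ∧ l + c.length < B := by
  refine ⟨c.length * -(B.natAbs + 2), dvd_mul_right _ _, ?_⟩
  have := c.length_pos
  nlinarith [neg_abs_le B, Int.natCast_natAbs B]

-- Far to the left of `F`, an element `b` of `e_v M(C)` would satisfy `f b ∈ Λ y + (tail of M(C))`,
-- where `f = 1 + X f₁`; but the coefficient of `b` in `f b` is `1`.
theorem false_of_forall_agreesAt (hρ : IsString ρ) [IsSimpleModule (UAlg k ρ) S]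
    (hι : Function.Injective ι) (hq : LinearMap.ker q = LinearMap.range ι)
    (hm : aeval (c.elt k) (1 + X * f₁) • m = ι y) (hqm : c.elt k • q m ≠ 0)
    (hs : ∀ l, C.AgreesAt s c l) {F : Submodule (UAlg k ρ) Z} (hF : F.FG)
    (hidem : ∀ z : Z, idem k ρ (c.arrow 0).left • z ∈ F) : False := by
  obtain ⟨B₁, hB₁⟩ := exists_le_span_sup_map_submoduleFrom hs hq (map_smul q _ m ▸ hqm) hF
  obtain ⟨B₂, hB₂⟩ := (Submodule.mem_iSup_of_directed _
    (submoduleFrom_antitone hs).directed_le).1 (iSup_submoduleFrom (k := k) hs ▸ Submodule.mem_top :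
      y ∈ ⨆ B, submoduleFrom k hs B)
  set B := min B₁ B₂
  obtain ⟨l, hl, hlB⟩ := c.exists_dvd_add_length_lt B
  have hbF : ι (bAt k C s l) ∈ F := by
    rw [← idem_smul_bAt_of_agreesAt (hs (l + 1)), (c.arrow_eq_iff (-l) 0).2 (by simpa using hl),
      map_smul]
    exact hidem _
  obtain ⟨_, hx, _, ⟨z, hz, rfl⟩, hxz⟩ := Submodule.mem_sup.1 (hB₁ hbF)
  obtain ⟨a, rfl⟩ := Submodule.mem_span_singleton.1 hx
  obtain ⟨h, hh⟩ := c.elt_mul_mul_elt hρ a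
  have hfb : aeval (c.elt k) (1 + X * f₁) • bAt k C s (l + c.length) =
      aeval (c.elt k) h • c.elt k • y + aeval (c.elt k) (1 + X * f₁) • c.elt k • z := by
    apply hι
    have hmul : c.elt k • a • c.elt k • m = aeval (c.elt k) h • c.elt k • m := by
      rw [← mul_smul, ← mul_smul, hh, mul_smul]
    rw [← elt_smul_bAt hs hl, map_smul ι, map_smul ι, ← hxz, smul_add (c.elt k), smul_add, hmul,
      aeval_smul_aeval_smul_comm, ← smul_aeval_smul_comm, hm]
    simp only [map_add, map_smul]
  have hmem : aeval (c.elt k) (1 + X * f₁) • bAt k C s (l + c.length) ∈ submoduleFrom k hs B := by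
    rw [hfb]
    exact add_mem
      (Submodule.smul_mem _ _ (Submodule.smul_mem _ _
        (submoduleFrom_antitone hs (min_le_right _ _) hB₂)))
      (Submodule.smul_mem _ _ (Submodule.smul_mem _ _
        (submoduleFrom_antitone hs (min_le_left _ _) hz)))
  have hcoeff := coeffAt_eq_zero_of_mem_submoduleFrom hs hlB hmem
  rw [coeffAt_aeval_smul_bAt_self hs (hl.add dvd_rfl)] at hcoeff
  simp at hcoeff

end Dichotomy

/-! ### Band modules -/

section Bands

open Polynomial

open scoped TensorProduct

variable {Q : Type v} [Quiver.{w} Q] {ρ : Set (QPath Q)} {C : Word ρ} {n : ℕ}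
  (k : Type u) [Field k] (h : C.HasPeriod n)

theorem exists_eq_neg_sub_mul (hn : 0 < n) (i : ℤ) :
    ∃ j : ℕ, j < n ∧ ∃ m : ℤ, i = -j - m * n := by
  have hn : (0 : ℤ) < n := Int.natCast_pos.2 hn
  have hnonneg := Int.emod_nonneg (-i) hn.ne'
  have hlt := Int.emod_lt_of_pos (-i) hn
  refine ⟨(-i % n).toNat, by omega, -i / n, ?_⟩
  rw [Int.toNat_of_nonneg hnonneg]
  linarith [Int.emod_add_mul_ediv (-i) n]

namespace Bimodule

/-- The basis element `bᵢ` of the bimodule `M(C)`. -/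
def b (i : ℤ) : Bimodule k h := StringModule.b k C i

variable {k}

theorem C_mul_T_smul (t : k) (m : ℤ) (x : Bimodule k h) :
    (LaurentPolynomial.C t * LaurentPolynomial.T m) • x = t • shiftAct k h m x := by
  change laurentAct k h _ x = _
  rw [← LaurentPolynomial.single_eq_C_mul_T]
  exact LinearMap.congr_fun (AddMonoidAlgebra.lift_single _ _ _) (show StringModule k C from x)

theorem C_smul (t : k) (x : Bimodule k h) : (LaurentPolynomial.C t) • x = t • x := by
  have hshift : shiftAct k h 0 = LinearMap.id :=
    StringModule.hom_ext fun i _ => by simp [shiftAct_b]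
  have hsmul := C_mul_T_smul h t 0 x
  rwa [LaurentPolynomial.T_zero, mul_one, hshift] at hsmul

theorem T_smul_b (m i : ℤ) :
    (LaurentPolynomial.T m : LaurentPolynomial k) • b k h i = b k h (i - m * n) := by
  have hsmul := C_mul_T_smul h 1 m (b k h i)
  rw [map_one, one_mul, one_smul] at hsmul
  exact hsmul.trans (shiftAct_b k h m i)

theorem span_b_neg_eq_top :
    Submodule.span (LaurentPolynomial k) (Set.range fun j : Fin n => b k h (-(j : ℕ))) = ⊤ := by
  rw [eq_top_iff]
  rintro x -
  induction StringModule.b_mem_span (k := k) (C := C) x using Submodule.span_induction with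
  | mem x hx =>
    obtain ⟨i, -, rfl⟩ := hx
    obtain ⟨j, hj, m, rfl⟩ := exists_eq_neg_sub_mul h.pos i
    change b k h _ ∈ _
    rw [← T_smul_b]
    exact Submodule.smul_mem _ _ (Submodule.subset_span ⟨⟨j, hj⟩, rfl⟩)
  | zero => exact zero_mem _
  | add x y _ _ hx hy => exact add_mem hx hy
  | smul t x _ hx => exact C_smul h t x ▸ Submodule.smul_mem _ _ hx

end Bimodule

namespace BandModule

variable {k} {V : Type*} [AddCommGroup V] [Module (LaurentPolynomial k) V]

theorem exists_eq_sum_tmul (z : BandModule k h V) :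
    ∃ v : Fin n → V, z = ∑ j : Fin n, Bimodule.b k h (-(j : ℕ)) ⊗ₜ[LaurentPolynomial k] v j := by
  induction z using TensorProduct.induction_on with
  | zero => exact ⟨0, by simp⟩
  | add z z' hz hz' =>
    obtain ⟨v, rfl⟩ := hz
    obtain ⟨v', rfl⟩ := hz'
    exact ⟨v + v', by simp only [Pi.add_apply, TensorProduct.tmul_add, Finset.sum_add_distrib]⟩
  | tmul x v =>
    have hx : x ∈ (⊤ : Submodule (LaurentPolynomial k) (Bimodule k h)) := Submodule.mem_top
    rw [← Bimodule.span_b_neg_eq_top, Submodule.mem_span_range_iff_exists_fun] at hx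
    obtain ⟨r, rfl⟩ := hx
    exact ⟨fun j => r j • v, by simp only [TensorProduct.sum_tmul, TensorProduct.smul_tmul]⟩

variable [Module k (BandModule k h V)] [IsScalarTower k (UAlg k ρ) (BandModule k h V)]

theorem C_smul (t : k) (z : BandModule k h V) : LaurentPolynomial.C t • z = t • z := by
  induction z using TensorProduct.induction_on with
  | zero => simp only [smul_zero]
  | add z z' hz hz' => rw [smul_add, smul_add, hz, hz']
  | tmul x v =>
    have hx : algebraMap k (UAlg k ρ) t • x = t • x :=
      algebraMap_smul (M := StringModule k C) (UAlg k ρ) t x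
    rw [TensorProduct.smul_tmul', Bimodule.C_smul, ← algebraMap_smul (UAlg k ρ) t (x ⊗ₜ v),
      TensorProduct.smul_tmul', hx]

theorem finite [Module k V] [IsScalarTower k (LaurentPolynomial k) V] [Module.Finite k V] :
    Module.Finite k (BandModule k h V) := by
  let φ : (Fin n → V) →ₗ[k] BandModule k h V :=
    { toFun := fun v => ∑ j : Fin n, Bimodule.b k h (-(j : ℕ)) ⊗ₜ[LaurentPolynomial k] v j
      map_add' := fun v v' => by
        simp only [Pi.add_apply, TensorProduct.tmul_add, Finset.sum_add_distrib]
      map_smul' := fun t v => by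
        simp only [Pi.smul_apply, RingHom.id_apply, ← C_smul, Finset.smul_sum,
          ← TensorProduct.tmul_smul, ← algebraMap_smul (LaurentPolynomial k) t (v _),
          LaurentPolynomial.algebraMap_apply, Algebra.algebraMap_self, RingHom.id_apply] }
  refine Module.Finite.of_surjective φ fun z => ?_
  obtain ⟨v, rfl⟩ := exists_eq_sum_tmul h z
  exact ⟨v, rfl⟩

end BandModule

theorem exists_aeval_smul_eq_zero_of_finite {A Y : Type*} [Ring A] [Algebra k A] [AddCommGroup Y]
    [Module A Y] [Module k Y] [IsScalarTower k A Y] [Module.Finite k Y] (a : A) :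
    ∃ g : k[X], g ≠ 0 ∧ ∀ y : Y, aeval a g • y = 0 := by
  have hint : IsIntegral k (Algebra.lsmul k k Y a) := Algebra.IsIntegral.isIntegral _
  refine ⟨minpoly k (Algebra.lsmul k k Y a), minpoly.ne_zero hint, fun y => ?_⟩
  have hzero := minpoly.aeval k (Algebra.lsmul k k Y a)
  rw [aeval_algHom_apply] at hzero
  exact LinearMap.congr_fun hzero y

end Bands

/-! ### Primitive simples -/

section Simples

open Polynomial

variable {Q : Type v} [Quiver.{w} Q] {ρ : Set (QPath Q)} {k : Type u} [Field k] {a : Q}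
  {P : Quiver.Path a a} {c : ArrowCycle ρ} {S : Type*} [AddCommGroup S] [Module (UAlg k ρ) S]

theorem aeval_zElt_mul_elt (hρ : IsString ρ) (hP : IsPrimitiveCycle ρ P) (hc : c.Represents P)
    (g : k[X]) : aeval (zElt k ρ a) g * c.elt k = aeval (c.elt k) g * c.elt k := by
  have hz : SemiconjBy (c.elt k) (c.elt k) (zElt k ρ a) := (zElt_mul_elt k hρ hP hc).symm
  induction g using Polynomial.induction_on' with
  | add g g' hg hg' => rw [map_add, map_add, add_mul, add_mul, hg, hg']
  | monomial e t =>
    rw [aeval_monomial, aeval_monomial, mul_assoc, mul_assoc, ← (hz.pow_right e).eq, ← pow_succ,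
      ← pow_succ']

theorem ArrowCycle.Represents.idem_mul_elt [DecidableEq Q] (hc : c.Represents P) (b : Q) :
    idem k ρ b * c.elt k = if b = a then c.elt k else 0 := by
  rw [← hc.pathElt_eq k]
  split_ifs with h
  · subst h
    exact idem_mul_pathElt P
  · exact pathElt_mul_of_ne h

theorem elt_smul_mem_primitiveTorsion_iff (hρ : IsString ρ) (hP : IsPrimitiveCycle ρ P)
    (hc : c.Represents P) (x : S) :
    c.elt k • x ∈ primitiveTorsion k ρ S ↔
      ∃ g : k[X], g.eval 0 = 1 ∧ aeval (c.elt k) g • c.elt k • x = 0 := by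
  classical
  have haeval : ∀ (b : Q) (g : k[X]), aeval (zElt k ρ b) g • (idem k ρ b • c.elt k • x) =
      if b = a then aeval (c.elt k) g • c.elt k • x else 0 := by
    intro b g
    rw [← mul_smul (idem k ρ b), hc.idem_mul_elt]
    split_ifs with h
    · subst h
      rw [← mul_smul, ← mul_smul, aeval_zElt_mul_elt hρ hP hc]
    · rw [zero_smul, smul_zero]
  simp only [primitiveTorsion, Set.mem_ofPred_eq, haeval]
  refine exists_congr fun g => and_congr_right fun _ => ⟨fun h => ?_, fun h b => ?_⟩
  · simpa using h a
  · rw [h, ite_self]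

theorem exists_irreducible_dvd_aeval_smul_eq_zero {A Y : Type*} [Ring A] [Algebra k A]
    [AddCommGroup Y] [Module A Y] (p : A) {g : k[X]} (hg : g ≠ 0) {y : Y} (hy : y ≠ 0)
    (hgy : aeval p g • y = 0) :
    ∃ f h : k[X], Irreducible f ∧ f ∣ g ∧ aeval p h • y ≠ 0 ∧ aeval p f • aeval p h • y = 0 := by
  induction g using WfDvdMonoid.induction_on_irreducible with
  | zero => exact absurd rfl hg
  | unit u hu =>
    exact absurd ((hu.map (aeval p)).smul_eq_zero.1 hgy) hy
  | mul a i ha hi ih =>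
    by_cases hay : aeval p a • y = 0
    · obtain ⟨f, h, hf, hfa, hfh⟩ := ih ha hay
      exact ⟨f, h, hf, hfa.mul_left i, hfh⟩
    · exact ⟨i, a, hi, dvd_mul_right i a, hay, by rw [← mul_smul, ← map_mul, hgy]⟩

theorem associated_one_add_X_mul {g : k[X]} (hg : g.coeff 0 ≠ 0) :
    ∃ f₁ : k[X], Associated g (1 + X * f₁) := by
  have hu : IsUnit (C (g.coeff 0)⁻¹) := isUnit_C.2 (inv_ne_zero hg).isUnit
  refine ⟨(g * C (g.coeff 0)⁻¹).divX, hu.unit, ?_⟩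
  conv_lhs => rw [IsUnit.unit_spec, ← X_mul_divX_add (g * C (g.coeff 0)⁻¹)]
  rw [coeff_mul_C, mul_inv_cancel₀ hg, map_one, add_comm]

theorem exists_irreducible_aeval_elt_smul_eq_zero (hρ : IsString ρ) (hP : IsPrimitiveCycle ρ P)
    (hc : c.Represents P) (hS : primitiveTorsion k ρ S = Set.univ) {x : S} (hx : c.elt k • x ≠ 0) :
    ∃ (f₁ : k[X]) (s : S), Irreducible (1 + X * f₁) ∧ c.elt k • s ≠ 0 ∧
      aeval (c.elt k) (1 + X * f₁) • s = 0 := by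
  obtain ⟨g, hg, hgx⟩ := (elt_smul_mem_primitiveTorsion_iff hρ hP hc x).1 (hS ▸ Set.mem_univ _)
  rw [← coeff_zero_eq_eval_zero] at hg
  have hg0 : g ≠ 0 := fun h => by simp [h] at hg
  obtain ⟨f, h, hf, hfg, hhx, hfhx⟩ := exists_irreducible_dvd_aeval_smul_eq_zero _ hg0 hx hgx
  have hf0 : f.coeff 0 ≠ 0 := by
    obtain ⟨f', rfl⟩ := hfg
    exact left_ne_zero_of_mul (by rw [← mul_coeff_zero, hg]; exact one_ne_zero)
  obtain ⟨f₁, hff₁⟩ := associated_one_add_X_mul hf0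
  obtain ⟨f', hf'⟩ := hff₁.dvd
  set y := aeval (c.elt k) h • c.elt k • x
  have hfy : aeval (c.elt k) (1 + X * f₁) • y = 0 := by
    rw [hf', mul_comm, map_mul, mul_smul, hfhx, smul_zero]
  refine ⟨f₁, -(aeval (c.elt k) f₁ • y), hff₁.irreducible hf, ?_, ?_⟩
  · rw [map_add, map_one, add_smul, one_smul, map_mul, aeval_X, mul_smul] at hfy
    rwa [smul_neg, ← eq_neg_of_add_eq_zero_left hfy]
  · rw [smul_neg, aeval_smul_aeval_smul_comm, hfy, smul_zero, neg_zero]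

end Simples

/-! ### The modules `M(∞P∞, V)` -/

section SimpleOfCycle

open Polynomial

open scoped TensorProduct

variable {Q : Type v} [Quiver.{w} Q] {ρ : Set (QPath Q)} {C : Word ρ} {k : Type u} [Field k] {a : Q}
  {P : Quiver.Path a a} {c : ArrowCycle ρ}

theorem Word.IsBiInfinitePower.letter_eq (hC : C.IsBiInfinitePower P) (hc : c.Represents P)
    (i : ℤ) : C.letter i = some (.dir (c.arrow i)) := by
  rw [hC.2, dirLetters, List.getElem?_map, hc.getElem?_arrows]
  rfl

theorem Word.IsBiInfinitePower.seg_smul_b (hC : C.IsBiInfinitePower P) (hc : c.Represents P)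
    (r : ℕ) : c.seg k 0 r • StringModule.b k C 0 = StringModule.b k C (-r) := by
  have h : C.IsDeepAt ⟨0, false⟩ c := fun l _ => by
    simp [Word.AgreesAt, Word.letterAt, hC.letter_eq hc, Letter.inverse]
  simpa [StringModule.bAt, Flag.pos] using StringModule.seg_smul_bAt_of_isDeepAt (k := k) h r

variable {S : Type*} [AddCommGroup S] [Module (UAlg k ρ) S]

theorem IsSimpleOfCycle.exists_elt_smul_ne_zero [Nontrivial S] (hc : c.Represents P)
    (h : IsSimpleOfCycle k ρ S P) : ∃ x : S, c.elt k • x ≠ 0 := by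
  obtain ⟨C, hper, V, _, _, hC, -, ⟨e⟩⟩ := h
  by_contra! hzero
  have helt : ∀ z : BandModule k hper V, c.elt k • z = 0 := fun z => by
    rw [← e.apply_symm_apply z, ← map_smul, hzero, map_zero]
  have hseg : ∀ (r : ℕ) (v : V), c.seg k 0 r • (Bimodule.b k hper 0 ⊗ₜ[LaurentPolynomial k] v) =
      Bimodule.b k hper (-r) ⊗ₜ v := fun r v => by
    rw [TensorProduct.smul_tmul']
    congr 1
    exact hC.seg_smul_b hc r
  have hb₀ : ∀ v : V, Bimodule.b k hper 0 ⊗ₜ[LaurentPolynomial k] v = 0 := fun v => by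
    have hT := helt (Bimodule.b k hper 0 ⊗ₜ ((LaurentPolynomial.T (-1) : LaurentPolynomial k) • v))
    rw [ArrowCycle.elt, hseg, ← TensorProduct.smul_tmul, Bimodule.T_smul_b, hc.length_eq] at hT
    simpa using hT
  obtain ⟨x, hx⟩ := exists_ne (0 : S)
  obtain ⟨v, hv⟩ := BandModule.exists_eq_sum_tmul hper (e x)
  refine hx ((e.map_eq_zero_iff).1 (hv.trans (Finset.sum_eq_zero fun j _ => ?_)))
  rw [← hseg, hb₀, smul_zero]

section BandHom

variable {V : Type*} [AddCommGroup V] [Module (LaurentPolynomial k) V] [Module k V] [Module k S]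
  {κ : V →ₗ[k] S}

theorem seg_add_length_mul_smul (hκ : ∀ v, κ (LaurentPolynomial.T (R := k) 1 • v) = c.elt k • κ v)
    (r j : ℕ) (v : V) :
    c.seg k 0 (r + c.length * j) • κ v =
      c.seg k 0 r • κ (LaurentPolynomial.T (R := k) j • v) := by
  induction j generalizing v with
  | zero => rw [mul_zero, add_zero, Nat.cast_zero, LaurentPolynomial.T_zero, one_smul]
  | succ j ih =>
    rw [mul_add, mul_one, ← add_assoc, add_comm, c.seg_length_add, mul_smul, ← hκ, ih, ← mul_smul,
      ← LaurentPolynomial.T_add, Nat.cast_succ]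

open Classical in
theorem seg_neg_smul_seg_smul (hρ : IsString ρ)
    (hκ : ∀ v, κ (LaurentPolynomial.T (R := k) 1 • v) = c.elt k • κ v) {i j : ℕ}
    (hi : i < c.length) (hj : j < c.length) (v : V) :
    c.seg k (-j) (c.length - j) • c.seg k 0 i • κ v =
      if i = j then κ (LaurentPolynomial.T (R := k) 1 • v) else 0 := by
  set w := LaurentPolynomial.T (R := k) (-1) • v with hw
  have hv : v = LaurentPolynomial.T (R := k) 1 • w := by
    rw [hw, ← mul_smul, ← LaurentPolynomial.T_add, add_neg_cancel, LaurentPolynomial.T_zero,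
      one_smul]
  rw [hv, hκ w, ← mul_smul (c.seg k 0 i), ← c.seg_length_add, ← mul_smul]
  split_ifs with hij
  · subst hij
    rw [c.seg_congr (j := 0 - ((c.length + i : ℕ) : ℤ)) ⟨1, by push_cast; ring⟩, ← c.seg_add,
      show c.length + i + (c.length - i) = c.length * (1 + 1) by omega, c.seg_length_mul, pow_succ,
      pow_one, mul_smul, ← hκ, ← hκ]
  · rw [c.seg_mul_seg_of_not_dvd hρ (by omega) (by omega), zero_smul]
    rintro ⟨e, he⟩
    push_cast at he
    have hdvd : (c.length : ℤ) ∣ i - j := ⟨e - 1, by rw [mul_sub, ← he]; ring⟩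
    have := Int.eq_zero_of_abs_lt_dvd hdvd (by rw [abs_lt]; omega)
    omega

theorem injective_of_bandHom (hρ : IsString ρ) (hc : c.Represents P)
    {hper : C.HasPeriod P.length}
    (hκ : ∀ v, κ (LaurentPolynomial.T (R := k) 1 • v) = c.elt k • κ v)
    (hinj : Function.Injective κ) {Ψ : BandModule k hper V →ₗ[UAlg k ρ] S}
    (hΨ : ∀ (j : ℕ) (v : V), Ψ (Bimodule.b k hper (-j) ⊗ₜ v) = c.seg k 0 j • κ v) :
    Function.Injective Ψ := by
  classical
  rw [injective_iff_map_eq_zero]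
  intro z hz
  obtain ⟨v, rfl⟩ := BandModule.exists_eq_sum_tmul hper z
  refine Finset.sum_eq_zero fun j _ => ?_
  have hlt : ∀ i : Fin P.length, (i : ℕ) < c.length := fun i => hc.length_eq.symm ▸ i.2
  have hj := congrArg (c.seg k (-(j : ℕ)) (c.length - j) • ·) hz
  simp only [map_sum, hΨ, Finset.smul_sum, smul_zero, seg_neg_smul_seg_smul hρ hκ (hlt _) (hlt j),
    Fin.val_inj, Finset.sum_ite_eq', Finset.mem_univ, if_true] at hj
  have hT : LaurentPolynomial.T (R := k) 1 • v j = 0 := hinj (hj.trans (map_zero κ).symm)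
  rw [(LaurentPolynomial.isUnit_T 1).smul_eq_zero] at hT
  rw [hT, TensorProduct.tmul_zero]

variable [IsScalarTower k (LaurentPolynomial k) V] [IsScalarTower k (UAlg k ρ) S]

/-- The image of `b_l ⊗ v` under the homomorphism `M(∞P∞, V) → S` which sends `b₀ ⊗ v` to `κ v`;
here `T` acts on `V` as `P` acts on the image of `κ`. -/
def bandVec (c : ArrowCycle ρ) (κ : V →ₗ[k] S) (l : ℤ) : V →ₗ[k] S :=
  Algebra.lsmul k k S (c.seg k 0 (-l % c.length).toNat) ∘ₗ κ ∘ₗ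
    Algebra.lsmul k k V (LaurentPolynomial.T (-l / c.length) : LaurentPolynomial k)

theorem bandVec_neg_sub (hκ : ∀ v, κ (LaurentPolynomial.T (R := k) 1 • v) = c.elt k • κ v)
    (r : ℕ) (m : ℤ) (v : V) :
    bandVec c κ (-r - m * c.length) v =
      c.seg k 0 r • κ (LaurentPolynomial.T (R := k) m • v) := by
  have hn := c.length_pos
  have hneg : -(-(r : ℤ) - m * c.length) = r + c.length * m := by ring
  change c.seg k 0 _ • κ (LaurentPolynomial.T (R := k) _ • v) = _
  rw [hneg, Int.add_mul_emod_self_left, Int.add_mul_ediv_left _ _ (by omega), ← Int.natCast_mod,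
    Int.toNat_natCast, ← Int.natCast_div, LaurentPolynomial.T_add, mul_smul,
    ← seg_add_length_mul_smul hκ, Nat.mod_add_div]

theorem bandVec_neg (hκ : ∀ v, κ (LaurentPolynomial.T (R := k) 1 • v) = c.elt k • κ v)
    (r : ℕ) (v : V) : bandVec c κ (-r) v = c.seg k 0 r • κ v := by
  simpa using bandVec_neg_sub hκ r 0 v

theorem bandVec_sub_mul (hκ : ∀ v, κ (LaurentPolynomial.T (R := k) 1 • v) = c.elt k • κ v)
    (l m : ℤ) (v : V) :
    bandVec c κ (l - m * c.length) v = bandVec c κ l (LaurentPolynomial.T (R := k) m • v) := by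
  obtain ⟨r, -, e, rfl⟩ := exists_eq_neg_sub_mul c.length_pos l
  rw [sub_sub, ← add_mul, bandVec_neg_sub hκ, bandVec_neg_sub hκ, LaurentPolynomial.T_add, mul_smul]

theorem ArrowCycle.arrow_neg_sub_mul (c : ArrowCycle ρ) (r : ℕ) (m : ℤ) :
    c.arrow (-r - m * c.length) = c.arrow (0 - r) :=
  (c.arrow_eq_iff _ _).2 ⟨-m, by ring⟩

theorem idem_smul_bandVec (hκ : ∀ v, κ (LaurentPolynomial.T (R := k) 1 • v) = c.elt k • κ v)
    (l : ℤ) (v : V) : idem k ρ (c.arrow l).left • bandVec c κ l v = bandVec c κ l v := by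
  obtain ⟨r, -, m, rfl⟩ := exists_eq_neg_sub_mul c.length_pos l
  rw [bandVec_neg_sub hκ, c.arrow_neg_sub_mul, ← mul_smul, c.idem_mul_seg]

theorem arrowElt_smul_bandVec (hκ : ∀ v, κ (LaurentPolynomial.T (R := k) 1 • v) = c.elt k • κ v)
    (l : ℤ) (v : V) : arrowElt k ρ (c.arrow l) • bandVec c κ l v = bandVec c κ (l - 1) v := by
  obtain ⟨r, -, m, rfl⟩ := exists_eq_neg_sub_mul c.length_pos l
  rw [bandVec_neg_sub hκ, c.arrow_neg_sub_mul, ← mul_smul, ← c.seg_succ, ← bandVec_neg_sub hκ]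
  congr 2
  push_cast
  ring

theorem arrowElt_smul_bandVec_of_ne (hρ : IsString ρ)
    (hκ : ∀ v, κ (LaurentPolynomial.T (R := k) 1 • v) = c.elt k • κ v) {l : ℤ} {y : Arrow Q}
    (hy : y ≠ c.arrow l) (v : V) : arrowElt k ρ y • bandVec c κ l v = 0 := by
  obtain ⟨r, -, m, rfl⟩ := exists_eq_neg_sub_mul c.length_pos l
  -- Stepping back once around the cycle makes the length of the path to `b_l` positive.
  have hl : -(r : ℤ) - m * c.length = -(r + c.length : ℕ) - (m - 1) * c.length := by
    push_cast
    ring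
  have hn := c.length_pos
  rw [hl, c.arrow_neg_sub_mul] at hy
  rw [hl, bandVec_neg_sub hκ, ← mul_smul, c.arrowElt_mul_seg_of_ne hρ (by omega) hy, zero_smul]

theorem exists_hom_bandVec (hρ : IsString ρ) (hC : C.IsBiInfinitePower P) (hc : c.Represents P)
    (hκ : ∀ v, κ (LaurentPolynomial.T (R := k) 1 • v) = c.elt k • κ v) (v : V) :
    ∃ φ : StringModule k C →ₗ[UAlg k ρ] S, ∀ y,
      φ y = StringModule.lin C (bandVec c κ) y v := by
  classical
  have hmem : ∀ l, l ∈ C.shape.idx := fun l => by rw [hC.1]; trivial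
  have hb : ∀ l, (StringModule.lin C (bandVec c κ)).flip v (StringModule.b k C l) =
      bandVec c κ l v := fun l =>
    LinearMap.congr_fun (StringModule.lin_b C _ (hmem l)) v
  refine ⟨homOfGenerators ((StringModule.lin C (bandVec c κ)).flip v) (fun b => ?_) fun y => ?_,
    fun y => rfl⟩
  · suffices (StringModule.lin C (bandVec c κ)).flip v ∘ₗ
        Algebra.lsmul k k (StringModule k C) (idem k ρ b) =
          Algebra.lsmul k k S (idem k ρ b) ∘ₗ (StringModule.lin C (bandVec c κ)).flip v from
      LinearMap.congr_fun this
    refine StringModule.hom_ext fun l hl => ?_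
    simp only [LinearMap.comp_apply, Algebra.lsmul_coe]
    rw [StringModule.idem_smul_b b hl, C.vertex_tail _ _ (hC.letter_eq hc l), hb]
    by_cases hlb : (c.arrow l).left = b
    · subst hlb
      rw [if_pos (by rfl), hb, idem_smul_bandVec hκ]
    · rw [if_neg (by simpa [Letter.tail] using hlb), map_zero, ← idem_smul_bandVec hκ l,
        ← mul_smul, idem_mul_of_ne (Ne.symm hlb), zero_smul]
  · suffices (StringModule.lin C (bandVec c κ)).flip v ∘ₗ
        Algebra.lsmul k k (StringModule k C) (arrowElt k ρ y) =
          Algebra.lsmul k k S (arrowElt k ρ y) ∘ₗ (StringModule.lin C (bandVec c κ)).flip v from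
      LinearMap.congr_fun this
    refine StringModule.hom_ext fun l hl => ?_
    simp only [LinearMap.comp_apply, Algebra.lsmul_coe]
    rw [StringModule.arrowElt_smul_b y hl, hC.letter_eq hc, hC.letter_eq hc, hb]
    by_cases hly : c.arrow l = y
    · rw [if_pos (by rw [hly]), hb, ← hly, arrowElt_smul_bandVec hκ]
    · rw [if_neg (by simpa using hly), if_neg (by simp), map_zero,
        arrowElt_smul_bandVec_of_ne hρ hκ (Ne.symm hly)]

theorem lin_bandVec_shiftAct (hκ : ∀ v, κ (LaurentPolynomial.T (R := k) 1 • v) = c.elt k • κ v)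
    {n : ℕ} (h : C.HasPeriod n) (hn : c.length = n) (m : ℤ) (y : StringModule k C) (v : V) :
    StringModule.lin C (bandVec c κ) (shiftAct k h m y) v =
      StringModule.lin C (bandVec c κ) y (LaurentPolynomial.T (R := k) m • v) := by
  let β : StringModule k C →ₗ[k] V →ₗ[k] S := StringModule.lin C (bandVec c κ)
  subst hn
  suffices β.flip v ∘ₗ shiftAct k h m = β.flip (LaurentPolynomial.T (R := k) m • v) from
    LinearMap.congr_fun this y
  refine StringModule.hom_ext fun l _ => ?_
  rw [LinearMap.comp_apply, shiftAct_b, LinearMap.flip_apply, LinearMap.flip_apply,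
    StringModule.lin_b C _ (h.mem _), StringModule.lin_b C _ (h.mem _), bandVec_sub_mul hκ]

theorem exists_bandHom (hρ : IsString ρ) (hC : C.IsBiInfinitePower P) (hc : c.Represents P)
    (hper : C.HasPeriod P.length)
    (hκ : ∀ v, κ (LaurentPolynomial.T (R := k) 1 • v) = c.elt k • κ v) :
    ∃ Ψ : BandModule k hper V →ₗ[UAlg k ρ] S, ∀ (j : ℕ) (v : V),
      Ψ (Bimodule.b k hper (-j) ⊗ₜ v) = c.seg k 0 j • κ v := by
  let β : Bimodule k hper →ₗ[k] V →ₗ[k] S := StringModule.lin C (bandVec c κ)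
  have hβshift : ∀ m (y : StringModule k C) v,
      β (shiftAct k hper m y) v = β y (LaurentPolynomial.T (R := k) m • v) :=
    lin_bandVec_shiftAct hκ hper hc.length_eq
  have hβbal : ∀ (q : LaurentPolynomial k) (y : Bimodule k hper) (v : V),
      β (q • y) v = β y (q • v) := fun q y v => by
    induction q using LaurentPolynomial.induction_on' with
    | add q q' hq hq' => rw [add_smul, add_smul, map_add, map_add, LinearMap.add_apply, hq, hq']
    | C_mul_T m t =>
      rw [mul_smul (_ : LaurentPolynomial k) _ v, LaurentPolynomial.C_eq_algebraMap,
        algebraMap_smul, map_smul (β y)]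
      exact (congrArg (fun z => β z v) (Bimodule.C_mul_T_smul hper t m y)).trans
        ((congrArg (fun f : V →ₗ[k] S => f v) (map_smul β t _)).trans
          (congrArg (t • ·) (hβshift m y v)))
  let Ψ : BandModule k hper V →+ S := TensorProduct.liftAddHom
    (LinearMap.toAddMonoidHom'.comp β.toAddMonoidHom) hβbal
  refine ⟨{ Ψ with map_smul' := fun b z => ?_ }, fun j v => ?_⟩
  · change Ψ (b • z) = b • Ψ z
    induction z using TensorProduct.induction_on with
    | zero => rw [smul_zero, map_zero, smul_zero]
    | add z z' hz hz' => rw [smul_add, map_add, hz, hz', map_add, smul_add]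
    | tmul y v =>
      obtain ⟨φ, hφ⟩ := exists_hom_bandVec hρ hC hc hκ v
      exact (hφ (b • y)).symm.trans ((map_smul φ b y).trans (congrArg (b • ·) (hφ y)))
  · have hb : β (Bimodule.b k hper (-j)) = bandVec c κ (-j) := StringModule.lin_b C _ (hper.mem _)
    change β (Bimodule.b k hper (-j)) v = _
    rw [hb, bandVec_neg hκ]

end BandHom

/-- The module structure over `k[T,T⁻¹]` on a `k`-algebra in which `T` acts as multiplication by a
unit. -/
@[reducible]
def laurentModule {K : Type*} [CommRing K] [Algebra k K] (x : Kˣ) :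
    Module (LaurentPolynomial k) K :=
  Module.compHom K (LaurentPolynomial.eval₂ (algebraMap k K) x)

theorem isSimpleModule_laurentModule {f : k[X]} [Fact (Irreducible f)] (x : (AdjoinRoot f)ˣ)
    (hx : (x : AdjoinRoot f) = AdjoinRoot.root f) :
    @IsSimpleModule (LaurentPolynomial k) _ (AdjoinRoot f) _ (laurentModule x) := by
  let _ := laurentModule (k := k) x
  refine isSimpleModule_iff_toSpanSingleton_surjective.2 ⟨inferInstance, fun y hy z => ?_⟩
  obtain ⟨g, hg⟩ := AdjoinRoot.mk_surjective (g := f) (z * y⁻¹)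
  have heval : LaurentPolynomial.eval₂ (algebraMap k (AdjoinRoot f)) x (toLaurent g) =
      AdjoinRoot.mk f g := by
    rw [LaurentPolynomial.eval₂_toLaurent, hx]
    exact AdjoinRoot.aeval_eq g
  refine ⟨toLaurent g, ?_⟩
  change LaurentPolynomial.eval₂ (algebraMap k (AdjoinRoot f)) x (toLaurent g) * y = z
  rw [heval, hg, mul_assoc, inv_mul_cancel₀ hy, mul_one]

/-- The class of `X` in `k[X]/(1 + X f₁)`, with inverse `-f₁`. -/
def rootUnit (f₁ : k[X]) : (AdjoinRoot (1 + X * f₁))ˣ :=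
  Units.mkOfMulEqOne (AdjoinRoot.root _) (AdjoinRoot.mk _ (-f₁)) <| by
    have hroot : AdjoinRoot.mk (1 + X * f₁) (1 + X * f₁) = 0 := AdjoinRoot.mk_self
    rw [map_add, map_one, map_mul, AdjoinRoot.mk_X] at hroot
    rw [map_neg, mul_neg]
    exact (eq_neg_of_add_eq_zero_left hroot).symm

theorem exists_linearMap_adjoinRoot {A Y : Type*} [Ring A] [Algebra k A] [AddCommGroup Y]
    [Module A Y] [Module k Y] [IsScalarTower k A Y] {p : A} {f : k[X]} {y : Y}
    (hy : aeval p f • y = 0) :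
    ∃ κ : AdjoinRoot f →ₗ[k] Y, ∀ g, κ (AdjoinRoot.mk f g) = aeval p g • y := by
  let φ : k[X] →ₗ[k] Y :=
    (LinearMap.toSpanSingleton A Y y).restrictScalars k ∘ₗ (aeval p).toLinearMap
  have hφ : (Ideal.span {f}).restrictScalars k ≤ LinearMap.ker φ := by
    intro g hg
    obtain ⟨g', rfl⟩ := Ideal.mem_span_singleton'.1 hg
    change aeval p (g' * f) • y = 0
    rw [map_mul, mul_smul, hy, smul_zero]
  exact ⟨(((Ideal.span {f}).restrictScalars k).liftQ φ hφ : _ →ₗ[k] Y), fun g => rfl⟩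

theorem isSimpleOfCycle_of_elt_smul_ne_zero (hρ : IsString ρ) (hP : IsPrimitiveCycle ρ P)
    (hc : c.Represents P) [IsSimpleModule (UAlg k ρ) S] (hS : primitiveTorsion k ρ S = Set.univ)
    {x : S} (hx : c.elt k • x ≠ 0) : IsSimpleOfCycle k ρ S P := by
  obtain ⟨f₁, s, hf, hs, hfs⟩ := exists_irreducible_aeval_elt_smul_eq_zero hρ hP hc hS hx
  obtain ⟨C, hC, hper⟩ := hP
  have : Fact (Irreducible (1 + X * f₁)) := ⟨hf⟩
  let _ : Module k S := Module.compHom S (algebraMap k (UAlg k ρ))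
  have : IsScalarTower k (UAlg k ρ) S := IsScalarTower.of_algebraMap_smul fun _ _ => rfl
  let _ : Module (LaurentPolynomial k) (AdjoinRoot (1 + X * f₁)) := laurentModule (rootUnit f₁)
  have : IsScalarTower k (LaurentPolynomial k) (AdjoinRoot (1 + X * f₁)) :=
    IsScalarTower.of_algebraMap_smul fun t v => by
      change LaurentPolynomial.eval₂ _ _ (LaurentPolynomial.C t) * v = _
      rw [LaurentPolynomial.eval₂_C, Algebra.smul_def]
  obtain ⟨κ, hκ⟩ := exists_linearMap_adjoinRoot hfs
  have hκT : ∀ v, κ (LaurentPolynomial.T (R := k) 1 • v) = c.elt k • κ v := fun v => by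
    obtain ⟨g, rfl⟩ := AdjoinRoot.mk_surjective v
    change κ (LaurentPolynomial.eval₂ _ _ (LaurentPolynomial.T 1) * _) = _
    rw [LaurentPolynomial.eval₂_T, zpow_one]
    change κ (AdjoinRoot.mk _ X * _) = _
    rw [← map_mul, hκ, hκ, map_mul, aeval_X, mul_smul]
  have hκinj : Function.Injective κ := (injective_iff_map_eq_zero κ).2 fun v hv => by
    obtain ⟨g, rfl⟩ := AdjoinRoot.mk_surjective v
    rw [hκ] at hv
    exact AdjoinRoot.mk_eq_zero.2 (dvd_of_aeval_smul_eq_zero hf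
      (fun h => hs (by rw [h, smul_zero])) hfs hv)
  obtain ⟨Ψ, hΨ⟩ := exists_bandHom hρ hC hc hper hκT
  have hsurj : Function.Surjective Ψ := LinearMap.surjective_of_ne_zero fun hΨ0 => hs <| by
    have hb := hΨ c.length (AdjoinRoot.mk _ 1)
    rw [hΨ0, LinearMap.zero_apply, hκ, map_one, one_smul] at hb
    exact hb.symm
  exact ⟨C, hper, AdjoinRoot (1 + X * f₁), inferInstance, inferInstance, hC,
    isSimpleModule_laurentModule (rootUnit f₁) rfl,
    ⟨(LinearEquiv.ofBijective Ψ ⟨injective_of_bandHom hρ hc hκT hκinj hΨ, hsurj⟩).symm⟩⟩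

end SimpleOfCycle

/-! ### Extensions of primitive simples -/

section Extension

open Polynomial StringModule

variable {Q : Type v} [Quiver.{w} Q] {ρ : Set (QPath Q)} {C : Word ρ} {k : Type u} [Field k] {a : Q}
  {P : Quiver.Path a a} {c : ArrowCycle ρ}
variable {M : Type*} [AddCommGroup M] [Module (UAlg k ρ) M] {S : Type*} [AddCommGroup S]
  [Module (UAlg k ρ) S]

theorem IsUnital.of_surjective (hM : IsUnital k ρ M) {π : M →ₗ[UAlg k ρ] S}
    (hπ : Function.Surjective π) : IsUnital k ρ S := by
  rw [IsUnital, eq_top_iff, ← LinearMap.range_eq_top.2 hπ, LinearMap.range_eq_map, ← hM,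
    Submodule.map_span]
  refine Submodule.span_mono ?_
  rintro _ ⟨_, ⟨b, hb, m, rfl⟩, rfl⟩
  exact ⟨b, hb, π m, map_smul _ _ _⟩

theorem smul_eq_zero_of_forall_idem_smul_eq_zero (h : ∀ (b : Q) (x : S), idem k ρ b • x = 0)
    {b : UAlg k ρ} (hb : b ∈ Lam k ρ) (x : S) : b • x = 0 := by
  obtain ⟨b, rfl⟩ := hb
  change UAlg.mk k ρ (Unitization.inr b) • x = 0
  induction b using PathAlgebra.induction with
  | h0 => rw [Unitization.inr_zero, map_zero, zero_smul]
  | hadd b b' hb hb' => rw [Unitization.inr_add, map_add, add_smul, hb, hb', add_zero]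
  | hof t p =>
    have hp : UAlg.mk k ρ (Unitization.inr (PathAlgebra.of k p)) • x = 0 := by
      change pathElt k ρ p • x = 0
      rw [← pathElt_mul_idem, mul_smul, h, smul_zero]
    rw [Unitization.inr_smul, map_smul, Algebra.smul_def, mul_smul, hp, smul_zero]

theorem IsUnital.exists_idem_smul_ne_zero [Nontrivial S] (hS : IsUnital k ρ S) :
    ∃ (b : Q) (x : S), idem k ρ b • x ≠ 0 := by
  by_contra! h
  have hbot : Submodule.span (UAlg k ρ) {y : S | ∃ b ∈ Lam k ρ, ∃ x : S, y = b • x} = ⊥ := by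
    rw [Submodule.span_eq_bot]
    rintro _ ⟨b, hb, x, rfl⟩
    exact smul_eq_zero_of_forall_idem_smul_eq_zero h hb x
  exact bot_ne_top (hbot.symm.trans hS)

theorem exists_pathElt_smul_ne_zero [Nontrivial S] (hρ : IsString ρ) (hS : IsUnital k ρ S)
    (hτ : primitiveTorsion k ρ S = Set.univ) :
    ∃ (b : Q) (P : Quiver.Path b b) (x : S),
      IsPrimitiveCycle ρ P ∧ pathElt k ρ ⟨b, b, P⟩ • x ≠ 0 := by
  obtain ⟨b, x, hx⟩ := hS.exists_idem_smul_ne_zero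
  obtain ⟨f, hf, hfx⟩ : x ∈ primitiveTorsion k ρ S := hτ ▸ Set.mem_univ x
  have hz : zElt k ρ b • idem k ρ b • x ≠ 0 := fun hz => hx <| by
    have hfb := hfx b
    rwa [← divX_mul_X_add f, coeff_zero_eq_eval_zero, hf, map_add, map_mul, aeval_X, map_one,
      map_one, add_smul, one_smul, mul_smul, hz, smul_zero, zero_add] at hfb
  have := finite_primitiveCycles hρ b
  have := Fintype.ofFinite {P : Quiver.Path b b // IsPrimitiveCycle ρ P}
  rw [zElt, finsum_eq_sum_of_fintype, Finset.sum_smul] at hz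
  obtain ⟨P, -, hP⟩ := Finset.exists_ne_zero_of_sum_ne_zero hz
  exact ⟨b, P, _, P.2, hP⟩

theorem StringModule.comp_peakHom [Module k M] [IsScalarTower k (UAlg k ρ) M] [Module k S]
    [IsScalarTower k (UAlg k ρ) S] {s : Flag} {t : ℕ} (hρ : IsString ρ)
    (h : C.IsPeakAtWith s c t) (φ : M →ₗ[UAlg k ρ] S) (x : M) :
    φ ∘ₗ peakHom k hρ h x = peakHom k hρ h (φ x) := by
  refine LinearMap.restrictScalars_injective k (hom_extAt s fun l hl => ?_)
  change φ (peakHom k hρ h x _) = peakHom k hρ h (φ x) _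
  rcases le_or_gt (-(t : ℤ)) l with hlt | hlt
  · rw [peakHom_bAt_of_le hρ h x hlt, peakHom_bAt_of_le hρ h (φ x) hlt, map_smul]
  · rw [peakHom_bAt_of_lt hρ h x hlt hl, peakHom_bAt_of_lt hρ h (φ x) hlt hl, map_zero]

section Complement

variable {R M W Y : Type*} [Ring R] [AddCommGroup M] [Module R M] [AddCommGroup W] [Module R W]
  [AddCommGroup Y] [Module R Y]

theorem isCompl_range_ker_of_bijective_comp {f : Y →ₗ[R] M} {g : M →ₗ[R] W}
    (h : Function.Bijective (g ∘ₗ f)) : IsCompl (LinearMap.range f) (LinearMap.ker g) := by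
  refine ⟨Submodule.disjoint_def.2 ?_, codisjoint_iff.2 (eq_top_iff.2 fun z _ => ?_)⟩
  · rintro _ ⟨y, rfl⟩ hy
    rw [(map_eq_zero_iff _ h.1).1 hy, map_zero]
  · obtain ⟨y, hy⟩ := h.2 (g z)
    refine Submodule.mem_sup.2 ⟨f y, ⟨y, rfl⟩, z - f y, ?_, add_sub_cancel _ _⟩
    rw [LinearMap.mem_ker, map_sub, ← hy, LinearMap.comp_apply, sub_self]

theorem sub_mem_iSup_ne {Φ : Type*} {N : Φ → Submodule R M} {y : Φ →₀ M} (hy : ∀ l, y l ∈ N l)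
    (l : Φ) : (y.sum fun _ z => z) - y l ∈ ⨆ (l') (_ : l' ≠ l), N l' := by
  classical
  rw [← Finsupp.add_sum_erase' y l _ fun _ => rfl, add_sub_cancel_left]
  refine Submodule.sum_mem _ fun l' hl' => ?_
  rw [Finsupp.support_erase, Finset.mem_erase] at hl'
  dsimp only
  rw [Finsupp.erase_ne hl'.1]
  exact Submodule.mem_iSup_of_mem l' (Submodule.mem_iSup_of_mem hl'.1 (hy l'))

theorem injective_mkQ_comp_of_disjoint {N₁ N₂ : Submodule R M} (hN : Disjoint N₁ N₂)
    (e : Y ≃ₗ[R] N₁) : Function.Injective (N₂.mkQ ∘ₗ N₁.subtype ∘ₗ e.toLinearMap) := by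
  rw [injective_iff_map_eq_zero]
  intro z hz
  have hz₂ : (e z : M) ∈ N₂ := (Submodule.Quotient.mk_eq_zero N₂).1 hz
  have hz₀ := Submodule.disjoint_def.1 hN _ (e z).2 hz₂
  rwa [Submodule.coe_eq_zero, e.map_eq_zero_iff] at hz₀

theorem ker_liftQ_eq_range_mkQ_comp {N₁ N₂ : Submodule R M} {π : M →ₗ[R] W}
    (hπ : LinearMap.ker π = N₁ ⊔ N₂) (e : Y ≃ₗ[R] N₁) :
    LinearMap.ker (N₂.liftQ π (hπ ▸ le_sup_right)) =
      LinearMap.range (N₂.mkQ ∘ₗ N₁.subtype ∘ₗ e.toLinearMap) := by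
  rw [Submodule.ker_liftQ, hπ, Submodule.map_sup, Submodule.mkQ_map_self, sup_bot_eq,
    LinearMap.range_comp, LinearMap.range_comp, LinearEquiv.range, Submodule.map_top,
    Submodule.range_subtype]

end Complement

/-- Either the lift `m` of an element of `S` can be corrected within `N₁`, or a peak of the word
twists `N₁` into a complement of the other summands. -/
theorem dvd_or_exists_isCompl [Module k M] [IsScalarTower k (UAlg k ρ) M] (hρ : IsString ρ)
    [IsSimpleModule (UAlg k ρ) S] {N₁ N₂ : Submodule (UAlg k ρ) M} (hN : Disjoint N₁ N₂)
    {π : M →ₗ[UAlg k ρ] S} (hπ : LinearMap.ker π = N₁ ⊔ N₂)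
    (e : N₁ ≃ₗ[UAlg k ρ] StringModule k C) {f₁ : k[X]} (hf : Irreducible (1 + X * f₁))
    {F : Submodule (UAlg k ρ) M} (hF : F.FG) (hidem : ∀ m : M, idem k ρ (c.arrow 0).left • m ∈ F)
    {m : M} {y : N₁} (hm : aeval (c.elt k) (1 + X * f₁) • m - y ∈ N₂) (hpm : c.elt k • π m ≠ 0) :
    (∃ y' : N₁, y = aeval (c.elt k) (1 + X * f₁) • y') ∨
      ∃ s, C.IsPeakAt s c ∧ ∃ N : Submodule (UAlg k ρ) M, Nonempty (N ≃ₗ[UAlg k ρ] N₁) ∧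
        IsCompl N N₂ := by
  let ι₀ : StringModule k C →ₗ[UAlg k ρ] M := N₁.subtype ∘ₗ e.symm.toLinearMap
  have hι : Function.Injective (N₂.mkQ ∘ₗ ι₀) := injective_mkQ_comp_of_disjoint hN e.symm
  have hq := ker_liftQ_eq_range_mkQ_comp hπ e.symm
  have hmy : aeval (c.elt k) (1 + X * f₁) • N₂.mkQ m = (N₂.mkQ ∘ₗ ι₀) (e y) := by
    rw [← map_smul, ← sub_eq_zero, LinearMap.comp_apply, ← map_sub]
    refine (Submodule.Quotient.mk_eq_zero N₂).2 ?_
    simpa [ι₀] using hm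
  by_cases hagree : ∃ s, ∀ l, C.AgreesAt s c l
  · obtain ⟨s, hs⟩ := hagree
    refine (false_of_forall_agreesAt hρ hι hq hmy hpm hs (hF.map N₂.mkQ) fun z => ?_).elim
    obtain ⟨z, rfl⟩ := N₂.mkQ_surjective z
    exact ⟨_, hidem z, map_smul _ _ _⟩
  rcases dvd_or_exists_bijective_add_peakHom hρ hι hq hf hmy hpm hagree with
    ⟨y', hy'⟩ | ⟨s, t, h, x, hx⟩
  · exact Or.inl ⟨e.symm y', e.injective (by rw [hy', map_smul, e.apply_symm_apply])⟩
  · obtain ⟨x, rfl⟩ := N₂.mkQ_surjective x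
    rw [← comp_peakHom, ← LinearMap.comp_add] at hx
    have hinj : Function.Injective (ι₀ + peakHom k hρ h x) :=
      Function.Injective.of_comp (f := N₂.mkQ) hx.1
    refine Or.inr ⟨s, ⟨t, h⟩, LinearMap.range (ι₀ + peakHom k hρ h x),
      ⟨(LinearEquiv.ofInjective _ hinj).symm.trans e.symm⟩, ?_⟩
    simpa only [Submodule.ker_mkQ] using isCompl_range_ker_of_bijective_comp hx

theorem IsBandModule.exists_aeval_smul_sub_eq_zero (hS : IsBandModule k ρ S) (p : UAlg k ρ)
    (f₁ : k[X]) (y : S) :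
    ∃ (y' : S) (f : k[X]), f.eval 0 = 1 ∧ aeval p f • (y - aeval p (1 + X * f₁) • y') = 0 := by
  obtain ⟨C, n, h, V, _, _, hV, -, ⟨e⟩⟩ := hS
  let _ : Module k V := Module.compHom V (algebraMap k (LaurentPolynomial k))
  have : IsScalarTower k (LaurentPolynomial k) V := IsScalarTower.of_algebraMap_smul fun _ _ => rfl
  have : Module.Finite k V := hV
  let _ : Module k (BandModule k h V) := Module.compHom _ (algebraMap k (UAlg k ρ))
  have : IsScalarTower k (UAlg k ρ) (BandModule k h V) :=
    IsScalarTower.of_algebraMap_smul fun _ _ => rfl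
  have : Module.Finite k (BandModule k h V) := BandModule.finite h
  obtain ⟨g, hg, hgz⟩ := exists_aeval_smul_eq_zero_of_finite (k := k) (Y := BandModule k h V) p
  refine StringAlg.exists_aeval_smul_sub_eq_zero p f₁ hg ?_
  rw [← e.map_eq_zero_iff, map_smul, hgz]

theorem elt_smul_sub_sum_mem_primitiveTorsion (hρ : IsString ρ) (hP : IsPrimitiveCycle ρ P)
    (hc : c.Represents P) {Φ : Type*} {s : Finset Φ} {y y' : Φ → M} {f : Φ → k[X]} {f₁ : k[X]}
    {m : M} (hm : ∑ l ∈ s, y l = aeval (c.elt k) (1 + X * f₁) • m) (hf : ∀ l, (f l).eval 0 = 1)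
    (hy : ∀ l, aeval (c.elt k) (f l) • (y l - aeval (c.elt k) (1 + X * f₁) • y' l) = 0) :
    c.elt k • (m - ∑ l ∈ s, y' l) ∈ primitiveTorsion k ρ M := by
  classical
  have hzero : aeval (c.elt k) ((∏ l ∈ s, f l) * (1 + X * f₁)) • (m - ∑ l ∈ s, y' l) = 0 := by
    rw [map_mul, mul_smul, smul_sub, ← hm, Finset.smul_sum, ← Finset.sum_sub_distrib,
      Finset.smul_sum]
    refine Finset.sum_eq_zero fun l hl => ?_
    rw [← Finset.prod_erase_mul _ _ hl, map_mul, mul_smul, hy, smul_zero]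
  refine (elt_smul_mem_primitiveTorsion_iff hρ hP hc _).2
    ⟨(∏ l ∈ s, f l) * (1 + X * f₁), by simp [eval_prod, hf], ?_⟩
  rw [← smul_aeval_smul_comm, hzero, smul_zero]

theorem exists_peak_and_isCompl (hρ : IsString ρ) [IsSimpleModule (UAlg k ρ) S]
    (hS : primitiveTorsion k ρ S = Set.univ) (hfc : IsFinitelyControlled k ρ M)
    {π : M →ₗ[UAlg k ρ] S} (hπ : Function.Surjective π)
    (hτ : primitiveTorsion k ρ M ⊆ LinearMap.ker π)
    {Φ : Type*} {N : Φ → Submodule (UAlg k ρ) M} (hind : iSupIndep N)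
    (hsum : ⨆ l, N l = LinearMap.ker π)
    (hN : ∀ l, IsStringModule k ρ (N l) ∨ IsBandModule k ρ (N l))
    (hP : IsPrimitiveCycle ρ P) (hSP : IsSimpleOfCycle k ρ S P) :
    ∃ l, (∃ C : Word ρ, Nonempty (N l ≃ₗ[UAlg k ρ] StringModule k C) ∧ ∃ i, C.IsPeak P i) ∧
      ∃ N' : Submodule (UAlg k ρ) M, Nonempty (N' ≃ₗ[UAlg k ρ] N l) ∧
        IsCompl N' (⨆ (l') (_ : l' ≠ l), N l') := by
  let _ : Module k M := Module.compHom M (algebraMap k (UAlg k ρ))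
  have : IsScalarTower k (UAlg k ρ) M := IsScalarTower.of_algebraMap_smul fun _ _ => rfl
  have := IsSimpleModule.nontrivial (UAlg k ρ) S
  obtain ⟨c, hc⟩ := hP.exists_arrowCycle hρ
  obtain ⟨x, hx⟩ := hSP.exists_elt_smul_ne_zero hc
  obtain ⟨f₁, s, hf, hs, hfs⟩ := exists_irreducible_aeval_elt_smul_eq_zero hρ hP hc hS hx
  obtain ⟨m, rfl⟩ := hπ s
  obtain ⟨F, hF, hidem⟩ := hfc (idem k ρ (c.arrow 0).left) ⟨_, rfl⟩
  have hfm : aeval (c.elt k) (1 + X * f₁) • m ∈ ⨆ l, N l := by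
    rw [hsum, LinearMap.mem_ker, map_smul, hfs]
  obtain ⟨y, hy, hym⟩ := (Submodule.mem_iSup_iff_exists_finsupp N _).1 hfm
  by_contra! hno
  have hcorr : ∀ l, ∃ (y' : N l) (f : k[X]), f.eval 0 = 1 ∧
      aeval (c.elt k) f • (y l - aeval (c.elt k) (1 + X * f₁) • (y' : M)) = 0 := by
    intro l
    rcases hN l with ⟨C, ⟨e⟩⟩ | hband
    · have hker : LinearMap.ker π = N l ⊔ ⨆ (l') (_ : l' ≠ l), N l' := by
        rw [← hsum, iSup_split_single N l]
      rcases dvd_or_exists_isCompl (y := ⟨y l, hy l⟩) hρ (hind l) hker e hf hF hidem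
        (hym ▸ sub_mem_iSup_ne hy l) hs with ⟨y', hy'⟩ | ⟨s, hpeak, N', hN', hcompl⟩
      · refine ⟨y', 1, eval_one, ?_⟩
        rw [map_one, one_smul, sub_eq_zero]
        exact congrArg Subtype.val hy'
      · exact (hno l ⟨C, ⟨e⟩, _, hpeak.isPeak hc⟩ N' hN' hcompl).elim
    · obtain ⟨y', f, hf', hy'⟩ := hband.exists_aeval_smul_sub_eq_zero (c.elt k) f₁ ⟨y l, hy l⟩
      exact ⟨y', f, hf', congrArg Subtype.val hy'⟩
  choose y' f hf' hy' using hcorr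
  have hπy' : π (∑ l ∈ y.support, (y' l : M)) = 0 := by
    rw [← LinearMap.mem_ker, ← hsum]
    exact Submodule.sum_mem _ fun l _ => Submodule.mem_iSup_of_mem l (y' l).2
  have htors := hτ (elt_smul_sub_sum_mem_primitiveTorsion hρ hP hc hym hf' hy')
  rw [SetLike.mem_coe, LinearMap.mem_ker, map_smul, map_sub, hπy', sub_zero] at htors
  exact hs htors

end Extension

end StringAlg

end

theorem theoremt {k : Type*} [Field k] {Q : Type*} [Quiver Q] (ρ : Set (StringAlg.QPath Q))
    (hρ : StringAlg.IsString ρ)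
    {S : Type*} [AddCommGroup S] [Module (StringAlg.UAlg k ρ) S]
    (hS : StringAlg.IsPrimitiveSimple k ρ S)
    {M : Type*} [AddCommGroup M] [Module (StringAlg.UAlg k ρ) M]
    (hM : StringAlg.IsUnital k ρ M) (hfc : StringAlg.IsFinitelyControlled k ρ M)
    (N : Submodule (StringAlg.UAlg k ρ) M)
    (hτ : StringAlg.primitiveTorsion k ρ M ⊆ N)
    (hMN : Nonempty ((M ⧸ N) ≃ₗ[StringAlg.UAlg k ρ] S))
    {Φ : Type*} (N_ : Φ → Submodule (StringAlg.UAlg k ρ) M)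
    (hind : iSupIndep N_) (hsum : ⨆ l, N_ l = N)
    (hN : ∀ l, StringAlg.IsStringModule k ρ (N_ l) ∨ StringAlg.IsBandModule k ρ (N_ l)) :
    (∃ (a : Q) (P : Quiver.Path a a),
      StringAlg.IsPrimitiveCycle ρ P ∧ StringAlg.IsSimpleOfCycle k ρ S P) ∧
    ∀ (a : Q) (P : Quiver.Path a a),
      StringAlg.IsPrimitiveCycle ρ P → StringAlg.IsSimpleOfCycle k ρ S P →
      ∃ m : Φ,
        (∃ C : StringAlg.Word ρ,
          Nonempty (N_ m ≃ₗ[StringAlg.UAlg k ρ] StringAlg.StringModule k C) ∧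
          ∃ i : ℤ, C.IsPeak P i) ∧
        ∃ N' : Submodule (StringAlg.UAlg k ρ) M,
          Nonempty (N' ≃ₗ[StringAlg.UAlg k ρ] N_ m) ∧
          IsCompl N' (⨆ (l : Φ) (_ : l ≠ m), N_ l) := by
  obtain ⟨hSs, hSτ⟩ := hS
  obtain ⟨e⟩ := hMN
  have := IsSimpleModule.nontrivial (StringAlg.UAlg k ρ) S
  let π : M →ₗ[StringAlg.UAlg k ρ] S := e.toLinearMap ∘ₗ N.mkQ
  have hπ : Function.Surjective π := e.surjective.comp N.mkQ_surjective
  have hker : LinearMap.ker π = N := by rw [LinearEquiv.ker_comp, Submodule.ker_mkQ]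
  refine ⟨?_, fun a P hP hSP => ?_⟩
  · obtain ⟨a, P, x, hP, hx⟩ :=
      StringAlg.exists_pathElt_smul_ne_zero hρ (hM.of_surjective hπ) hSτ
    obtain ⟨c, hc⟩ := hP.exists_arrowCycle hρ
    rw [hc.pathElt_eq] at hx
    exact ⟨a, P, hP, StringAlg.isSimpleOfCycle_of_elt_smul_ne_zero hρ hP hc hSτ hx⟩
  · exact StringAlg.exists_peak_and_isCompl hρ hSτ hfc hπ (hker ▸ hτ) hind (hsum.trans hker.symm)
      hN hP hSP
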